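/- Let $n\ge 1$. Let $dV$ be Lebesgue measure on $\mathbb{C}^n$ normalized so that $\int_{\mathbb{C}^n} e^{-|z|^2}\,dV(z)=1$. For $0<p<\infty$ and real $\alpha$, let $F^p_\alpha$ be the space of all entire functions $f$ on $\mathbb{C}^n$ with $$\|f\|_{F^p_\alpha}:=\Big(\int_{\mathbb{C}^n}\big|f(z)e^{-|z|^2/2}\big|^p\,\frac{dV(z)}{(1+|z|)^{\alpha}}\Big)^{1/p}<\infty .$$ For an entire function $f$ with homogeneous expansion $f=\sum_{k\ge0}f_k$ ($f_k$ a homogeneous polynomial of degree $k$) and real $s$, put $f_s^-=\sum_{k\le|s|}f_k$ and $f_s^+=f-f_s^-$. For real $\sigma$ put $$(\psi,\varphi)_\sigma=\int_{\mathbb{C}^n}\psi(z)\overline{\varphi(z)}e^{-|z|^2}\,\frac{dV(z)}{|z|^\sigma},\qquad \langle f,g\rangle_\sigma=\begin{cases}(f,g)_\sigma & \text{if }\sigma<2n,\\ (f_{\sigma/2}^-,g_{\sigma/2}^-)_0+(f_{\sigma/2}^+,g_{\sigma/2}^+)_\sigma & \text{if }\sigma\ge 2n.\end{cases}$$ **Theorem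 5.5.** Let $1<p<\infty$, let $q$ be the conjugate exponent, $1/p+1/q=1$, and let $\alpha,\beta$ be real numbers. Then $(F^p_{\alpha p})^*=F^q_{\beta q}$, with equivalent norms, under the pairing $\langle\cdot,\cdot\rangle_{\alpha+\beta}$. That is: for all $f\in F^p_{\alpha p}$ and $g\in F^q_{\beta q}$ the integrals that define $\langle f,g\rangle_{\alpha+\beta}$ converge absolutely; the map $g\mapsto\langle\cdot,g\rangle_{\alpha+\beta}$ is a conjugate-linear bijection of $F^q_{\beta q}$ onto the space $(F^p_{\alpha p})^*$ of bounded linear functionals on $F^p_{\alpha p}$; and there is a constant $C>0$, depending only on $n,p,\alpha,\beta$, such that $$C^{-1}\|g\|_{F^q_{\beta q}}\le\big\|\langle\cdot,g\rangle_{\alpha+\beta}\big\|_{(F^p_{\alpha p})^*}\le C\|g\|_{F^q_{\beta q}}\qquad\text{for all } g\in F^q_{\beta q}.$$ -/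

import Mathlib

open MeasureTheory

noncomputable section

namespace Fock

/-- The volume measure `dV` on `ℂⁿ`, normalized so that `∫ exp (-|z|²) dV(z) = 1`
(see `integral_exp_neg_sq`). -/
def V (n : ℕ) : Measure (EuclideanSpace ℂ (Fin n)) :=
  ENNReal.ofReal (Real.pi ^ n)⁻¹ • (volume : Measure (EuclideanSpace ℂ (Fin n)))

theorem integral_exp_neg_sq (n : ℕ) : ∫ z, Real.exp (-‖z‖ ^ 2) ∂(V n) = 1 := by
  have h := GaussianFourier.integral_rexp_neg_mul_sq_norm
    (V := EuclideanSpace ℂ (Fin n)) (b := 1) one_pos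
  have hd : Module.finrank ℝ (EuclideanSpace ℂ (Fin n)) = 2 * n := by
    rw [(WithLp.linearEquiv 2 ℝ (Fin n → ℂ)).finrank_eq, Module.finrank_pi_fintype]
    simp [Complex.finrank_real_complex, mul_comm]
  rw [hd] at h
  have he : ((2 * n : ℕ) : ℝ) / 2 = (n : ℝ) := by push_cast; ring
  rw [he, Real.rpow_natCast, div_one] at h
  have hp : (0 : ℝ) < Real.pi ^ n := by positivity
  rw [V, integral_smul_measure, ENNReal.toReal_ofReal (by positivity)]
  simp only [neg_mul, one_mul] at h
  rw [h, smul_eq_mul, inv_mul_cancel₀ hp.ne']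

/-- The weighted measure `dV_α(z) = dV(z) / (1 + |z|)^α`. -/
def Vw (n : ℕ) (α : ℝ) : Measure (EuclideanSpace ℂ (Fin n)) :=
  (V n).withDensity fun z => ENNReal.ofReal ((1 + ‖z‖) ^ (-α))

/-- The weighted measure `dW_α(z) = dV(z) / |z|^α`. -/
def W (n : ℕ) (α : ℝ) : Measure (EuclideanSpace ℂ (Fin n)) :=
  (V n).withDensity fun z => ENNReal.ofReal (‖z‖ ^ (-α))

/-- The function `ψ(z) exp (-|z|²/2)`. -/
def gauss {n : ℕ} (ψ : EuclideanSpace ℂ (Fin n) → ℂ) : EuclideanSpace ℂ (Fin n) → ℂ :=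
  fun z => ψ z * (Real.exp (-‖z‖ ^ 2 / 2) : ℂ)

/-- The entire functions `f` on `ℂⁿ` with `∫ |f(z) exp (-|z|²/2)|^p dV_α(z) < ∞`,
as a vector space of functions (meant for `0 < p < ∞`). -/
def carrier (n : ℕ) (p α : ℝ) : Submodule ℂ (EuclideanSpace ℂ (Fin n) → ℂ) where
  carrier := {f | Differentiable ℂ f ∧ MemLp (gauss f) (ENNReal.ofReal p) (Vw n α)}
  zero_mem' := by
    refine ⟨differentiable_const 0, ?_⟩
    have h : gauss (0 : EuclideanSpace ℂ (Fin n) → ℂ) = 0 := by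
      funext z; simp [gauss]
    rw [h]
    exact MemLp.zero
  add_mem' := by
    rintro f g ⟨hf, hf'⟩ ⟨hg, hg'⟩
    refine ⟨hf.add hg, ?_⟩
    have h : gauss (f + g) = gauss f + gauss g := by
      funext z; simp [gauss, add_mul]
    rw [h]
    exact hf'.add hg'
  smul_mem' := by
    rintro c f ⟨hf, hf'⟩
    refine ⟨hf.const_smul c, ?_⟩
    have h : gauss (c • f) = c • gauss f := by
      funext z; simp [gauss, mul_assoc]
    rw [h]
    exact hf'.const_smul c

/-- The weighted Fock space `F^p_α(ℂⁿ)`. This is a type of its own, so that its topology is the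
one of its norm (defined below), not that of pointwise convergence. -/
def FockSpace (n : ℕ) (p α : ℝ) : Type := carrier n p α

namespace FockSpace

variable {n : ℕ} {p α : ℝ}

instance : AddCommGroup (FockSpace n p α) := inferInstanceAs (AddCommGroup (carrier n p α))

instance : Module ℂ (FockSpace n p α) := inferInstanceAs (Module ℂ (carrier n p α))

instance : CoeFun (FockSpace n p α) fun _ => EuclideanSpace ℂ (Fin n) → ℂ := ⟨fun f => f.1⟩

instance [h : Fact (1 < p)] : Fact (1 ≤ ENNReal.ofReal p) :=
  ⟨ENNReal.one_le_ofReal.2 h.out.le⟩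

/-- The embedding of `F^p_α` in an `L^p` space, `f ↦ f exp (-|·|²/2) ∈ L^p(dV_α)`. -/
def toLp (n : ℕ) (p α : ℝ) :
    FockSpace n p α →ₗ[ℂ] Lp ℂ (ENNReal.ofReal p) (Vw n α) where
  toFun f := MemLp.toLp (gauss f) f.2.2
  map_add' f g := by
    rw [← MemLp.toLp_add]
    congr 1
    funext z
    exact add_mul (f z) (g z) _
  map_smul' c f := by
    rw [RingHom.id_apply, ← MemLp.toLp_const_smul]
    congr 1
    funext z
    exact mul_assoc c (f z) _

theorem volume_absolutelyContinuous (n : ℕ) (α : ℝ) :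
    (volume : Measure (EuclideanSpace ℂ (Fin n))) ≪ Vw n α := by
  have h1 : (volume : Measure (EuclideanSpace ℂ (Fin n))) ≪ V n := by
    refine Measure.absolutelyContinuous_smul ?_
    have : (0 : ℝ) < (Real.pi ^ n)⁻¹ := by positivity
    simpa using this
  refine h1.trans (withDensity_absolutelyContinuous' ?_ ?_)
  · exact Measurable.aemeasurable (by fun_prop)
  · refine Filter.Eventually.of_forall fun z => ?_
    have : (0 : ℝ) < (1 + ‖z‖) ^ (-α) := by positivity
    simpa using this

theorem toLp_injective (n : ℕ) (p α : ℝ) : Function.Injective (toLp n p α) := by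
  intro f g h
  have h1 : gauss f =ᵐ[Vw n α] gauss g := (MemLp.toLp_eq_toLp_iff f.2.2 g.2.2).1 h
  have h2 := (volume_absolutelyContinuous n α).ae_le h1
  have hc : ∀ u : FockSpace n p α, Continuous (gauss u) := by
    intro u
    have := u.2.1.continuous
    unfold gauss
    fun_prop
  have h3 : gauss f = gauss g := (Continuous.ae_eq_iff_eq volume (hc f) (hc g)).1 h2
  refine Subtype.ext (funext fun z => ?_)
  have h4 := congrFun h3 z
  simp only [gauss] at h4
  exact mul_right_cancel₀ (by exact_mod_cast (Real.exp_pos _).ne') h4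

/-- The norm of `F^p_α` for `p > 1`, given by the formula in `norm_eq`. -/
instance [Fact (1 < p)] : NormedAddCommGroup (FockSpace n p α) :=
  NormedAddCommGroup.induced _ _ (toLp n p α) (toLp_injective n p α)

instance [Fact (1 < p)] : NormedSpace ℂ (FockSpace n p α) :=
  NormedSpace.induced ℂ _ _ (toLp n p α)

theorem norm_eq [hp : Fact (1 < p)] (f : FockSpace n p α) :
    ‖f‖ = (∫ z, ‖f z * (Real.exp (-‖z‖ ^ 2 / 2) : ℂ)‖ ^ p ∂(Vw n α)) ^ (1 / p) := by
  have hp0 : 0 < p := one_pos.trans hp.out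
  have h : ‖f‖ = ‖MemLp.toLp (gauss f) f.2.2‖ := rfl
  rw [h, Lp.norm_toLp, MemLp.eLpNorm_eq_integral_rpow_norm (by simpa using hp0)
    ENNReal.ofReal_ne_top f.2.2, ENNReal.toReal_ofReal hp0.le, one_div,
    ENNReal.toReal_ofReal (by positivity)]
  rfl

end FockSpace

/-- The homogeneous component `f_k` of degree `k` in the Taylor expansion `f = ∑ f_k` of an entire
function at the origin. -/
def homComp {n : ℕ} (f : EuclideanSpace ℂ (Fin n) → ℂ) (k : ℕ) :
    EuclideanSpace ℂ (Fin n) → ℂ :=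
  fun z => ((k.factorial : ℂ))⁻¹ * iteratedFDeriv ℂ k f 0 fun _ => z

/-- `f_s^- = ∑_{k ≤ |s|} f_k`. -/
def lowPart {n : ℕ} (s : ℝ) (f : EuclideanSpace ℂ (Fin n) → ℂ) : EuclideanSpace ℂ (Fin n) → ℂ :=
  fun z => ∑ k ∈ Finset.range (⌊|s|⌋₊ + 1), homComp f k z

/-- `f_s^+ = f - f_s^- = ∑_{k > |s|} f_k`. -/
def highPart {n : ℕ} (s : ℝ) (f : EuclideanSpace ℂ (Fin n) → ℂ) : EuclideanSpace ℂ (Fin n) → ℂ :=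
  fun z => f z - lowPart s f z

/-- The integrand `ψ(z) conj(φ(z)) exp (-|z|²)`. -/
def integrand {n : ℕ} (ψ φ : EuclideanSpace ℂ (Fin n) → ℂ) : EuclideanSpace ℂ (Fin n) → ℂ :=
  fun z => ψ z * (starRingEnd ℂ) (φ z) * (Real.exp (-‖z‖ ^ 2) : ℂ)

/-- `(ψ, φ)_σ = ∫ ψ conj(φ) exp (-|z|²) dW_σ`. -/
def intPairing {n : ℕ} (σ : ℝ) (ψ φ : EuclideanSpace ℂ (Fin n) → ℂ) : ℂ :=
  ∫ z, integrand ψ φ z ∂(W n σ)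

/-- The pairing `⟨f, g⟩_σ`: it is `(f, g)_σ` if `σ < 2n`, and
`(f_{σ/2}^-, g_{σ/2}^-)_0 + (f_{σ/2}^+, g_{σ/2}^+)_σ` if `σ ≥ 2n`. -/
def pairing {n : ℕ} (σ : ℝ) (f g : EuclideanSpace ℂ (Fin n) → ℂ) : ℂ :=
  if σ < 2 * n then intPairing σ f g
  else intPairing 0 (lowPart (σ / 2) f) (lowPart (σ / 2) g) +
    intPairing σ (highPart (σ / 2) f) (highPart (σ / 2) g)

/-- The integrals that define `⟨f, g⟩_σ` converge absolutely. -/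
def PairingConverges {n : ℕ} (σ : ℝ) (f g : EuclideanSpace ℂ (Fin n) → ℂ) : Prop :=
  if σ < 2 * n then Integrable (integrand f g) (W n σ)
  else Integrable (integrand (lowPart (σ / 2) f) (lowPart (σ / 2) g)) (W n 0) ∧
    Integrable (integrand (highPart (σ / 2) f) (highPart (σ / 2) g)) (W n σ)

end Fock

end

/-!
A bounded functional `L` on `F^p_{αp}` is determined by its values on the kernels `z ↦ e^{z·w̄}`,
and `g₀(w) = conj (L (e^{·w̄}))` is entire. The Gaussian projection onto entire functions is bounded
on the weighted `L^p` spaces, so the converse of Hölder's inequality puts `g₀` into `F^q_{-αq}`,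
with `L = (·, g₀)_0`.

For homogeneous polynomials of degree `k`, integration in polar coordinates shows that
`⟨·, ·⟩_σ = c_k (·, ·)_0`, where `c_k = Γ(n + k - σ/2) / Γ(n + k)` for all but finitely many `k`.
Hence, with `σ = α + β`, the function representing `L` under `⟨·, ·⟩_σ` has to be `∑ c_k⁻¹ (g₀)_k`.
It lies in `F^q_{βq}` because the multiplier `c_k⁻¹` is a composition of operators
`x + ∑ z_j ∂_j`, each of which costs a factor `(1 + |z|)²`, with a fractional integration along
rays of order `δ`, which gains `(1 + |z|)^{2δ}`.
-/

noncomputable section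

namespace Fock

open Filter Topology
open scoped ENNReal NNReal ContDiff

/-! ### Inequalities in Lebesgue spaces -/

section Analysis

lemma exists_exp_mul_rpow_le (A b : ℝ) {c : ℝ} (hc : 0 < c) :
    ∃ C : ℝ, 0 < C ∧ ∀ r : ℝ, 0 ≤ r →
      Real.exp (A * r) * (1 + r) ^ b ≤ C * Real.exp (c * r ^ 2) := by
  refine ⟨Real.exp ((|A| + |b|) ^ 2 / (4 * c)), Real.exp_pos _, fun r hr => ?_⟩
  have hpow : (1 + r) ^ b ≤ Real.exp (|b| * r) :=
    calc (1 + r) ^ b ≤ (1 + r) ^ |b| :=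
          Real.rpow_le_rpow_of_exponent_le (by linarith) (le_abs_self b)
      _ ≤ Real.exp r ^ |b| := by gcongr; linarith [Real.add_one_le_exp r]
      _ = Real.exp (|b| * r) := by rw [← Real.exp_mul, mul_comm]
  have hsq : (|A| + |b|) * r ≤ (|A| + |b|) ^ 2 / (4 * c) + c * r ^ 2 := by
    have hdiff : (|A| + |b|) ^ 2 / (4 * c) + c * r ^ 2 - (|A| + |b|) * r =
        ((|A| + |b|) - 2 * c * r) ^ 2 / (4 * c) := by field_simp; ring
    linarith [show 0 ≤ ((|A| + |b|) - 2 * c * r) ^ 2 / (4 * c) by positivity]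
  have hA : A * r ≤ |A| * r := mul_le_mul_of_nonneg_right (le_abs_self A) hr
  calc Real.exp (A * r) * (1 + r) ^ b ≤ Real.exp (A * r) * Real.exp (|b| * r) := by gcongr
    _ ≤ Real.exp ((|A| + |b|) ^ 2 / (4 * c) + c * r ^ 2) := by
      rw [← Real.exp_add]
      exact Real.exp_le_exp.2 (by linarith)
    _ = _ := Real.exp_add _ _

lemma norm_ofReal_exp (x : ℝ) : ‖(Real.exp x : ℂ)‖ = Real.exp x := by
  rw [Complex.norm_real, Real.norm_of_nonneg (Real.exp_pos _).le]

lemma one_add_norm_le_mul {E : Type*} [SeminormedAddCommGroup E] (z w : E) :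
    1 + ‖z‖ ≤ (1 + ‖w‖) * (1 + ‖z - w‖) := by
  have : ‖z‖ ≤ ‖w‖ + ‖z - w‖ := norm_le_norm_add_norm_sub' z w
  nlinarith [norm_nonneg w, norm_nonneg (z - w)]

lemma one_add_norm_rpow_le {E : Type*} [SeminormedAddCommGroup E] (a : ℝ) (z w : E) :
    (1 + ‖z‖) ^ a ≤ (1 + ‖w‖) ^ a * (1 + ‖z - w‖) ^ |a| := by
  have hz : 0 < 1 + ‖z‖ := by positivity
  have hw : 0 < 1 + ‖w‖ := by positivity
  rcases le_total 0 a with ha | ha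
  · rw [abs_of_nonneg ha, ← Real.mul_rpow (by positivity) (by positivity)]
    exact Real.rpow_le_rpow hz.le (one_add_norm_le_mul z w) ha
  · have h : (1 + ‖w‖) ^ (-a) ≤ ((1 + ‖z‖) * (1 + ‖z - w‖)) ^ (-a) := by
      refine Real.rpow_le_rpow hw.le ?_ (neg_nonneg.2 ha)
      simpa only [norm_sub_rev z w] using one_add_norm_le_mul w z
    rw [Real.mul_rpow (by positivity) (by positivity), Real.rpow_neg hw.le, Real.rpow_neg hz.le]
      at h
    rwa [abs_of_nonpos ha, ← inv_mul_le_iff₀ (by positivity), mul_comm,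
      ← le_inv_mul_iff₀ (by positivity)]

variable {X : Type*} [MeasurableSpace X] {μ : Measure X}

lemma lintegral_mul_rpow_le {p : ℝ} (hp : 1 ≤ p) {f ψ : X → ℝ≥0∞} (hf : Measurable f)
    (hψ : Measurable ψ) :
    (∫⁻ x, f x * ψ x ∂μ) ^ p ≤ (∫⁻ x, ψ x ∂μ) ^ (p - 1) * ∫⁻ x, f x ^ p * ψ x ∂μ := by
  have hp0 : 0 < p := one_pos.trans_le hp
  have hmul : ∀ {g : X → ℝ≥0∞}, Measurable g →
      ∫⁻ x, g x ∂(μ.withDensity ψ) = ∫⁻ x, g x * ψ x ∂μ := fun hg => by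
    rw [lintegral_withDensity_eq_lintegral_mul _ hψ hg]
    exact lintegral_congr fun x => mul_comm _ _
  have h := eLpNorm'_le_eLpNorm'_mul_rpow_measure_univ (μ := μ.withDensity ψ) one_pos hp
    hf.aestronglyMeasurable
  simp only [eLpNorm', enorm_eq_self, ENNReal.rpow_one, div_one, hmul hf,
    hmul (hf.pow_const p), withDensity_apply _ MeasurableSet.univ, Measure.restrict_univ] at h
  calc _ ≤ _ := ENNReal.rpow_le_rpow h hp0.le
    _ = _ := by
      rw [ENNReal.mul_rpow_of_nonneg _ _ hp0.le, ← ENNReal.rpow_mul, ← ENNReal.rpow_mul,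
        one_div_mul_cancel hp0.ne', ENNReal.rpow_one, mul_comm, sub_mul, one_mul,
        one_div_mul_cancel hp0.ne']

theorem lintegral_conv_rpow_le {G : Type*} [AddCommGroup G] [MeasurableSpace G]
    [MeasurableAdd₂ G] [MeasurableNeg G] {μ : Measure G} [SFinite μ] [μ.IsAddLeftInvariant]
    [μ.IsNegInvariant] {p : ℝ} (hp : 1 ≤ p) {ψ f : G → ℝ≥0∞} (hψ : Measurable ψ)
    (hf : Measurable f) :
    ∫⁻ z, (∫⁻ w, f w * ψ (z - w) ∂μ) ^ p ∂μ ≤ (∫⁻ z, ψ z ∂μ) ^ p * ∫⁻ w, f w ^ p ∂μ := by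
  set I := ∫⁻ z, ψ z ∂μ
  have hpointwise : ∀ z, (∫⁻ w, f w * ψ (z - w) ∂μ) ^ p ≤
      I ^ (p - 1) * ∫⁻ w, f w ^ p * ψ (z - w) ∂μ := fun z => by
    simpa only [lintegral_sub_left_eq_self ψ z] using
      lintegral_mul_rpow_le (μ := μ) (ψ := fun w => ψ (z - w)) hp hf (by fun_prop)
  calc ∫⁻ z, (∫⁻ w, f w * ψ (z - w) ∂μ) ^ p ∂μ
      ≤ ∫⁻ z, I ^ (p - 1) * ∫⁻ w, f w ^ p * ψ (z - w) ∂μ ∂μ := lintegral_mono hpointwise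
    _ = I ^ (p - 1) * ∫⁻ w, ∫⁻ z, f w ^ p * ψ (z - w) ∂μ ∂μ := by
      have hmeas : Measurable fun x : G × G => f x.2 ^ p * ψ (x.1 - x.2) := by fun_prop
      rw [lintegral_const_mul _ hmeas.lintegral_prod_right',
        lintegral_lintegral_swap hmeas.aemeasurable]
    _ = I ^ (p - 1) * ∫⁻ w, f w ^ p * I ∂μ := by
      congr 1
      refine lintegral_congr fun w => ?_
      rw [lintegral_const_mul _ (by fun_prop), lintegral_sub_right_eq_self ψ w]
    _ = I ^ p * ∫⁻ w, f w ^ p ∂μ := by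
      rw [lintegral_mul_const _ (by fun_prop), mul_comm (∫⁻ w, f w ^ p ∂μ), ← mul_assoc]
      congr 1
      nth_rewrite 2 [← ENNReal.rpow_one I]
      rw [← ENNReal.rpow_add_of_nonneg _ _ (sub_nonneg.2 hp) zero_le_one, sub_add_cancel]

theorem eLpNorm_conv_le {G : Type*} [AddCommGroup G] [MeasurableSpace G]
    [MeasurableAdd₂ G] [MeasurableNeg G] {μ : Measure G} [SFinite μ] [μ.IsAddLeftInvariant]
    [μ.IsNegInvariant] {p : ℝ} (hp : 1 ≤ p) {ψ f : G → ℝ≥0∞} (hψ : Measurable ψ)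
    (hf : Measurable f) :
    eLpNorm (fun z => ∫⁻ w, f w * ψ (z - w) ∂μ) (ENNReal.ofReal p) μ ≤
      (∫⁻ z, ψ z ∂μ) * eLpNorm f (ENNReal.ofReal p) μ := by
  have hp0 : 0 < p := one_pos.trans_le hp
  simp only [eLpNorm_eq_lintegral_rpow_enorm_toReal (by simpa using hp0) ENNReal.ofReal_ne_top,
    ENNReal.toReal_ofReal hp0.le, enorm_eq_self]
  refine (ENNReal.rpow_le_rpow (lintegral_conv_rpow_le hp hψ hf) (by positivity)).trans_eq ?_
  rw [ENNReal.mul_rpow_of_nonneg _ _ (by positivity), ← ENNReal.rpow_mul,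
    mul_one_div_cancel hp0.ne', ENNReal.rpow_one]

lemma rpow_one_div_le_of_le_mul_rpow {p q : ℝ} (hpq : p.HolderConjugate q) {A C : ℝ≥0∞}
    (hA : A ≠ ⊤) (h : A ≤ C * A ^ (1 / p)) : A ^ (1 / q) ≤ C := by
  rcases eq_or_ne A 0 with rfl | hA0
  · simp [hpq.symm.pos]
  have hsplit : A ^ (1 / q) * A ^ (1 / p) = A := by
    rw [← ENNReal.rpow_add _ _ hA0 hA, one_div, one_div, add_comm, hpq.inv_add_inv_eq_one,
      ENNReal.rpow_one]
  have hne : A ^ (1 / p) ≠ 0 := by simp [ENNReal.rpow_eq_zero_iff, hA0, hA]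
  have hnt : A ^ (1 / p) ≠ ⊤ := ENNReal.rpow_ne_top_of_nonneg (one_div_nonneg.2 hpq.pos.le) hA
  exact (ENNReal.mul_le_mul_iff_left hne hnt).1 (hsplit.trans_le h)

lemma norm_conj_mul_rpow {q : ℝ} (hq : 1 < q) (t : ℂ) :
    ‖(starRingEnd ℂ) t * (‖t‖ ^ (q - 2) : ℝ)‖ = ‖t‖ ^ (q - 1) := by
  rcases eq_or_ne t 0 with rfl | ht
  · simp [Real.zero_rpow (sub_pos.2 hq).ne']
  · rw [norm_mul, RCLike.norm_conj, Complex.norm_real, Real.norm_of_nonneg (by positivity),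
      ← Real.rpow_one_add' (norm_nonneg t) (by linarith)]
    ring_nf

lemma conj_mul_rpow_mul_self {q : ℝ} (hq : 1 < q) (t : ℂ) :
    (starRingEnd ℂ) t * (‖t‖ ^ (q - 2) : ℝ) * t = (‖t‖ ^ q : ℝ) := by
  rw [mul_right_comm, Complex.conj_mul', ← Complex.ofReal_pow, ← Complex.ofReal_mul,
    ← Real.rpow_natCast, ← Real.rpow_add' (norm_nonneg t) (by push_cast; linarith)]
  congr 2
  push_cast
  ring

lemma eLpNorm_indicator_conj_mul_rpow {p q : ℝ} (hpq : p.HolderConjugate q) (T : X → ℂ) {K : Set X}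
    (hK : MeasurableSet K) :
    eLpNorm (K.indicator fun x => (starRingEnd ℂ) (T x) * (‖T x‖ ^ (q - 2) : ℝ))
      (ENNReal.ofReal p) μ = (∫⁻ x in K, ‖T x‖ₑ ^ q ∂μ) ^ (1 / p) := by
  rw [eLpNorm_indicator_eq_eLpNorm_restrict hK,
    eLpNorm_eq_lintegral_rpow_enorm_toReal (by simpa using hpq.pos) ENNReal.ofReal_ne_top,
    ENNReal.toReal_ofReal hpq.nonneg]
  congr 1
  refine lintegral_congr fun x => ?_
  rw [← ofReal_norm, norm_conj_mul_rpow hpq.symm.lt, ENNReal.ofReal_rpow_of_nonneg (by positivity)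
    hpq.nonneg, ← Real.rpow_mul (norm_nonneg _), hpq.symm.sub_one_mul_conj,
    ← ENNReal.ofReal_rpow_of_nonneg (norm_nonneg _) hpq.symm.nonneg, ofReal_norm]

/-- The bounded measurable functions of compact support, which test membership in `L^q`. -/
structure IsTestFunction {X E : Type*} [TopologicalSpace X] [MeasurableSpace X]
    [NormedAddCommGroup E] [MeasurableSpace E] (φ : X → E) : Prop where
  measurable : Measurable φ
  hasCompactSupport : HasCompactSupport φ
  bounded : ∃ M, ∀ x, ‖φ x‖ ≤ M

lemma isTestFunction_indicator_of_continuousOn_norm_le {X E : Type*} [TopologicalSpace X]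
    [T2Space X] [MeasurableSpace X] [OpensMeasurableSpace X] [NormedAddCommGroup E]
    [MeasurableSpace E] {K : Set X} (hK : IsCompact K) {φ : X → E} (hφ : Measurable φ) {b : X → ℝ}
    (hb : ContinuousOn b K) (h : ∀ x, ‖φ x‖ ≤ b x) : IsTestFunction (K.indicator φ) where
  measurable := hφ.indicator hK.measurableSet
  hasCompactSupport := HasCompactSupport.intro hK fun _ hx => Set.indicator_of_notMem hx φ
  bounded := by
    obtain ⟨M, hM⟩ := hK.exists_bound_of_continuousOn hb
    refine ⟨max M 0, fun x => ?_⟩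
    by_cases hx : x ∈ K
    · rw [Set.indicator_of_mem hx]
      exact (h x).trans ((le_abs_self _).trans ((hM x hx).trans (le_max_left _ _)))
    · rw [Set.indicator_of_notMem hx, norm_zero]
      exact le_max_right _ _

lemma IsTestFunction.smul {X : Type*} [TopologicalSpace X] [T2Space X] [MeasurableSpace X]
    [OpensMeasurableSpace X] {φ : X → ℂ} (hφ : IsTestFunction φ) {v : X → ℝ} (hv : Continuous v) :
    IsTestFunction fun x => v x • φ x := by
  obtain ⟨M, hM⟩ := hφ.bounded
  have hindicator : (tsupport φ).indicator (fun x => v x • φ x) = fun x => v x • φ x :=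
    Set.indicator_eq_self.2
      ((Function.support_smul_subset_right (f := v) (g := φ)).trans (subset_tsupport φ))
  rw [← hindicator]
  refine isTestFunction_indicator_of_continuousOn_norm_le hφ.hasCompactSupport.isCompact
    (hv.measurable.smul hφ.measurable) (b := fun x => ‖v x‖ * M) (by fun_prop) fun x => ?_
  rw [norm_smul]
  gcongr
  exact hM x

lemma IsTestFunction.integrable_smul {X E : Type*} [TopologicalSpace X] [T2Space X]
    [MeasurableSpace X] [OpensMeasurableSpace X] {μ : Measure X} [IsFiniteMeasureOnCompacts μ]
    [NormedAddCommGroup E] [NormedSpace ℂ E] {φ : X → ℂ} (hφ : IsTestFunction φ) {v : X → E}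
    (hv : Continuous v) : Integrable (fun x => φ x • v x) μ := by
  obtain ⟨M, hM⟩ := hφ.bounded
  have hloc : IntegrableOn (fun x => φ x • v x) (tsupport φ) μ :=
    Integrable.bdd_smul (hv.continuousOn.integrableOn_compact hφ.hasCompactSupport.isCompact) M
      hφ.measurable.aestronglyMeasurable (Eventually.of_forall hM)
  exact (integrableOn_iff_integrable_of_support_subset
    ((Function.support_smul_subset_left _ _).trans (subset_tsupport φ))).1 hloc

section ConverseHoelder

variable {X : Type*} [TopologicalSpace X] [T2Space X] [MeasurableSpace X] [OpensMeasurableSpace X]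
  {μ : Measure X} {p q : ℝ}

lemma setLIntegral_rpow_le_of_forall_enorm_integral_mul_le [IsFiniteMeasureOnCompacts μ]
    (hpq : p.HolderConjugate q) {T : X → ℂ} (hT : Continuous T) {C : ℝ≥0∞}
    (h : ∀ φ : X → ℂ, IsTestFunction φ →
      ‖∫ x, φ x * T x ∂μ‖ₑ ≤ C * eLpNorm φ (ENNReal.ofReal p) μ) {K : Set X} (hK : IsCompact K) :
    (∫⁻ x in K, ‖T x‖ₑ ^ q ∂μ) ^ (1 / q) ≤ C := by
  have hq : 1 < q := hpq.symm.lt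
  have hint : IntegrableOn (fun x => ‖T x‖ ^ q) K μ :=
    (hT.norm.rpow_const fun _ => .inr hpq.symm.nonneg).continuousOn.integrableOn_compact hK
  have hofReal : ENNReal.ofReal (∫ x in K, ‖T x‖ ^ q ∂μ) = ∫⁻ x in K, ‖T x‖ₑ ^ q ∂μ := by
    rw [ofReal_integral_eq_lintegral_ofReal hint (Eventually.of_forall fun x => by positivity)]
    exact lintegral_congr fun x => by
      rw [← ENNReal.ofReal_rpow_of_nonneg (norm_nonneg _) hpq.symm.nonneg, ofReal_norm]
  set φ : X → ℂ := fun x => (starRingEnd ℂ) (T x) * (‖T x‖ ^ (q - 2) : ℝ)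
  have hφ : Measurable φ := by
    have := hT.measurable
    fun_prop
  have htest : IsTestFunction (K.indicator φ) :=
    isTestFunction_indicator_of_continuousOn_norm_le hK hφ
      (hT.norm.rpow_const fun _ => .inr (sub_pos.2 hq).le).continuousOn
      fun x => (norm_conj_mul_rpow hq (T x)).le
  have hpair : ‖∫ x, K.indicator φ x * T x ∂μ‖ₑ = ∫⁻ x in K, ‖T x‖ₑ ^ q ∂μ := by
    have hmul : ∀ x, K.indicator φ x * T x = K.indicator (fun x => ((‖T x‖ ^ q : ℝ) : ℂ)) x :=
      fun x => by
        rw [← Set.indicator_mul_left]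
        exact congrArg (K.indicator · x) (funext fun y => conj_mul_rpow_mul_self hq (T y))
    simp_rw [hmul]
    rw [integral_indicator hK.measurableSet, integral_complex_ofReal, ← ofReal_norm,
      Complex.norm_real, Real.norm_of_nonneg (integral_nonneg fun x => by positivity), hofReal]
  refine rpow_one_div_le_of_le_mul_rpow hpq (hofReal ▸ ENNReal.ofReal_ne_top) ?_
  rw [← eLpNorm_indicator_conj_mul_rpow hpq T hK.measurableSet, ← hpair]
  exact h _ htest

theorem eLpNorm_le_of_forall_enorm_integral_mul_le [SigmaCompactSpace X]
    [IsFiniteMeasureOnCompacts μ] (hpq : p.HolderConjugate q) {T : X → ℂ} (hT : Continuous T)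
    {C : ℝ≥0∞} (h : ∀ φ : X → ℂ, IsTestFunction φ →
      ‖∫ x, φ x * T x ∂μ‖ₑ ≤ C * eLpNorm φ (ENNReal.ofReal p) μ) :
    eLpNorm T (ENNReal.ofReal q) μ ≤ C := by
  have hcover : AECover μ atTop (compactCovering X) :=
    { ae_eventually_mem := Eventually.of_forall fun x => by
        obtain ⟨k, hk⟩ := Set.mem_iUnion.1 ((iUnion_compactCovering X).symm ▸ Set.mem_univ x)
        exact eventually_atTop.2 ⟨k, fun m hm => compactCovering_subset X hm hk⟩
      measurableSet := fun k => (isCompact_compactCovering X k).measurableSet }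
  have hlim := hcover.lintegral_tendsto_of_countably_generated (f := fun x => ‖T x‖ₑ ^ q)
    (hT.measurable.enorm.pow_const q).aemeasurable
  rw [eLpNorm_eq_lintegral_rpow_enorm_toReal (by simpa using hpq.symm.pos) ENNReal.ofReal_ne_top,
    ENNReal.toReal_ofReal hpq.symm.nonneg]
  exact le_of_tendsto' (hlim.ennrpow_const (1 / q)) fun k =>
    setLIntegral_rpow_le_of_forall_enorm_integral_mul_le hpq hT h (isCompact_compactCovering X k)

end ConverseHoelder

end Analysis

/-! ### Weighted norms -/

/-- The space `ℂⁿ` with its Euclidean norm. -/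
abbrev Cn (n : ℕ) : Type := EuclideanSpace ℂ (Fin n)

variable {n : ℕ} {p q a b : ℝ}

instance isAddHaarMeasure_V (n : ℕ) : (V n).IsAddHaarMeasure :=
  Measure.IsAddHaarMeasure.smul _ (ENNReal.ofReal_pos.2 (by positivity)).ne' ENNReal.ofReal_ne_top

/-- The density `exp (-|z|²/2) (1 + |z|)^(-a)`, whose product with an entire function lies in
`L^p(dV)` when the function belongs to `F^p_{ap}`. -/
def weight (a : ℝ) (z : Cn n) : ℝ := Real.exp (-‖z‖ ^ 2 / 2) * (1 + ‖z‖) ^ (-a)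

lemma weight_pos (a : ℝ) (z : Cn n) : 0 < weight a z := by
  unfold weight
  positivity

@[fun_prop] lemma continuous_weight (a : ℝ) : Continuous (weight a : Cn n → ℝ) :=
  (by fun_prop : Continuous fun z : Cn n => Real.exp (-‖z‖ ^ 2 / 2)).mul
    ((by fun_prop : Continuous fun z : Cn n => 1 + ‖z‖).rpow_const fun _ => .inl (by positivity))

lemma weight_mul_weight (a b : ℝ) (z : Cn n) :
    weight a z * weight b z = Real.exp (-‖z‖ ^ 2) * (1 + ‖z‖) ^ (-(a + b)) := by
  rw [weight, weight, neg_add, Real.rpow_add (by positivity), mul_mul_mul_comm, ← Real.exp_add,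
    add_halves]

lemma weight_mul_weight_neg (a : ℝ) (z : Cn n) :
    weight a z * weight (-a) z = Real.exp (-‖z‖ ^ 2) := by
  rw [weight_mul_weight, add_neg_cancel, neg_zero, Real.rpow_zero, mul_one]

/-- The norm of `F exp (-|·|²/2) (1 + |·|)^(-a)` in `L^p(dV)`, for arbitrary functions `F`. The
norm of `F^p_{ap}` is its restriction to entire functions (see `wnorm_coe`). -/
def wnorm (p a : ℝ) (F : Cn n → ℂ) : ℝ≥0∞ :=
  eLpNorm (fun z => weight a z • F z) (ENNReal.ofReal p) (V n)

lemma enorm_weight_smul (a : ℝ) (z : Cn n) (c : ℂ) :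
    ‖weight a z • c‖ₑ = ENNReal.ofReal (weight a z) * ‖c‖ₑ := by
  rw [enorm_smul, Real.enorm_of_nonneg (weight_pos a z).le]

lemma wnorm_le_mul (p a : ℝ) {F G : Cn n → ℂ} {C : ℝ≥0} (h : ∀ z, ‖F z‖ₑ ≤ C * ‖G z‖ₑ) :
    wnorm p a F ≤ C * wnorm p a G := by
  refine eLpNorm_le_nnreal_smul_eLpNorm_of_ae_le_mul' (Eventually.of_forall fun z => ?_) _
  rw [enorm_weight_smul, enorm_weight_smul, mul_left_comm]
  gcongr
  exact h z

lemma eLpNorm_gauss (hp : 0 < p) (a : ℝ) (F : Cn n → ℂ) :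
    eLpNorm (gauss F) (ENNReal.ofReal p) (Vw n (a * p)) = wnorm p a F := by
  have hp' : ENNReal.ofReal p ≠ 0 := by simpa using hp
  have hdensity : ∀ z : Cn n, ENNReal.ofReal ((1 + ‖z‖) ^ (-(a * p))) * ‖gauss F z‖ₑ ^ p =
      ‖weight a z • F z‖ₑ ^ p := fun z => by
    rw [enorm_weight_smul, gauss, enorm_mul, ← ofReal_norm (Complex.ofReal _), norm_ofReal_exp,
      ← neg_mul, Real.rpow_mul (by positivity), ← ENNReal.ofReal_rpow_of_nonneg (by positivity)
      hp.le, ← ENNReal.mul_rpow_of_nonneg _ _ hp.le, weight, ENNReal.ofReal_mul (by positivity)]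
    ring_nf
  rw [wnorm, eLpNorm_eq_lintegral_rpow_enorm_toReal hp' ENNReal.ofReal_ne_top,
    eLpNorm_eq_lintegral_rpow_enorm_toReal hp' ENNReal.ofReal_ne_top, ENNReal.toReal_ofReal hp.le,
    Vw, lintegral_withDensity_eq_lintegral_mul_non_measurable _ (by fun_prop)
      (Eventually.of_forall fun z => ENNReal.ofReal_lt_top)]
  exact congrArg (· ^ (1 / p)) (lintegral_congr hdensity)

lemma mem_carrier (hp : 0 < p) {F : Cn n → ℂ} (hF : Differentiable ℂ F) (h : wnorm p a F ≠ ⊤) :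
    F ∈ carrier n p (a * p) := by
  have hcont : Continuous (gauss F) := by
    have := hF.continuous
    unfold gauss
    fun_prop
  exact ⟨hF, hcont.aestronglyMeasurable, (eLpNorm_gauss hp a F).trans_lt h.lt_top⟩

/-- An entire function of finite norm as an element of the Fock space. -/
def mkFock [hp : Fact (1 < p)] (F : Cn n → ℂ) (hF : Differentiable ℂ F) (h : wnorm p a F ≠ ⊤) :
    FockSpace n p (a * p) :=
  ⟨F, mem_carrier (one_pos.trans hp.out) hF h⟩

lemma wnorm_coe [hp : Fact (1 < p)] (f : FockSpace n p (a * p)) : wnorm p a f = ‖f‖ₑ := by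
  have h : ‖f‖ = ‖MemLp.toLp (gauss f) f.2.2‖ := rfl
  rw [← ofReal_norm, h, Lp.norm_toLp, ENNReal.ofReal_toReal f.2.2.2.ne,
    eLpNorm_gauss (one_pos.trans hp.out)]

namespace FockSpace

lemma ext {f g : FockSpace n p a} (h : ∀ z, f z = g z) : f = g :=
  Subtype.ext (funext h)

lemma differentiable (f : FockSpace n p a) : Differentiable ℂ f := f.2.1

lemma continuous (f : FockSpace n p a) : Continuous f := f.2.1.continuous

@[simp] lemma sub_apply (f g : FockSpace n p a) (z : Cn n) : (f - g) z = f z - g z := rfl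

@[simp] lemma smul_apply (c : ℂ) (f : FockSpace n p a) (z : Cn n) : (c • f) z = c * f z := rfl

lemma wnorm_ne_top [Fact (1 < p)] (f : FockSpace n p (a * p)) : wnorm p a f ≠ ⊤ := by
  rw [wnorm_coe]
  exact enorm_ne_top

end FockSpace

lemma norm_le_of_wnorm_le [Fact (1 < p)] (f : FockSpace n p (a * p)) {C : ℝ≥0} {M : ℝ}
    (hM : 0 ≤ M) (h : wnorm p a f ≤ C * ENNReal.ofReal M) : ‖f‖ ≤ C * M := by
  rwa [wnorm_coe, ← ofReal_norm, ← ENNReal.ofReal_coe_nnreal, ← ENNReal.ofReal_mul C.coe_nonneg,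
    ENNReal.ofReal_le_ofReal_iff (by positivity)] at h

theorem lintegral_mul_weight_le (hpq : p.HolderConjugate q) (a b : ℝ) {F G : Cn n → ℂ}
    (hF : AEMeasurable F (V n)) (hG : AEMeasurable G (V n)) :
    ∫⁻ z, ‖F z‖ₑ * ‖G z‖ₑ * ENNReal.ofReal (weight a z * weight b z) ∂(V n) ≤
      wnorm p a F * wnorm q b G := by
  rw [wnorm, wnorm, eLpNorm_eq_lintegral_rpow_enorm_toReal (by simpa using hpq.pos)
    ENNReal.ofReal_ne_top, eLpNorm_eq_lintegral_rpow_enorm_toReal (by simpa using hpq.symm.pos)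
    ENNReal.ofReal_ne_top, ENNReal.toReal_ofReal hpq.nonneg, ENNReal.toReal_ofReal hpq.symm.nonneg]
  refine le_of_eq_of_le (lintegral_congr fun z => ?_) (ENNReal.lintegral_mul_le_Lp_mul_Lq (V n) hpq
    (f := fun z => ‖weight a z • F z‖ₑ) (g := fun z => ‖weight b z • G z‖ₑ)
    (by fun_prop) (by fun_prop))
  rw [Pi.mul_apply, enorm_weight_smul, enorm_weight_smul, ENNReal.ofReal_mul (weight_pos a z).le]
  ring

lemma integrable_exp_neg_mul_norm_sq {c : ℝ} (hc : 0 < c) :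
    Integrable (fun z : Cn n => Real.exp (-c * ‖z‖ ^ 2)) (V n) := by
  refine Integrable.smul_measure ?_ ENNReal.ofReal_ne_top
  simpa [Complex.norm_exp, ← Complex.ofReal_pow] using
    (GaussianFourier.integrable_cexp_neg_mul_sq_norm_add (V := Cn n) (b := c)
      (by simpa using hc) 0 0).norm

lemma memLp_exp_neg_mul_norm_sq {c : ℝ} (hc : 0 < c) (hp : 0 < p) :
    MemLp (fun z : Cn n => Real.exp (-c * ‖z‖ ^ 2)) (ENNReal.ofReal p) (V n) := by
  rw [← integrable_norm_rpow_iff (by fun_prop) (by simpa using hp) ENNReal.ofReal_ne_top,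
    ENNReal.toReal_ofReal hp.le]
  refine (integrable_exp_neg_mul_norm_sq (n := n) (mul_pos hc hp)).congr
    (Eventually.of_forall fun z => ?_)
  simp only [Real.norm_of_nonneg (Real.exp_pos _).le, ← Real.exp_mul]
  ring_nf

lemma wnorm_exp_norm_lt_top (hp : 0 < p) (a A : ℝ) :
    wnorm p a (fun z : Cn n => (Real.exp (A * ‖z‖) : ℂ)) < ⊤ := by
  obtain ⟨C, _, hC⟩ := exists_exp_mul_rpow_le A (-a) (c := 1 / 4) (by norm_num)
  refine ((memLp_exp_neg_mul_norm_sq (n := n) (c := 1 / 4) (by norm_num) hp).const_mul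
    C).mono (by fun_prop) (Eventually.of_forall fun z => ?_) |>.2
  rw [norm_smul, norm_ofReal_exp, Real.norm_of_nonneg (weight_pos a z).le]
  calc weight a z * Real.exp (A * ‖z‖)
      = Real.exp (A * ‖z‖) * (1 + ‖z‖) ^ (-a) * Real.exp (-‖z‖ ^ 2 / 2) := by
        rw [weight]; ring
    _ ≤ C * Real.exp (1 / 4 * ‖z‖ ^ 2) * Real.exp (-‖z‖ ^ 2 / 2) := by
        exact mul_le_mul_of_nonneg_right (hC _ (norm_nonneg z)) (Real.exp_pos _).le
    _ = C * Real.exp (-(1 / 4) * ‖z‖ ^ 2) := by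
        rw [mul_assoc, ← Real.exp_add]; ring_nf
    _ ≤ _ := le_abs_self _

lemma exists_wnorm_le_of_norm_le_exp (n : ℕ) (hp : 0 < p) (a A : ℝ) :
    ∃ C : ℝ≥0, ∀ (M : ℝ) (F : Cn n → ℂ), (∀ z, ‖F z‖ ≤ M * Real.exp (A * ‖z‖)) →
      wnorm p a F ≤ C * ENNReal.ofReal M := by
  lift wnorm p a (fun z : Cn n => (Real.exp (A * ‖z‖) : ℂ)) to ℝ≥0
    using (wnorm_exp_norm_lt_top hp a A).ne with C hC
  refine ⟨C, fun M F hF => ?_⟩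
  rw [hC, mul_comm, ENNReal.ofReal]
  refine wnorm_le_mul p a fun z => ?_
  rw [← ofReal_norm, ← ofReal_norm, ← ENNReal.ofReal, ← ENNReal.ofReal_mul' (norm_nonneg _),
    norm_ofReal_exp]
  exact ENNReal.ofReal_le_ofReal (hF z)

lemma exists_rpow_mul_exp_le (n : ℕ) (a b : ℝ) {c : ℝ} (hc : 0 < c) : ∃ C : ℝ≥0, ∀ z w : Cn n,
    (1 + ‖z‖) ^ (-(a + b)) * ((1 + ‖z‖) ^ b *
      (Real.exp (-‖w‖ ^ 2 / 2) * Real.exp (-c * ‖z - w‖ ^ 2))) ≤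
        C * (weight a w * Real.exp (-(c / 2) * ‖z - w‖ ^ 2)) := by
  obtain ⟨C, hC0, hC⟩ := exists_exp_mul_rpow_le 0 |a| (half_pos hc)
  refine ⟨⟨C, hC0.le⟩, fun z w => ?_⟩
  have hpeetre : (1 + ‖z‖) ^ (-a) ≤ (1 + ‖w‖) ^ (-a) * (C * Real.exp (c / 2 * ‖z - w‖ ^ 2)) := by
    refine (one_add_norm_rpow_le (-a) z w).trans ?_
    rw [abs_neg]
    gcongr
    simpa using hC ‖z - w‖ (norm_nonneg _)
  have hexp : Real.exp (c / 2 * ‖z - w‖ ^ 2) * Real.exp (-c * ‖z - w‖ ^ 2) =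
      Real.exp (-(c / 2) * ‖z - w‖ ^ 2) := by
    rw [← Real.exp_add]
    ring_nf
  rw [← mul_assoc, ← Real.rpow_add (by positivity), neg_add, neg_add_cancel_right]
  calc (1 + ‖z‖) ^ (-a) * (Real.exp (-‖w‖ ^ 2 / 2) * Real.exp (-c * ‖z - w‖ ^ 2))
      ≤ (1 + ‖w‖) ^ (-a) * (C * Real.exp (c / 2 * ‖z - w‖ ^ 2)) *
          (Real.exp (-‖w‖ ^ 2 / 2) * Real.exp (-c * ‖z - w‖ ^ 2)) := by gcongr
    _ = C * (weight a w * Real.exp (-(c / 2) * ‖z - w‖ ^ 2)) := by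
        rw [← hexp, weight]
        ring

lemma exists_enorm_weight_smul_le (n : ℕ) (a b : ℝ) {c : ℝ} (hc : 0 < c) (K : ℝ≥0) :
    ∃ C : ℝ≥0, ∀ (F : Cn n → ℂ) (z : Cn n) (u : ℂ),
      ‖u‖ₑ * ENNReal.ofReal (Real.exp (-‖z‖ ^ 2 / 2)) ≤
        K * ENNReal.ofReal ((1 + ‖z‖) ^ b) * ∫⁻ w, ‖F w‖ₑ * ENNReal.ofReal
          (Real.exp (-‖w‖ ^ 2 / 2) * Real.exp (-c * ‖z - w‖ ^ 2)) ∂(V n) →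
      ‖weight (a + b) z • u‖ₑ ≤ C * ∫⁻ w, ‖weight a w • F w‖ₑ *
        ENNReal.ofReal (Real.exp (-(c / 2) * ‖z - w‖ ^ 2)) ∂(V n) := by
  obtain ⟨C, hC⟩ := exists_rpow_mul_exp_le n a b hc
  refine ⟨K * C, fun F z u hu => ?_⟩
  have hbound : ∀ w : Cn n, ENNReal.ofReal ((1 + ‖z‖) ^ (-(a + b))) *
      (ENNReal.ofReal ((1 + ‖z‖) ^ b) * (‖F w‖ₑ * ENNReal.ofReal
        (Real.exp (-‖w‖ ^ 2 / 2) * Real.exp (-c * ‖z - w‖ ^ 2)))) ≤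
      C * (‖weight a w • F w‖ₑ * ENNReal.ofReal (Real.exp (-(c / 2) * ‖z - w‖ ^ 2))) := fun w => by
    have h := ENNReal.ofReal_le_ofReal (hC z w)
    rw [ENNReal.ofReal_mul (by positivity), ENNReal.ofReal_mul (by positivity),
      ENNReal.ofReal_mul C.coe_nonneg, ENNReal.ofReal_mul (weight_pos a w).le,
      ENNReal.ofReal_coe_nnreal] at h
    calc _ = ‖F w‖ₑ * _ := by ring
      _ ≤ _ := mul_le_mul_right h _
      _ = _ := by rw [enorm_weight_smul]; ring
  calc ‖weight (a + b) z • u‖ₑ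
      = ENNReal.ofReal ((1 + ‖z‖) ^ (-(a + b))) *
          (‖u‖ₑ * ENNReal.ofReal (Real.exp (-‖z‖ ^ 2 / 2))) := by
        rw [enorm_weight_smul, weight, ENNReal.ofReal_mul (by positivity)]
        ring
    _ ≤ _ := mul_le_mul_right hu _
    _ = K * ∫⁻ w, _ ∂(V n) := by
        rw [mul_assoc (K : ℝ≥0∞), mul_left_comm, ← lintegral_const_mul' _ _ ENNReal.ofReal_ne_top,
          ← lintegral_const_mul' _ _ ENNReal.ofReal_ne_top]
    _ ≤ K * ∫⁻ w, _ ∂(V n) := mul_le_mul_right (lintegral_mono hbound) _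
    _ = _ := by rw [lintegral_const_mul' _ _ ENNReal.coe_ne_top, ← mul_assoc, ENNReal.coe_mul]

theorem exists_wnorm_le_of_gaussian_kernel (n : ℕ) (hp : 1 ≤ p) (a b : ℝ) {c : ℝ} (hc : 0 < c)
    (K : ℝ≥0) : ∃ C : ℝ≥0, ∀ F u : Cn n → ℂ, Measurable F →
      (∀ z, ‖u z‖ₑ * ENNReal.ofReal (Real.exp (-‖z‖ ^ 2 / 2)) ≤
        K * ENNReal.ofReal ((1 + ‖z‖) ^ b) * ∫⁻ w, ‖F w‖ₑ * ENNReal.ofReal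
          (Real.exp (-‖w‖ ^ 2 / 2) * Real.exp (-c * ‖z - w‖ ^ 2)) ∂(V n)) →
      wnorm p (a + b) u ≤ C * wnorm p a F := by
  obtain ⟨C, hC⟩ := exists_enorm_weight_smul_le n a b hc K
  set ψ : Cn n → ℝ≥0∞ := fun z => ENNReal.ofReal (Real.exp (-(c / 2) * ‖z‖ ^ 2))
  lift ∫⁻ z, ψ z ∂(V n) to ℝ≥0
    using (integrable_exp_neg_mul_norm_sq (half_pos hc)).lintegral_lt_top.ne with I hI
  refine ⟨C * I, fun F u hF hu => ?_⟩
  calc wnorm p (a + b) u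
      ≤ C • eLpNorm (fun z => ∫⁻ w, ‖weight a w • F w‖ₑ * ψ (z - w) ∂(V n))
          (ENNReal.ofReal p) (V n) :=
        eLpNorm_le_nnreal_smul_eLpNorm_of_ae_le_mul'
          (Eventually.of_forall fun z => hC F z (u z) (hu z)) _
    _ ≤ C • (↑I * eLpNorm (fun w => ‖weight a w • F w‖ₑ) (ENNReal.ofReal p) (V n)) := by
        rw [hI]
        gcongr
        exact eLpNorm_conv_le hp (by fun_prop) (by fun_prop)
    _ = ↑(C * I) * wnorm p a F := by
        rw [eLpNorm_enorm, ENNReal.smul_def, smul_eq_mul, ← mul_assoc, ← ENNReal.coe_mul, wnorm]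

/-! ### The reproducing formula -/

lemma circleAverage_smul_eq_apply_zero {X E : Type*} [NormedAddCommGroup X] [NormedSpace ℂ X]
    [NormedAddCommGroup E] [NormedSpace ℂ E] [CompleteSpace E] {h : X → E} (hh : Differentiable ℂ h)
    (z : X) : Real.circleAverage (fun t : ℂ => h (t • z)) 0 1 = h 0 := by
  have hd : Differentiable ℂ fun t : ℂ => h (t • z) := hh.comp (by fun_prop)
  simpa using (hd.diffContOnCl (s := Metric.ball 0 |1|)).circleAverage

section CircleAverage

variable {X E : Type*} [NormedAddCommGroup X] [NormedSpace ℂ X] [MeasurableSpace X] [BorelSpace X]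
  [NormedAddCommGroup E]

lemma integral_comp_smul_of_norm_eq_one [NormedSpace ℝ E] {μ : Measure X}
    (hμ : ∀ t : ℂ, ‖t‖ = 1 → MeasurePreserving (t • ·) μ μ) {t : ℂ} (ht : ‖t‖ = 1) (H : X → E) :
    ∫ z, H (t • z) ∂μ = ∫ z, H z ∂μ :=
  (hμ t ht).integral_comp (measurableEmbedding_const_smul₀ (norm_ne_zero_iff.1 (by simp [ht]))) H

theorem integral_circleAverage_smul [NormedSpace ℝ E] [CompleteSpace E]
    [SecondCountableTopology X] {μ : Measure X} [SFinite μ]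
    (hμ : ∀ t : ℂ, ‖t‖ = 1 → MeasurePreserving (t • ·) μ μ) {H : X → E} (hc : Continuous H)
    (hi : Integrable H μ) :
    ∫ z, Real.circleAverage (fun t : ℂ => H (t • z)) 0 1 ∂μ = ∫ z, H z ∂μ := by
  have hnorm : ∀ θ : ℝ, ‖circleMap 0 1 θ‖ = 1 := fun θ => by simp
  set ν : Measure ℝ := volume.restrict (Set.Ioc 0 (2 * Real.pi))
  have hcont : Continuous fun x : ℝ × X => H (circleMap 0 1 x.1 • x.2) := by fun_prop
  have hint : Integrable (fun x : ℝ × X => H (circleMap 0 1 x.1 • x.2)) (ν.prod μ) := by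
    rw [integrable_prod_iff hcont.aestronglyMeasurable]
    refine ⟨Eventually.of_forall fun θ =>
      ((hμ _ (hnorm θ)).integrable_comp hc.aestronglyMeasurable).2 hi, ?_⟩
    simp only [integral_comp_smul_of_norm_eq_one hμ (hnorm _) fun z => ‖H z‖]
    exact integrable_const _
  simp only [Real.circleAverage_def, intervalIntegral.integral_of_le Real.two_pi_pos.le]
  rw [integral_smul, ← integral_integral_swap hint]
  simp only [integral_comp_smul_of_norm_eq_one hμ (hnorm _) H]
  rw [integral_const, measureReal_restrict_apply_univ, Real.volume_real_Ioc_of_le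
    Real.two_pi_pos.le, sub_zero, smul_smul, inv_mul_cancel₀ Real.two_pi_pos.ne', one_smul]

end CircleAverage

lemma measurePreserving_smul_V (n : ℕ) {t : ℂ} (ht : ‖t‖ = 1) :
    MeasurePreserving (t • ·) (V n) (V n) := by
  have ht0 : t ≠ 0 := norm_ne_zero_iff.1 (by simp [ht])
  let e : Cn n ≃ₗᵢ[ℝ] Cn n :=
    { (LinearEquiv.smulOfNeZero ℂ (Cn n) t ht0).restrictScalars ℝ with
      norm_map' := fun z => (norm_smul t z).trans (by rw [ht, one_mul]) }
  exact e.measurePreserving.smul_measure _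

lemma measurePreserving_smul_W (n : ℕ) (σ : ℝ) {t : ℂ} (ht : ‖t‖ = 1) :
    MeasurePreserving (t • ·) (W n σ) (W n σ) := by
  refine ⟨measurable_const_smul t, Measure.ext fun s hs => ?_⟩
  have hts : MeasurableSet ((t • · : Cn n → Cn n) ⁻¹' s) := measurable_const_smul t hs
  rw [Measure.map_apply (measurable_const_smul t) hs, W, withDensity_apply _ hts,
    withDensity_apply _ hs,
    ← (measurePreserving_smul_V n ht).setLIntegral_comp_preimage hs (by fun_prop)]
  simp only [norm_smul, ht, one_mul]

/-- Integrability of `F` against `e^{A|w| - |w|²}` for all `A`. It makes the Gaussian integral of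
`F` against every kernel `e^{z·w̄}` absolutely convergent. -/
structure ExpIntegrable (F : Cn n → ℂ) : Prop where
  aestronglyMeasurable : AEStronglyMeasurable F (V n)
  integrable : ∀ A : ℝ, Integrable (fun w => ‖F w‖ * Real.exp (A * ‖w‖ - ‖w‖ ^ 2)) (V n)

lemma exists_lintegral_exp_le (n : ℕ) (hp : 1 < p) (a A : ℝ) :
    ∃ C : ℝ≥0, ∀ F : Cn n → ℂ, AEMeasurable F (V n) →
      ∫⁻ w, ‖F w‖ₑ * ENNReal.ofReal (Real.exp (A * ‖w‖ - ‖w‖ ^ 2)) ∂(V n) ≤ C * wnorm p a F := by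
  have hpq : p.HolderConjugate (Real.conjExponent p) := Real.HolderConjugate.conjExponent hp
  lift wnorm (Real.conjExponent p) (-a) (fun z : Cn n => (Real.exp (A * ‖z‖) : ℂ)) to ℝ≥0
    using (wnorm_exp_norm_lt_top hpq.symm.pos (-a) A).ne with C hC
  refine ⟨C, fun F hF => ?_⟩
  rw [hC, mul_comm]
  refine le_of_eq_of_le (lintegral_congr fun w => ?_)
    (lintegral_mul_weight_le hpq a (-a) hF (by fun_prop))
  rw [← ofReal_norm (Complex.ofReal _), norm_ofReal_exp, weight_mul_weight_neg, mul_assoc,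
    ← ENNReal.ofReal_mul (Real.exp_pos _).le, ← Real.exp_add, ← sub_eq_add_neg]

lemma ExpIntegrable.of_wnorm (hp : 1 < p) {F : Cn n → ℂ} (hF : AEMeasurable F (V n))
    (h : wnorm p a F ≠ ⊤) : ExpIntegrable F := by
  refine ⟨hF.aestronglyMeasurable, fun A => ⟨hF.aestronglyMeasurable.norm.mul (by fun_prop), ?_⟩⟩
  obtain ⟨C, hC⟩ := exists_lintegral_exp_le n hp a A
  refine lt_of_le_of_lt (le_of_eq_of_le (lintegral_congr fun w => ?_) (hC F hF))
    (ENNReal.mul_lt_top ENNReal.coe_lt_top h.lt_top)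
  rw [enorm_mul, enorm_norm, Real.enorm_of_nonneg (Real.exp_pos _).le]

lemma FockSpace.expIntegrable [hp : Fact (1 < p)] (f : FockSpace n p (a * p)) : ExpIntegrable f :=
  .of_wnorm hp.out f.continuous.aemeasurable f.wnorm_ne_top

lemma norm_mul_exp_sub_sq_le (A : ℝ) (w : Cn n) :
    ‖w‖ * Real.exp (A * ‖w‖ - ‖w‖ ^ 2) ≤ Real.exp ((A + 1) * ‖w‖ - ‖w‖ ^ 2) := by
  have hsplit : Real.exp ((A + 1) * ‖w‖ - ‖w‖ ^ 2) =
      Real.exp ‖w‖ * Real.exp (A * ‖w‖ - ‖w‖ ^ 2) := by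
    rw [← Real.exp_add]
    ring_nf
  rw [hsplit]
  gcongr
  linarith [Real.add_one_le_exp ‖w‖]

lemma ExpIntegrable.mul_inner {F : Cn n → ℂ} (hF : ExpIntegrable F) (v : Cn n) :
    ExpIntegrable fun w => F w * inner ℂ w v := by
  have hm : AEStronglyMeasurable (fun w => F w * inner ℂ w v) (V n) :=
    hF.aestronglyMeasurable.mul (by fun_prop)
  refine ⟨hm, fun A => ((hF.integrable (A + 1)).const_mul ‖v‖).mono' (hm.norm.mul (by fun_prop))
    (Eventually.of_forall fun w => ?_)⟩
  rw [Real.norm_of_nonneg (by positivity), norm_mul]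
  calc ‖F w‖ * ‖inner ℂ w v‖ * Real.exp (A * ‖w‖ - ‖w‖ ^ 2)
      ≤ ‖F w‖ * (‖w‖ * ‖v‖) * Real.exp (A * ‖w‖ - ‖w‖ ^ 2) := by
        gcongr
        exact norm_inner_le_norm w v
    _ = ‖v‖ * (‖F w‖ * (‖w‖ * Real.exp (A * ‖w‖ - ‖w‖ ^ 2))) := by ring
    _ ≤ _ := by
        gcongr
        exact norm_mul_exp_sub_sq_le A w

/-- The Gaussian projection `F ↦ ∫ F(w) e^{z·w̄} e^{-|w|²} dV(w)`, whose kernel reproduces entire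
functions (see `proj_eq_self`). -/
def proj (F : Cn n → ℂ) (z : Cn n) : ℂ :=
  ∫ w, F w * Complex.exp (inner ℂ w z) * (Real.exp (-‖w‖ ^ 2) : ℂ) ∂(V n)

lemma norm_exp_inner_le (w z : Cn n) : ‖Complex.exp (inner ℂ w z)‖ ≤ Real.exp (‖z‖ * ‖w‖) := by
  rw [Complex.norm_exp, mul_comm]
  exact Real.exp_le_exp.2 ((Complex.re_le_norm _).trans (norm_inner_le_norm w z))

lemma norm_mul_exp_inner_le (c : ℂ) (w : Cn n) {z : Cn n} {R : ℝ} (hz : ‖z‖ ≤ R) :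
    ‖c * Complex.exp (inner ℂ w z) * (Real.exp (-‖w‖ ^ 2) : ℂ)‖ ≤
      ‖c‖ * Real.exp (R * ‖w‖ - ‖w‖ ^ 2) := by
  rw [norm_mul, norm_mul, norm_ofReal_exp, mul_assoc, sub_eq_add_neg, Real.exp_add]
  gcongr
  exact (norm_exp_inner_le w z).trans (by gcongr)

lemma norm_mul_exp_inner_smul_innerSL_le (c : ℂ) (w : Cn n) {z : Cn n} {R : ℝ} (hz : ‖z‖ ≤ R) :
    ‖(c * Complex.exp (inner ℂ w z) * (Real.exp (-‖w‖ ^ 2) : ℂ)) • innerSL ℂ w‖ ≤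
      ‖c‖ * Real.exp ((R + 1) * ‖w‖ - ‖w‖ ^ 2) := by
  rw [norm_smul, innerSL_apply_norm]
  calc _ ≤ ‖c‖ * Real.exp (R * ‖w‖ - ‖w‖ ^ 2) * ‖w‖ := by
        gcongr
        exact norm_mul_exp_inner_le c w hz
    _ = ‖c‖ * (‖w‖ * Real.exp (R * ‖w‖ - ‖w‖ ^ 2)) := by ring
    _ ≤ _ := by
        gcongr
        exact norm_mul_exp_sub_sq_le R w

namespace ExpIntegrable

variable {F : Cn n → ℂ}

lemma integrable_kernel (hF : ExpIntegrable F) (z : Cn n) :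
    Integrable (fun w => F w * Complex.exp (inner ℂ w z) * (Real.exp (-‖w‖ ^ 2) : ℂ)) (V n) :=
  (hF.integrable ‖z‖).mono' ((hF.aestronglyMeasurable.mul (by fun_prop)).mul (by fun_prop))
    (Eventually.of_forall fun w => norm_mul_exp_inner_le (F w) w le_rfl)

lemma integrable_kernel_smul_innerSL (hF : ExpIntegrable F) (z : Cn n) :
    Integrable (fun w => (F w * Complex.exp (inner ℂ w z) * (Real.exp (-‖w‖ ^ 2) : ℂ)) •
      innerSL ℂ w) (V n) :=
  (hF.integrable (‖z‖ + 1)).mono'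
    ((hF.integrable_kernel z).1.smul (innerSL ℂ).continuous.aestronglyMeasurable)
    (Eventually.of_forall fun w => norm_mul_exp_inner_smul_innerSL_le (F w) w le_rfl)

lemma hasFDerivAt_proj (hF : ExpIntegrable F) (z : Cn n) :
    HasFDerivAt (proj F) (∫ w, (F w * Complex.exp (inner ℂ w z) * (Real.exp (-‖w‖ ^ 2) : ℂ)) •
      innerSL ℂ w ∂(V n)) z := by
  refine hasFDerivAt_integral_of_dominated_of_fderiv_le (s := Metric.ball z 1)
    (F := fun z w => F w * Complex.exp (inner ℂ w z) * (Real.exp (-‖w‖ ^ 2) : ℂ))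
    (F' := fun z w => (F w * Complex.exp (inner ℂ w z) * (Real.exp (-‖w‖ ^ 2) : ℂ)) • innerSL ℂ w)
    (Metric.ball_mem_nhds z one_pos) (Eventually.of_forall fun y => (hF.integrable_kernel y).1)
    (hF.integrable_kernel z) (hF.integrable_kernel_smul_innerSL z).1
    (Eventually.of_forall fun w y hy => norm_mul_exp_inner_smul_innerSL_le (F w) w
      (R := ‖z‖ + 1) ?_) (hF.integrable _) (Eventually.of_forall fun w y _ => ?_)
  · have := norm_le_norm_add_norm_sub' y z
    rw [mem_ball_iff_norm] at hy
    linarith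
  · have hinner : HasFDerivAt (fun y => (inner ℂ w y : ℂ)) (innerSL ℂ w) y :=
      (innerSL ℂ w).hasFDerivAt
    refine ((hinner.cexp.const_mul (F w)).mul_const (Real.exp (-‖w‖ ^ 2) : ℂ)).congr_fderiv ?_
    rw [smul_smul, smul_smul]
    ring_nf

lemma fderiv_proj_apply (hF : ExpIntegrable F) (z v : Cn n) :
    fderiv ℂ (proj F) z v = proj (fun w => F w * inner ℂ w v) z := by
  rw [(hF.hasFDerivAt_proj z).fderiv,
    ContinuousLinearMap.integral_apply (hF.integrable_kernel_smul_innerSL z), proj]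
  refine integral_congr_ae (Eventually.of_forall fun w => ?_)
  simp only [smul_apply, innerSL_apply_apply, smul_eq_mul]
  ring

theorem contDiff_proj (hF : ExpIntegrable F) (m : ℕ) : ContDiff ℂ m (proj F) := by
  induction m generalizing F with
  | zero =>
    rw [Nat.cast_zero, contDiff_zero]
    exact continuous_iff_continuousAt.2 fun z => (hF.hasFDerivAt_proj z).continuousAt
  | succ m ih =>
    rw [Nat.cast_succ, contDiff_succ_iff_fderiv]
    refine ⟨fun z => (hF.hasFDerivAt_proj z).differentiableAt, fun h => absurd h (by simp),
      contDiff_clm_apply_iff.2 fun v => ?_⟩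
    simp only [hF.fderiv_proj_apply _ v]
    exact ih (hF.mul_inner v)

lemma differentiable_proj (hF : ExpIntegrable F) : Differentiable ℂ (proj F) :=
  fun z => (hF.hasFDerivAt_proj z).differentiableAt

lemma proj_sub {G : Cn n → ℂ} (hF : ExpIntegrable F) (hG : ExpIntegrable G) (z : Cn n) :
    proj (fun w => F w - G w) z = proj F z - proj G z := by
  simp only [proj, sub_mul]
  exact integral_sub (hF.integrable_kernel z) (hG.integrable_kernel z)

end ExpIntegrable

theorem integral_mul_exp_neg_sq_eq {h : Cn n → ℂ} (hh : Differentiable ℂ h)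
    (hi : Integrable (fun w => h w * (Real.exp (-‖w‖ ^ 2) : ℂ)) (V n)) :
    ∫ w, h w * (Real.exp (-‖w‖ ^ 2) : ℂ) ∂(V n) = h 0 := by
  have hcont := hh.continuous
  have haverage : ∀ z : Cn n, Real.circleAverage
      (fun t : ℂ => h (t • z) * (Real.exp (-‖t • z‖ ^ 2) : ℂ)) 0 1 =
      h 0 * (Real.exp (-‖z‖ ^ 2) : ℂ) := fun z => by
    rw [← circleAverage_smul_eq_apply_zero hh z, mul_comm, ← smul_eq_mul,
      ← Real.circleAverage_fun_smul]
    refine Real.circleAverage_congr_sphere fun t ht => ?_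
    have ht' : ‖t‖ = 1 := by simpa using ht
    simp only [norm_smul, ht', one_mul, smul_eq_mul, mul_comm]
  rw [← integral_circleAverage_smul (fun _ => measurePreserving_smul_V n) (by fun_prop) hi]
  simp only [haverage]
  rw [integral_const_mul, integral_complex_ofReal, integral_exp_neg_sq, Complex.ofReal_one, mul_one]

lemma exp_inner_mul_exp_neg_norm_sq (z w : Cn n) :
    Complex.exp (inner ℂ (z + w) z) * (Real.exp (-‖z + w‖ ^ 2) : ℂ) =
      Complex.exp (-inner ℂ z w) * (Real.exp (-‖w‖ ^ 2) : ℂ) := by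
  have hsq : ∀ v : Cn n, (((-‖v‖ ^ 2 : ℝ)) : ℂ) = -inner ℂ v v := fun v => by
    rw [inner_self_eq_norm_sq_to_K]
    norm_cast
  rw [Complex.ofReal_exp, Complex.ofReal_exp, ← Complex.exp_add, ← Complex.exp_add, hsq, hsq]
  simp only [inner_add_left, inner_add_right]
  ring_nf

theorem proj_eq_self {f : Cn n → ℂ} (hf : Differentiable ℂ f) (hi : ExpIntegrable f) :
    proj f = f := by
  funext z
  have htranslate : ∀ w : Cn n, f (z + w) * Complex.exp (inner ℂ (z + w) z) *
      (Real.exp (-‖z + w‖ ^ 2) : ℂ) =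
      (f (z + w) * Complex.exp (-inner ℂ z w)) * (Real.exp (-‖w‖ ^ 2) : ℂ) := fun w => by
    rw [mul_assoc, mul_assoc, exp_inner_mul_exp_neg_norm_sq]
  have hdiff : Differentiable ℂ fun w : Cn n => f (z + w) * Complex.exp (-inner ℂ z w) :=
    (hf.comp (by fun_prop)).mul (innerSL ℂ z).differentiable.neg.cexp
  have hint := (hi.integrable_kernel z).comp_add_left z
  rw [proj, ← integral_add_left_eq_self _ z]
  simp only [htranslate] at hint ⊢
  rw [integral_mul_exp_neg_sq_eq hdiff hint]
  simp

lemma exists_enorm_proj_le (n : ℕ) (hp : 1 < p) (a R : ℝ) :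
    ∃ C : ℝ≥0, ∀ F : Cn n → ℂ, AEMeasurable F (V n) → ∀ z, ‖z‖ ≤ R →
      ‖proj F z‖ₑ ≤ C * wnorm p a F := by
  obtain ⟨C, hC⟩ := exists_lintegral_exp_le n hp a R
  refine ⟨C, fun F hF z hz => (enorm_integral_le_lintegral_enorm _).trans
    (le_trans (lintegral_mono fun w => ?_) (hC F hF))⟩
  rw [← ofReal_norm, ← ofReal_norm, ← ENNReal.ofReal_mul (norm_nonneg _)]
  exact ENNReal.ofReal_le_ofReal (norm_mul_exp_inner_le (F w) w hz)

lemma FockSpace.proj_eq [Fact (1 < p)] (f : FockSpace n p (a * p)) : proj f = f :=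
  proj_eq_self f.differentiable f.expIntegrable

lemma exists_norm_apply_le (n : ℕ) (p a R : ℝ) [hp : Fact (1 < p)] :
    ∃ C : ℝ≥0, ∀ (f : FockSpace n p (a * p)) (z : Cn n), ‖z‖ ≤ R → ‖f z‖ ≤ C * ‖f‖ := by
  obtain ⟨C, hC⟩ := exists_enorm_proj_le n hp.out a R
  refine ⟨C, fun f z hz => ?_⟩
  have h := hC f f.continuous.aemeasurable z hz
  rw [f.proj_eq, wnorm_coe, ← ofReal_norm, ← ofReal_norm, ← ENNReal.ofReal_coe_nnreal,
    ← ENNReal.ofReal_mul C.coe_nonneg] at h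
  exact (ENNReal.ofReal_le_ofReal_iff (by positivity)).1 h

/-- Evaluation at `z` as a bounded functional on `F^p_{ap}`. -/
def evalL (p a : ℝ) [Fact (1 < p)] (z : Cn n) : FockSpace n p (a * p) →L[ℂ] ℂ :=
  LinearMap.mkContinuousOfExistsBound
    { toFun := fun f => f z
      map_add' := fun _ _ => rfl
      map_smul' := fun _ _ => rfl }
    (let ⟨C, hC⟩ := exists_norm_apply_le n p a ‖z‖; ⟨C, fun f => hC f z le_rfl⟩)

@[simp] lemma evalL_apply [Fact (1 < p)] (z : Cn n) (f : FockSpace n p (a * p)) :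
    evalL p a z f = f z := rfl

/-! ### The Gaussian projection and homogeneous expansions -/

lemma norm_exp_inner_mul_exp (z w : Cn n) :
    ‖Complex.exp (inner ℂ w z)‖ * Real.exp (-‖w‖ ^ 2) * Real.exp (-‖z‖ ^ 2 / 2) =
      Real.exp (-‖w‖ ^ 2 / 2) * Real.exp (-(1 / 2) * ‖z - w‖ ^ 2) := by
  have hsub := norm_sub_sq (𝕜 := ℂ) z w
  have hre : RCLike.re (inner ℂ z w : ℂ) = (inner ℂ w z : ℂ).re := inner_re_symm z w
  rw [hre] at hsub
  rw [Complex.norm_exp, ← Real.exp_add, ← Real.exp_add, ← Real.exp_add, hsub]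
  ring_nf

lemma enorm_proj_mul_exp_le (F : Cn n → ℂ) (z : Cn n) :
    ‖proj F z‖ₑ * ENNReal.ofReal (Real.exp (-‖z‖ ^ 2 / 2)) ≤
      ∫⁻ w, ‖F w‖ₑ * ENNReal.ofReal
        (Real.exp (-‖w‖ ^ 2 / 2) * Real.exp (-(1 / 2) * ‖z - w‖ ^ 2)) ∂(V n) := by
  refine (mul_le_mul_left (enorm_integral_le_lintegral_enorm _) _).trans_eq ?_
  rw [← lintegral_mul_const' _ _ ENNReal.ofReal_ne_top]
  refine lintegral_congr fun w => ?_
  rw [← norm_exp_inner_mul_exp, ← ofReal_norm, ← ofReal_norm, norm_mul, norm_mul, norm_ofReal_exp,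
    ← ENNReal.ofReal_mul (by positivity), ← ENNReal.ofReal_mul (by positivity)]
  ring_nf

theorem exists_wnorm_proj_le (n : ℕ) (hp : 1 ≤ p) (a : ℝ) :
    ∃ C : ℝ≥0, ∀ F : Cn n → ℂ, Measurable F → wnorm p a (proj F) ≤ C * wnorm p a F := by
  obtain ⟨C, hC⟩ := exists_wnorm_le_of_gaussian_kernel n hp a 0 (c := 1 / 2) (by norm_num) 1
  refine ⟨C, fun F hF => ?_⟩
  simpa using hC F (proj F) hF fun z => by simpa using enorm_proj_mul_exp_le F z

/-- The Gaussian projection of a measurable function with finite weighted norm, as an element of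
the Fock space. -/
def projFock [hp : Fact (1 < p)] (F : Cn n → ℂ) (hF : Measurable F) (h : wnorm p a F ≠ ⊤) :
    FockSpace n p (a * p) :=
  mkFock (proj F) (ExpIntegrable.of_wnorm hp.out hF.aemeasurable h).differentiable_proj
    (let ⟨_, hC⟩ := exists_wnorm_proj_le n hp.out.le a
    ((hC F hF).trans_lt (ENNReal.mul_lt_top ENNReal.coe_lt_top h.lt_top)).ne)

@[simp] lemma projFock_apply [Fact (1 < p)] {F : Cn n → ℂ} (hF : Measurable F)
    (h : wnorm p a F ≠ ⊤) (z : Cn n) : projFock F hF h z = proj F z := rfl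

lemma exists_enorm_sub_projFock_le (n : ℕ) (p a : ℝ) [hp : Fact (1 < p)] :
    ∃ C : ℝ≥0, ∀ (f : FockSpace n p (a * p)) (F : Cn n → ℂ) (hF : Measurable F)
      (h : wnorm p a F ≠ ⊤), ‖f - projFock F hF h‖ₑ ≤ C * wnorm p a (fun w => f w - F w) := by
  obtain ⟨C, hC⟩ := exists_wnorm_proj_le n hp.out.le a
  refine ⟨C, fun f F hF h => ?_⟩
  have hcoe : (f - projFock F hF h : FockSpace n p (a * p)) = proj fun w => f w - F w := by
    funext z
    rw [f.expIntegrable.proj_sub (.of_wnorm hp.out hF.aemeasurable h), f.proj_eq,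
      FockSpace.sub_apply, projFock_apply]
  rw [← wnorm_coe, hcoe]
  exact hC _ (f.continuous.measurable.sub hF)

lemma gauss_mul_exp (F : Cn n → ℂ) :
    gauss (fun w => F w * (Real.exp (‖w‖ ^ 2 / 2) : ℂ)) = F := by
  funext w
  rw [gauss, mul_assoc, ← Complex.ofReal_mul, ← Real.exp_add, neg_div, add_neg_cancel,
    Real.exp_zero, Complex.ofReal_one, mul_one]

lemma gauss_sub (F G : Cn n → ℂ) : gauss (fun w => F w - G w) = gauss F - gauss G := by
  funext w
  exact sub_mul _ _ _

/-- The bounded projection carries an `L^p` limit of functions of the space back to the space. -/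
instance FockSpace.completeSpace [hp : Fact (1 < p)] : CompleteSpace (FockSpace n p (a * p)) := by
  have hp0 := one_pos.trans hp.out
  refine Metric.complete_of_cauchySeq_tendsto fun u hu => ?_
  have hiso : Isometry (FockSpace.toLp n p (a * p)) :=
    AddMonoidHomClass.isometry_of_norm _ fun f => rfl
  obtain ⟨F, hF⟩ := cauchySeq_tendsto_of_complete (hiso.uniformContinuous.comp_cauchySeq hu)
  set G : Cn n → ℂ := fun w => F w * (Real.exp (‖w‖ ^ 2 / 2) : ℂ)
  have hGm : Measurable G := (Lp.stronglyMeasurable F).measurable.mul (by fun_prop)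
  have hGn : wnorm p a G ≠ ⊤ := by
    rw [← eLpNorm_gauss hp0, gauss_mul_exp]
    exact (Lp.memLp F).2.ne
  have hsub : Tendsto (fun k => wnorm p a fun w => u k w - G w) atTop (𝓝 0) := by
    simp only [← eLpNorm_gauss hp0, gauss_sub, gauss_mul_exp, G]
    exact (Lp.tendsto_Lp_iff_tendsto_eLpNorm'' (fun k => gauss (u k)) (fun k => (u k).2.2) F
      (Lp.memLp F)).1 (by rwa [Lp.toLp_coeFn])
  obtain ⟨C, hC⟩ := exists_enorm_sub_projFock_le n p a
  refine ⟨projFock G hGm hGn, tendsto_iff_edist_tendsto_0.2 <|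
    tendsto_of_tendsto_of_tendsto_of_le_of_le tendsto_const_nhds
      (h := fun k => C * wnorm p a fun w => u k w - G w) ?_ (fun _ => zero_le) fun k => ?_⟩
  · simpa using ENNReal.Tendsto.const_mul hsub (.inr ENNReal.coe_ne_top)
  · rw [edist_eq_enorm_sub]
    exact hC (u k) G hGm hGn

lemma FockSpace.contDiff [Fact (1 < p)] (f : FockSpace n p (a * p)) : ContDiff ℂ ∞ f :=
  f.proj_eq ▸ contDiff_infty.2 f.expIntegrable.contDiff_proj

lemma homComp_smul (f : Cn n → ℂ) (k : ℕ) (t : ℂ) (z : Cn n) :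
    homComp f k (t • z) = t ^ k * homComp f k z := by
  have hmap := (iteratedFDeriv ℂ k f 0).map_smul_univ (fun _ => t) (fun _ => z)
  rw [homComp, homComp, hmap, Finset.prod_const, Finset.card_univ, Fintype.card_fin, smul_eq_mul,
    mul_left_comm]

@[fun_prop] lemma contDiff_homComp (f : Cn n → ℂ) (k : ℕ) : ContDiff ℂ ∞ (homComp f k) :=
  contDiff_const.mul
    ((ContinuousMultilinearMap.contDiff _).comp (contDiff_pi.2 fun _ => contDiff_id))

section homComp

variable {f g : Cn n → ℂ} (hf : ContDiff ℂ ∞ f) (hg : ContDiff ℂ ∞ g)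
include hf

lemma differentiable_slice (z : Cn n) : Differentiable ℂ fun t : ℂ => f (t • z) :=
  (hf.differentiable (by simp)).comp (by fun_prop)

lemma homComp_eq_iteratedDeriv (k : ℕ) (z : Cn n) :
    homComp f k z = (k.factorial : ℂ)⁻¹ * iteratedDeriv k (fun t : ℂ => f (t • z)) 0 := by
  have hslice : (fun t : ℂ => f (t • z)) = f ∘ ContinuousLinearMap.toSpanSingleton ℂ z := by
    funext t
    simp
  rw [iteratedDeriv_eq_iteratedFDeriv, hslice,
    (ContinuousLinearMap.toSpanSingleton ℂ z).iteratedFDeriv_comp_right hf 0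
      (by exact_mod_cast le_top), homComp]
  simp

lemma hasSum_homComp_smul (z : Cn n) (t : ℂ) :
    HasSum (fun k => t ^ k * homComp f k z) (f (t • z)) := by
  refine (Complex.hasSum_taylorSeries_of_entire (differentiable_slice hf z) 0 t).congr_fun
    fun k => ?_
  rw [homComp_eq_iteratedDeriv hf, sub_zero, smul_eq_mul, smul_eq_mul]
  ring

lemma hasSum_homComp (z : Cn n) : HasSum (fun k => homComp f k z) (f z) := by
  simpa using hasSum_homComp_smul hf z 1

lemma homComp_eq_of_hasSum {z : Cn n} {c : ℕ → ℂ}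
    (h : ∀ t : ℂ, HasSum (fun k => t ^ k * c k) (f (t • z))) (k : ℕ) : homComp f k z = c k := by
  have hseries : ∀ {d : ℕ → ℂ}, (∀ t : ℂ, HasSum (fun k => t ^ k * d k) (f (t • z))) →
      HasFPowerSeriesAt (fun t : ℂ => f (t • z)) (.ofScalars ℂ d) 0 := fun hd =>
    hasFPowerSeriesAt_iff.2 (Eventually.of_forall fun t => by
      simpa [FormalMultilinearSeries.coeff_ofScalars] using hd t)
  simpa only [FormalMultilinearSeries.coeff_ofScalars] using congrArg (fun P => P.coeff k)
    ((hseries (hasSum_homComp_smul hf z)).eq_formalMultilinearSeries (hseries h))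

lemma homComp_of_homogeneous {j : ℕ} (h : ∀ (t : ℂ) z, f (t • z) = t ^ j * f z) (k : ℕ)
    (z : Cn n) : homComp f k z = if k = j then f z else 0 := by
  refine homComp_eq_of_hasSum hf (c := fun k => if k = j then f z else 0) (fun t => ?_) k
  rw [h]
  convert! hasSum_ite_eq j (t ^ j * f z) using 2 with i
  split_ifs with hi <;> simp [hi]

include hg in
lemma homComp_add (k : ℕ) (z : Cn n) :
    homComp (f + g) k z = homComp f k z + homComp g k z := by
  refine homComp_eq_of_hasSum (hf.add hg) (c := fun k => homComp f k z + homComp g k z)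
    (fun t => ?_) k
  simpa only [mul_add, Pi.add_apply] using
    (hasSum_homComp_smul hf z t).add (hasSum_homComp_smul hg z t)

lemma homComp_const_smul (c : ℂ) (k : ℕ) (z : Cn n) :
    homComp (c • f) k z = c * homComp f k z := by
  refine homComp_eq_of_hasSum (hf.const_smul c) (c := fun k => c * homComp f k z)
    (fun t => ?_) k
  simpa only [mul_left_comm, Pi.smul_apply, smul_eq_mul] using
    (hasSum_homComp_smul hf z t).mul_left c

include hg in
lemma homComp_sub (k : ℕ) (z : Cn n) :
    homComp (f - g) k z = homComp f k z - homComp g k z := by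
  have hneg : ContDiff ℂ ∞ ((-1 : ℂ) • g) := hg.const_smul (-1 : ℂ)
  rw [sub_eq_add_neg f, ← neg_one_smul ℂ g, homComp_add hf hneg, homComp_const_smul hg,
    neg_one_mul, sub_eq_add_neg]

lemma norm_homComp_le {M R : ℝ} (hR : 0 < R) (hM : ∀ z, ‖z‖ ≤ R → ‖f z‖ ≤ M) (k : ℕ)
    (z : Cn n) : ‖homComp f k z‖ ≤ M * (‖z‖ / R) ^ k := by
  rcases k.eq_zero_or_pos with rfl | hk
  · simpa [homComp] using hM 0 (by simp [hR.le])
  rcases eq_or_ne z 0 with rfl | hz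
  · have hzero := homComp_smul f k 0 0
    rw [zero_smul, zero_pow hk.ne', zero_mul] at hzero
    simp [hzero, zero_pow hk.ne']
  have hz' : 0 < ‖z‖ := norm_pos_iff.2 hz
  have hcauchy := Complex.norm_iteratedDeriv_le_of_forall_mem_sphere_norm_le (c := 0)
    (R := R / ‖z‖) (C := M) k (by positivity) (differentiable_slice hf z).diffContOnCl
    fun t ht => hM _ (by
      rw [norm_smul, mem_sphere_zero_iff_norm.1 ht, div_mul_cancel₀ _ hz'.ne'])
  rw [homComp_eq_iteratedDeriv hf, norm_mul, norm_inv, Complex.norm_natCast,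
    inv_mul_le_iff₀ (by positivity)]
  refine hcauchy.trans_eq ?_
  rw [div_pow, div_pow]
  field_simp

lemma circleAverage_inv_pow_mul_eq_homComp (k : ℕ) (z : Cn n) :
    Real.circleAverage (fun t : ℂ => (t⁻¹) ^ k * f (t • z)) 0 1 = homComp f k z := by
  have hcauchy := (differentiable_slice hf z).diffContOnCl (s := Metric.ball 0 1)
    |>.circleIntegral_one_div_sub_center_pow_smul one_pos k
  rw [Real.circleAverage_eq_circleIntegral one_ne_zero, homComp_eq_iteratedDeriv hf]
  have hintegrand : ∀ t : ℂ, (t - 0)⁻¹ • ((t⁻¹) ^ k * f (t • z)) =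
      (1 / (t - 0) ^ (k + 1)) • f (t • z) := fun t => by
    rw [sub_zero, one_div, pow_succ', mul_inv, ← inv_pow, smul_eq_mul, smul_eq_mul, mul_assoc]
  simp only [hintegrand]
  rw [hcauchy, smul_smul, smul_eq_mul]
  field_simp [Complex.two_pi_I_ne_zero]

end homComp

/-! ### Convergence and boundedness of the pairing -/

/-- The sum of the homogeneous components of degree less than `N`. Unlike `lowPart` it may be
empty, which makes a single formula for the pairing possible (see `pairing_eq`). -/
def lowSum (N : ℕ) (f : Cn n → ℂ) (z : Cn n) : ℂ := ∑ k ∈ Finset.range N, homComp f k z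

/-- The sum of the homogeneous components of degree at least `N`. -/
def highSum (N : ℕ) (f : Cn n → ℂ) (z : Cn n) : ℂ := f z - lowSum N f z

lemma lowSum_zero (f : Cn n → ℂ) : lowSum 0 f = 0 := rfl

lemma highSum_zero (f : Cn n → ℂ) : highSum 0 f = f := by
  funext z
  simp [highSum, lowSum_zero]

@[fun_prop] lemma contDiff_lowSum (N : ℕ) (f : Cn n → ℂ) : ContDiff ℂ ∞ (lowSum N f) :=
  ContDiff.sum fun k _ => contDiff_homComp f k

section homComp

variable {f g : Cn n → ℂ} (N : ℕ) (hf : ContDiff ℂ ∞ f) (hg : ContDiff ℂ ∞ g)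

lemma homComp_lowSum (f : Cn n → ℂ) (k : ℕ) (z : Cn n) :
    homComp (lowSum N f) k z = if k < N then homComp f k z else 0 := by
  refine homComp_eq_of_hasSum (contDiff_lowSum N f)
    (c := fun k => if k < N then homComp f k z else 0) (fun t => ?_) k
  have hsum : lowSum N f (t • z) =
      ∑ k ∈ Finset.range N, t ^ k * (if k < N then homComp f k z else 0) :=
    Finset.sum_congr rfl fun k hk => by rw [homComp_smul, if_pos (Finset.mem_range.1 hk)]
  rw [hsum]
  exact hasSum_sum_of_ne_finset_zero fun k hk => by rw [if_neg (by simpa using hk), mul_zero]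

include hf

@[fun_prop] lemma contDiff_highSum : ContDiff ℂ ∞ (highSum N f) :=
  hf.sub (contDiff_lowSum N f)

lemma homComp_highSum (k : ℕ) (z : Cn n) :
    homComp (highSum N f) k z = if k < N then 0 else homComp f k z := by
  have hsub : highSum N f = f - lowSum N f := rfl
  rw [hsub, homComp_sub hf (contDiff_lowSum N f), homComp_lowSum]
  split_ifs <;> simp

lemma hasSum_highSum (z : Cn n) : HasSum (fun k => homComp f (k + N) z) (highSum N f z) :=
  (hasSum_nat_add_iff' N).2 (hasSum_homComp hf z)

include hg in
lemma lowSum_add (z : Cn n) : lowSum N (f + g) z = lowSum N f z + lowSum N g z := by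
  simp only [lowSum, homComp_add hf hg, Finset.sum_add_distrib]

lemma lowSum_const_smul (c : ℂ) (z : Cn n) : lowSum N (c • f) z = c * lowSum N f z := by
  simp only [lowSum, homComp_const_smul hf, Finset.mul_sum]

end homComp

/-- The number of homogeneous components that are paired without a weight in `⟨·,·⟩_σ`. -/
def cut (n : ℕ) (σ : ℝ) : ℕ := if σ < 2 * n then 0 else ⌊|σ / 2|⌋₊ + 1

lemma pairing_eq (σ : ℝ) (f g : Cn n → ℂ) :
    pairing σ f g = intPairing 0 (lowSum (cut n σ) f) (lowSum (cut n σ) g) +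
      intPairing σ (highSum (cut n σ) f) (highSum (cut n σ) g) := by
  unfold pairing cut
  split_ifs with h
  · simp [highSum_zero, lowSum_zero, intPairing, integrand]
  · rfl

lemma pairingConverges_of_integrable {σ : ℝ} {f g : Cn n → ℂ}
    (hlow : Integrable (integrand (lowSum (cut n σ) f) (lowSum (cut n σ) g)) (W n 0))
    (hhigh : Integrable (integrand (highSum (cut n σ) f) (highSum (cut n σ) g)) (W n σ)) :
    PairingConverges σ f g := by
  unfold PairingConverges
  unfold cut at hlow hhigh
  split_ifs at * with h
  · rwa [highSum_zero, highSum_zero] at hhigh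
  · exact ⟨hlow, hhigh⟩

/-- Products of two functions of order `cut n σ` at the origin are integrable against `|z|^{-σ}`
there. -/
lemma neg_two_mul_lt_two_mul_cut_sub (n : ℕ) (σ : ℝ) : -(2 * n : ℝ) < 2 * cut n σ - σ := by
  unfold cut
  split_ifs with h
  · push_cast
    linarith
  · have hfloor := Nat.lt_floor_add_one |σ / 2|
    have habs := le_abs_self (σ / 2)
    push_cast
    linarith [n.cast_nonneg (α := ℝ)]

lemma exists_norm_homComp_le (n : ℕ) (p a : ℝ) [Fact (1 < p)] {R : ℝ} (hR : 0 < R) :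
    ∃ C : ℝ≥0, ∀ (f : FockSpace n p (a * p)) (k : ℕ) (z : Cn n),
      ‖homComp f k z‖ ≤ C * ‖f‖ * (‖z‖ / R) ^ k := by
  obtain ⟨C, hC⟩ := exists_norm_apply_le n p a R
  exact ⟨C, fun f => norm_homComp_le f.contDiff hR (hC f)⟩

lemma exists_norm_lowSum_le (n : ℕ) (p a : ℝ) [Fact (1 < p)] (N : ℕ) :
    ∃ C : ℝ≥0, ∀ (f : FockSpace n p (a * p)) (z : Cn n),
      ‖lowSum N f z‖ ≤ C * ‖f‖ * Real.exp (N * ‖z‖) := by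
  obtain ⟨C, hC⟩ := exists_norm_homComp_le n p a one_pos
  refine ⟨N * C, fun f z => ?_⟩
  have hpow : ∀ k ∈ Finset.range N, ‖homComp f k z‖ ≤ C * ‖f‖ * Real.exp (N * ‖z‖) := by
    intro k hk
    refine (hC f k z).trans ?_
    rw [div_one]
    gcongr
    calc ‖z‖ ^ k ≤ Real.exp ‖z‖ ^ k := by
          gcongr
          linarith [Real.add_one_le_exp ‖z‖]
      _ = Real.exp (k * ‖z‖) := (Real.exp_nat_mul _ _).symm
      _ ≤ Real.exp (N * ‖z‖) := by
          gcongr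
          exact (Finset.mem_range.1 hk).le
  refine (norm_sum_le_of_le _ hpow).trans_eq ?_
  rw [Finset.sum_const, Finset.card_range, nsmul_eq_mul, NNReal.coe_mul, NNReal.coe_natCast]
  ring

lemma exists_wnorm_lowSum_le (n : ℕ) (p a : ℝ) [Fact (1 < p)] (N : ℕ) (hq : 0 < q) (b : ℝ) :
    ∃ C : ℝ≥0, ∀ f : FockSpace n p (a * p), wnorm q b (lowSum N f) ≤ C * ‖f‖ₑ := by
  obtain ⟨C, hC⟩ := exists_norm_lowSum_le n p a N
  obtain ⟨D, hD⟩ := exists_wnorm_le_of_norm_le_exp n hq b N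
  refine ⟨D * C, fun f => (hD _ _ (hC f)).trans_eq ?_⟩
  rw [ENNReal.ofReal_mul C.coe_nonneg, ENNReal.ofReal_coe_nnreal, ofReal_norm, ENNReal.coe_mul,
    mul_assoc]

lemma exists_wnorm_highSum_le (n : ℕ) (p a : ℝ) [hp : Fact (1 < p)] (N : ℕ) :
    ∃ C : ℝ≥0, ∀ f : FockSpace n p (a * p), wnorm p a (highSum N f) ≤ C * ‖f‖ₑ := by
  obtain ⟨C, hC⟩ := exists_wnorm_lowSum_le n p a N (one_pos.trans hp.out) a
  refine ⟨1 + C, fun f => ?_⟩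
  have hf := f.continuous
  have hlow := (contDiff_lowSum N f).continuous
  calc wnorm p a (highSum N f) ≤ wnorm p a f + wnorm p a (lowSum N f) := by
        simp only [wnorm, highSum, smul_sub]
        exact eLpNorm_sub_le (Continuous.aestronglyMeasurable (by fun_prop))
          (Continuous.aestronglyMeasurable (by fun_prop)) (Fact.out)
    _ ≤ ‖f‖ₑ + C * ‖f‖ₑ := add_le_add (wnorm_coe f).le (hC f)
    _ = ↑(1 + C) * ‖f‖ₑ := by rw [ENNReal.coe_add, ENNReal.coe_one, add_mul, one_mul]

lemma exists_norm_highSum_le (n : ℕ) (p a : ℝ) [Fact (1 < p)] (N : ℕ) :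
    ∃ C : ℝ≥0, ∀ (f : FockSpace n p (a * p)) (z : Cn n), ‖z‖ ≤ 1 →
      ‖highSum N f z‖ ≤ C * ‖f‖ * ‖z‖ ^ N := by
  obtain ⟨C, hC⟩ := exists_norm_homComp_le n p a two_pos
  refine ⟨C * 2, fun f z hz => ?_⟩
  have hterm : ∀ k, ‖homComp f (k + N) z‖ ≤ C * ‖f‖ * ‖z‖ ^ N * (1 / 2) ^ k := fun k => by
    calc ‖homComp f (k + N) z‖ ≤ C * ‖f‖ * (‖z‖ / 2) ^ (k + N) := hC f _ z
      _ = C * ‖f‖ * (‖z‖ ^ k * ‖z‖ ^ N * ((1 / 2) ^ k * (1 / 2) ^ N)) := by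
        rw [← pow_add, ← pow_add, ← mul_pow, mul_one_div]
      _ ≤ C * ‖f‖ * (1 * ‖z‖ ^ N * ((1 / 2) ^ k * 1)) := by
        gcongr
        · exact pow_le_one₀ (norm_nonneg z) hz
        · exact pow_le_one₀ (by norm_num) (by norm_num)
      _ = C * ‖f‖ * ‖z‖ ^ N * (1 / 2) ^ k := by ring
  rw [← (hasSum_highSum N f.contDiff z).tsum_eq, NNReal.coe_mul]
  refine (tsum_of_norm_bounded (hasSum_geometric_two.mul_left _) hterm).trans_eq ?_
  push_cast
  ring

lemma finrank_Cn (n : ℕ) : Module.finrank ℝ (Cn n) = 2 * n := by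
  rw [(WithLp.linearEquiv 2 ℝ (Fin n → ℂ)).finrank_eq, Module.finrank_pi_fintype]
  simp [Complex.finrank_real_complex, mul_comm]

lemma integrableOn_ball_norm_rpow (hn : 1 ≤ n) {N : ℕ} {σ : ℝ}
    (h : -(2 * n : ℝ) < 2 * N - σ) :
    IntegrableOn (fun z : Cn n => ‖z‖ ^ (2 * N) * ‖z‖ ^ (-σ)) (Metric.ball 0 1) (V n) := by
  have : Nonempty (Fin n) := ⟨⟨0, hn⟩⟩
  refine (integrableOn_fun_norm_addHaar (V n)
    (f := fun r : ℝ => r ^ (2 * N) * r ^ (-σ)) (r := 1)).2 ?_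
  rw [finrank_Cn]
  have hradial : IntegrableOn (fun y : ℝ => y ^ ((2 * n - 1 : ℕ) + (2 * N : ℕ) + -σ : ℝ))
      (Set.Ioo 0 1) := by
    rw [intervalIntegral.integrableOn_Ioo_rpow_iff one_pos]
    push_cast [Nat.cast_sub (show 1 ≤ 2 * n by lia)]
    linarith
  refine hradial.congr_fun (fun y hy => ?_) measurableSet_Ioo
  simp only [Real.rpow_add hy.1, Real.rpow_natCast, smul_eq_mul, mul_assoc]

lemma rpow_neg_le_mul_one_add_rpow_neg (σ : ℝ) {r : ℝ} (hr : 1 ≤ r) :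
    r ^ (-σ) ≤ 2 ^ |σ| * (1 + r) ^ (-σ) := by
  have hr0 : 0 < r := one_pos.trans_le hr
  rcases le_total σ 0 with h | h
  · calc r ^ (-σ) ≤ (1 + r) ^ (-σ) := Real.rpow_le_rpow hr0.le (by linarith) (by linarith)
      _ ≤ 2 ^ |σ| * (1 + r) ^ (-σ) :=
        le_mul_of_one_le_left (by positivity) (Real.one_le_rpow (by norm_num) (abs_nonneg σ))
  · calc r ^ (-σ) ≤ ((1 + r) / 2) ^ (-σ) :=
          Real.rpow_le_rpow_of_nonpos (by positivity) (by linarith) (by linarith)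
      _ = 2 ^ |σ| * (1 + r) ^ (-σ) := by
          rw [abs_of_nonneg h, Real.div_rpow (by positivity) zero_le_two,
            Real.rpow_neg zero_le_two, div_inv_eq_mul, mul_comm]

lemma enorm_integrand (ψ φ : Cn n → ℂ) (z : Cn n) :
    ‖integrand ψ φ z‖ₑ = ‖ψ z‖ₑ * ‖φ z‖ₑ * ENNReal.ofReal (Real.exp (-‖z‖ ^ 2)) := by
  rw [integrand, enorm_mul, enorm_mul, ← ofReal_norm (Complex.ofReal _), norm_ofReal_exp,
    RCLike.enorm_conj]

lemma continuous_integrand {ψ φ : Cn n → ℂ} (hψ : Continuous ψ) (hφ : Continuous φ) :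
    Continuous (integrand ψ φ) :=
  (hψ.mul (Complex.continuous_conj.comp hφ)).mul (by fun_prop)

lemma W_zero (n : ℕ) : W n 0 = V n := by
  simp [W]

lemma setLIntegral_W (σ : ℝ) {s : Set (Cn n)} (hs : MeasurableSet s) (F : Cn n → ℝ≥0∞) :
    ∫⁻ z in s, F z ∂(W n σ) = ∫⁻ z in s, ENNReal.ofReal (‖z‖ ^ (-σ)) * F z ∂(V n) :=
  setLIntegral_withDensity_eq_setLIntegral_mul_non_measurable _ (by fun_prop) _ hs
    (Eventually.of_forall fun _ => ENNReal.ofReal_lt_top)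

lemma lintegral_enorm_integrand_le (hpq : p.HolderConjugate q) (a : ℝ) {F G : Cn n → ℂ}
    (hF : AEMeasurable F (V n)) (hG : AEMeasurable G (V n)) :
    ∫⁻ z, ‖integrand F G z‖ₑ ∂(V n) ≤ wnorm p a F * wnorm q (-a) G := by
  simpa only [enorm_integrand, weight_mul_weight_neg] using lintegral_mul_weight_le hpq a (-a) hF hG

lemma exists_setLIntegral_ball_integrand_le (hn : 1 ≤ n) {N : ℕ} {σ : ℝ}
    (h : -(2 * n : ℝ) < 2 * N - σ) :
    ∃ C : ℝ≥0, ∀ (A B : ℝ≥0) (F G : Cn n → ℂ), (∀ z, ‖z‖ ≤ 1 → ‖F z‖ ≤ A * ‖z‖ ^ N) →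
      (∀ z, ‖z‖ ≤ 1 → ‖G z‖ ≤ B * ‖z‖ ^ N) →
        ∫⁻ z in Metric.ball 0 1, ‖integrand F G z‖ₑ ∂(W n σ) ≤ C * (A * B) := by
  lift ∫⁻ z in Metric.ball (0 : Cn n) 1, ENNReal.ofReal (‖z‖ ^ (2 * N) * ‖z‖ ^ (-σ)) ∂(V n) to ℝ≥0
    using (integrableOn_ball_norm_rpow hn h).lintegral_lt_top.ne with C hC
  refine ⟨C, fun A B F G hF hG => ?_⟩
  rw [hC, setLIntegral_W σ measurableSet_ball, ← lintegral_mul_const' _ _ (by finiteness)]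
  refine setLIntegral_mono' measurableSet_ball fun z hz => ?_
  have hz' : ‖z‖ ≤ 1 := (mem_ball_zero_iff.1 hz).le
  rw [enorm_integrand, ← ofReal_norm, ← ofReal_norm, ← ENNReal.ofReal_coe_nnreal,
    ← ENNReal.ofReal_coe_nnreal (p := B)]
  simp only [← ENNReal.ofReal_mul' (norm_nonneg _), ← ENNReal.ofReal_mul' (Real.exp_pos _).le,
    ← ENNReal.ofReal_mul' B.coe_nonneg, ← ENNReal.ofReal_mul (Real.rpow_nonneg (norm_nonneg z) _),
    ← ENNReal.ofReal_mul' (mul_nonneg A.coe_nonneg B.coe_nonneg)]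
  refine ENNReal.ofReal_le_ofReal ?_
  calc ‖z‖ ^ (-σ) * (‖F z‖ * ‖G z‖ * Real.exp (-‖z‖ ^ 2))
      ≤ ‖z‖ ^ (-σ) * ((A * ‖z‖ ^ N) * (B * ‖z‖ ^ N) * 1) := by
        gcongr
        · exact hF z hz'
        · exact hG z hz'
        · exact Real.exp_le_one_iff.2 (neg_nonpos.2 (sq_nonneg _))
    _ = ‖z‖ ^ (2 * N) * ‖z‖ ^ (-σ) * (A * B) := by ring

lemma setLIntegral_compl_ball_integrand_le (hpq : p.HolderConjugate q) (a b : ℝ)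
    {F G : Cn n → ℂ} (hF : AEMeasurable F (V n)) (hG : AEMeasurable G (V n)) :
    ∫⁻ z in (Metric.ball 0 1)ᶜ, ‖integrand F G z‖ₑ ∂(W n (a + b)) ≤
      ENNReal.ofReal (2 ^ |a + b|) * (wnorm p a F * wnorm q b G) := by
  refine le_trans ?_ (mul_le_mul_right (lintegral_mul_weight_le hpq a b hF hG) _)
  rw [setLIntegral_W _ measurableSet_ball.compl, ← lintegral_const_mul' _ _ ENNReal.ofReal_ne_top]
  refine (setLIntegral_mono' measurableSet_ball.compl fun z hz => ?_).trans
    (setLIntegral_le_lintegral _ _)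
  have hz' : 1 ≤ ‖z‖ := by simpa using hz
  rw [enorm_integrand, mul_left_comm, mul_left_comm (ENNReal.ofReal (2 ^ |a + b|)),
    weight_mul_weight, ← ENNReal.ofReal_mul (by positivity), ← ENNReal.ofReal_mul (by positivity),
    mul_left_comm, mul_comm (‖z‖ ^ _)]
  gcongr
  exact rpow_neg_le_mul_one_add_rpow_neg _ hz'

section Pairing

variable [hp : Fact (1 < p)] [hq : Fact (1 < q)]

lemma exists_lintegral_highSum_le (hn : 1 ≤ n) (hpq : p.HolderConjugate q) (a b : ℝ) {N : ℕ}
    (h : -(2 * n : ℝ) < 2 * N - (a + b)) :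
    ∃ C : ℝ≥0, ∀ (f : FockSpace n p (a * p)) (g : FockSpace n q (b * q)),
      ∫⁻ z, ‖integrand (highSum N f) (highSum N g) z‖ₑ ∂(W n (a + b)) ≤ C * (‖f‖ₑ * ‖g‖ₑ) := by
  obtain ⟨A, hA⟩ := exists_norm_highSum_le n p a N
  obtain ⟨B, hB⟩ := exists_norm_highSum_le n q b N
  obtain ⟨C, hC⟩ := exists_setLIntegral_ball_integrand_le hn h
  obtain ⟨D, hD⟩ := exists_wnorm_highSum_le n p a N
  obtain ⟨E, hE⟩ := exists_wnorm_highSum_le n q b N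
  refine ⟨C * (A * B) + (2 ^ |a + b| : ℝ).toNNReal * (D * E), fun f g => ?_⟩
  rw [← lintegral_add_compl _ (measurableSet_ball (x := (0 : Cn n)) (ε := 1))]
  calc _ ≤ C * (↑(A * ‖f‖₊) * ↑(B * ‖g‖₊)) +
        ENNReal.ofReal (2 ^ |a + b|) * ((D * ‖f‖ₑ) * (E * ‖g‖ₑ)) :=
      add_le_add (hC _ _ _ _ (hA f) (hB g)) <|
        (setLIntegral_compl_ball_integrand_le hpq a b
          (contDiff_highSum N f.contDiff).continuous.aemeasurable
          (contDiff_highSum N g.contDiff).continuous.aemeasurable).trans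
          (by gcongr; exacts [hD f, hE g])
    _ = _ := by
      simp only [enorm_eq_nnnorm, ENNReal.ofReal]
      push_cast
      ring

lemma exists_lintegral_lowSum_le (n : ℕ) (hpq : p.HolderConjugate q) (a b : ℝ) (N : ℕ) :
    ∃ C : ℝ≥0, ∀ (f : FockSpace n p (a * p)) (g : FockSpace n q (b * q)),
      ∫⁻ z, ‖integrand (lowSum N f) (lowSum N g) z‖ₑ ∂(W n 0) ≤ C * (‖f‖ₑ * ‖g‖ₑ) := by
  obtain ⟨D, hD⟩ := exists_wnorm_lowSum_le n p a N hpq.pos 0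
  obtain ⟨E, hE⟩ := exists_wnorm_lowSum_le n q b N hpq.symm.pos (-0)
  refine ⟨D * E, fun f g => ?_⟩
  rw [W_zero, ENNReal.coe_mul, mul_mul_mul_comm]
  exact (lintegral_enorm_integrand_le hpq 0 (contDiff_lowSum N f).continuous.aemeasurable
    (contDiff_lowSum N g).continuous.aemeasurable).trans (mul_le_mul' (hD f) (hE g))

lemma integrable_highSum (hn : 1 ≤ n) (hpq : p.HolderConjugate q) {N : ℕ}
    (h : -(2 * n : ℝ) < 2 * N - (a + b)) (f : FockSpace n p (a * p)) (g : FockSpace n q (b * q)) :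
    Integrable (integrand (highSum N f) (highSum N g)) (W n (a + b)) :=
  let ⟨_, hC⟩ := exists_lintegral_highSum_le hn hpq a b h
  ⟨(continuous_integrand (contDiff_highSum N f.contDiff).continuous
    (contDiff_highSum N g.contDiff).continuous).aestronglyMeasurable,
    (hC f g).trans_lt (by finiteness)⟩

lemma integrable_lowSum (hpq : p.HolderConjugate q) (N : ℕ)
    (f : FockSpace n p (a * p)) (g : FockSpace n q (b * q)) :
    Integrable (integrand (lowSum N f) (lowSum N g)) (W n 0) :=
  let ⟨_, hC⟩ := exists_lintegral_lowSum_le n hpq a b N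
  ⟨(continuous_integrand (contDiff_lowSum N f).continuous
    (contDiff_lowSum N g).continuous).aestronglyMeasurable, (hC f g).trans_lt (by finiteness)⟩

theorem pairingConverges (hn : 1 ≤ n) (hpq : p.HolderConjugate q)
    (f : FockSpace n p (a * p)) (g : FockSpace n q (b * q)) : PairingConverges (a + b) f g :=
  pairingConverges_of_integrable (integrable_lowSum hpq _ f g)
    (integrable_highSum hn hpq (neg_two_mul_lt_two_mul_cut_sub n (a + b)) f g)

theorem exists_norm_pairing_le (hn : 1 ≤ n) (hpq : p.HolderConjugate q) (a b : ℝ) :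
    ∃ C : ℝ≥0, ∀ (f : FockSpace n p (a * p)) (g : FockSpace n q (b * q)),
      ‖pairing (a + b) f g‖ ≤ C * ‖f‖ * ‖g‖ := by
  obtain ⟨C, hC⟩ :=
    exists_lintegral_lowSum_le n (p := p) (q := q) hpq a b (cut n (a + b))
  obtain ⟨D, hD⟩ := exists_lintegral_highSum_le hn (p := p) (q := q) hpq a b
    (neg_two_mul_lt_two_mul_cut_sub n (a + b))
  refine ⟨C + D, fun f g => ?_⟩
  have henorm : ‖pairing (a + b) f g‖ₑ ≤ ↑((C + D) * ‖f‖₊ * ‖g‖₊) := by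
    rw [pairing_eq]
    calc _ ≤ C * (‖f‖ₑ * ‖g‖ₑ) + D * (‖f‖ₑ * ‖g‖ₑ) := (enorm_add_le _ _).trans <| add_le_add
          ((enorm_integral_le_lintegral_enorm _).trans (hC f g))
          ((enorm_integral_le_lintegral_enorm _).trans (hD f g))
      _ = _ := by
        simp only [enorm_eq_nnnorm]
        push_cast
        ring
  exact_mod_cast henorm

end Pairing

/-! ### Integration in polar coordinates -/

section PolarCoordinates

variable {E : Type*} [NormedAddCommGroup E] [NormedSpace ℝ E] [FiniteDimensional ℝ E]
  [Nontrivial E] [MeasurableSpace E] [BorelSpace E] (μ : Measure E) [μ.IsAddHaarMeasure]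

theorem integral_eq_integral_sphere_prod {F : Type*} [NormedAddCommGroup F] [NormedSpace ℝ F]
    (f : E → F) :
    ∫ z, f z ∂μ = ∫ x : Metric.sphere (0 : E) 1 × Set.Ioi (0 : ℝ), f ((x.2 : ℝ) • (x.1 : E))
      ∂(μ.toSphere.prod (.volumeIoiPow (Module.finrank ℝ E - 1))) := by
  rw [← μ.measurePreserving_homeomorphUnitSphereProd.integral_comp
    (Homeomorph.measurableEmbedding _)
    (fun x : Metric.sphere (0 : E) 1 × Set.Ioi (0 : ℝ) => f ((x.2 : ℝ) • (x.1 : E)))]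
  conv_lhs => rw [← restrict_compl_singleton (μ := μ) 0,
    ← integral_subtype_comap (measurableSet_singleton _).compl]
  refine integral_congr_ae (Eventually.of_forall fun z => ?_)
  have hz : ‖z.1‖ ≠ 0 := norm_ne_zero_iff.2 z.2
  simp only [homeomorphUnitSphereProd_apply_snd_coe, homeomorphUnitSphereProd_apply_fst_coe,
    smul_smul, mul_inv_cancel₀ hz, one_smul]

theorem integral_volumeIoiPow {F : Type*} [NormedAddCommGroup F] [NormedSpace ℝ F] (m : ℕ)
    (g : ℝ → F) :
    ∫ r : Set.Ioi (0 : ℝ), g r ∂(Measure.volumeIoiPow m) = ∫ r in Set.Ioi (0 : ℝ), r ^ m • g r := by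
  rw [Measure.volumeIoiPow, integral_withDensity_eq_integral_toReal_smul (by fun_prop) (by simp),
    integral_subtype_comap measurableSet_Ioi
      (fun r : ℝ => (ENNReal.ofReal (r ^ m)).toReal • g r)]
  refine setIntegral_congr_fun measurableSet_Ioi fun r (hr : 0 < r) => ?_
  simp only [ENNReal.toReal_ofReal (pow_nonneg hr.le m)]

theorem integral_norm_mul_of_homogeneous (φ : ℝ → ℝ) {H : E → ℂ} {m : ℕ}
    (hH : ∀ (r : ℝ) (z : E), 0 < r → H (r • z) = r ^ m * H z) :
    ∫ z, φ ‖z‖ * H z ∂μ =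
      (∫ r in Set.Ioi (0 : ℝ), r ^ (Module.finrank ℝ E - 1 + m) * φ r : ℝ) *
        ∫ z : Metric.sphere (0 : E) 1, H z ∂μ.toSphere := by
  have hpolar : ∀ x : Metric.sphere (0 : E) 1 × Set.Ioi (0 : ℝ),
      (φ ‖(x.2 : ℝ) • (x.1 : E)‖ : ℂ) * H ((x.2 : ℝ) • (x.1 : E)) =
        H x.1 * (((x.2 : ℝ) ^ m * φ x.2 : ℝ) : ℂ) := fun ⟨z, r, hr⟩ => by
    simp only [norm_smul, norm_eq_of_mem_sphere, mul_one, Real.norm_of_nonneg (le_of_lt hr),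
      hH r _ hr]
    push_cast
    ring
  rw [integral_eq_integral_sphere_prod]
  simp only [hpolar]
  rw [integral_prod_mul (fun z : Metric.sphere (0 : E) 1 => H z)
    (fun r : Set.Ioi (0 : ℝ) => (((r : ℝ) ^ m * φ r : ℝ) : ℂ)), mul_comm,
    integral_complex_ofReal, integral_volumeIoiPow _ fun r => r ^ m * φ r]
  simp only [smul_eq_mul, pow_add, mul_assoc]

end PolarCoordinates

lemma integral_Ioi_pow_mul_rpow_neg_mul_exp_neg_sq {m : ℕ} {τ : ℝ} (h : 0 < m + 1 - τ) :
    ∫ r in Set.Ioi (0 : ℝ), r ^ m * (r ^ (-τ) * Real.exp (-r ^ 2)) =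
      1 / 2 * Real.Gamma ((m + 1 - τ) / 2) := by
  have hGamma := integral_rpow_mul_exp_neg_rpow (p := 2) (q := m - τ) two_pos (by linarith)
  rw [show (m : ℝ) - τ + 1 = m + 1 - τ by ring] at hGamma
  rw [← hGamma]
  refine setIntegral_congr_fun measurableSet_Ioi fun r (hr : 0 < r) => ?_
  rw [← mul_assoc, ← Real.rpow_natCast, ← Real.rpow_add hr, Real.rpow_two, sub_eq_add_neg]

lemma integral_W_eq_integral_toSphere (hn : 1 ≤ n) {H : Cn n → ℂ} {k : ℕ} {σ : ℝ}
    (hσ : 0 < n + k - σ / 2)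
    (hH : ∀ (r : ℝ) (z : Cn n), 0 < r → H (r • z) = r ^ (2 * k) * H z) :
    ∫ z, H z * (Real.exp (-‖z‖ ^ 2) : ℂ) ∂(W n σ) =
      (1 / 2 * Real.Gamma (n + k - σ / 2) : ℝ) *
        ∫ z : Metric.sphere (0 : Cn n) 1, H z ∂(V n).toSphere := by
  have : Nonempty (Fin n) := ⟨⟨0, hn⟩⟩
  have hdim : ((2 * n - 1 + 2 * k : ℕ) : ℝ) + 1 = 2 * n + 2 * k := by
    have : 2 * n - 1 + 2 * k + 1 = 2 * n + 2 * k := by omega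
    exact_mod_cast this
  have hradial := integral_Ioi_pow_mul_rpow_neg_mul_exp_neg_sq (m := 2 * n - 1 + 2 * k) (τ := σ)
    (by linarith)
  rw [show (((2 * n - 1 + 2 * k : ℕ) : ℝ) + 1 - σ) / 2 = n + k - σ / 2 by rw [hdim]; ring,
    ← finrank_Cn] at hradial
  rw [← hradial, ← integral_norm_mul_of_homogeneous (V n)
    (fun r => r ^ (-σ) * Real.exp (-r ^ 2)) hH, W,
    integral_withDensity_eq_integral_toReal_smul (by fun_prop) (by simp)]
  refine integral_congr_ae (Eventually.of_forall fun z => ?_)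
  simp only [ENNReal.toReal_ofReal (Real.rpow_nonneg (norm_nonneg z) (-σ)), Complex.real_smul]
  push_cast
  ring

theorem integral_W_of_homogeneous (hn : 1 ≤ n) {H : Cn n → ℂ} {k : ℕ} {σ : ℝ}
    (hσ : 0 < n + k - σ / 2)
    (hH : ∀ (r : ℝ) (z : Cn n), 0 < r → H (r • z) = r ^ (2 * k) * H z) :
    ∫ z, H z * (Real.exp (-‖z‖ ^ 2) : ℂ) ∂(W n σ) =
      (Real.Gamma (n + k - σ / 2) / Real.Gamma (n + k) : ℝ) *
        ∫ z, H z * (Real.exp (-‖z‖ ^ 2) : ℂ) ∂(V n) := by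
  have hnk : (0 : ℝ) < n + k := by positivity
  have hG : (Real.Gamma (n + k) : ℂ) ≠ 0 := by
    exact_mod_cast (Real.Gamma_pos_of_pos hnk).ne'
  have hunweighted := integral_W_eq_integral_toSphere hn (σ := 0) (by simpa using hnk) hH
  rw [W_zero, zero_div, sub_zero] at hunweighted
  rw [integral_W_eq_integral_toSphere hn hσ hH, hunweighted]
  push_cast
  field_simp

instance (σ : ℝ) : SFinite (W n σ) := by
  unfold W V
  infer_instance

theorem integral_integrand_homComp {μ : Measure (Cn n)} [SFinite μ]
    (hμ : ∀ t : ℂ, ‖t‖ = 1 → MeasurePreserving (t • ·) μ μ) {P g : Cn n → ℂ} {k : ℕ}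
    (hP : Continuous P) (h : ∀ (t : ℂ) z, P (t • z) = t ^ k * P z) (hg : ContDiff ℂ ∞ g)
    (hi : Integrable (integrand P g) μ) :
    ∫ z, integrand P (homComp g k) z ∂μ = ∫ z, integrand P g z ∂μ := by
  rw [← integral_circleAverage_smul hμ (continuous_integrand hP hg.continuous) hi]
  refine integral_congr_ae (Eventually.of_forall fun z => ?_)
  let L : ℂ →L[ℝ] ℂ := (P z * (Real.exp (-‖z‖ ^ 2) : ℂ)) • (Complex.conjCLE : ℂ →L[ℝ] ℂ)
  have hcirc : ∀ t ∈ Metric.sphere (0 : ℂ) |1|,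
      integrand P g (t • z) = L ((t⁻¹) ^ k * g (t • z)) := fun t ht => by
    have ht' : ‖t‖ = 1 := by simpa using ht
    have hinv : starRingEnd ℂ t⁻¹ = t := by
      rw [Complex.inv_eq_conj ht', Complex.conj_conj]
    simp only [integrand, h, norm_smul, ht', one_mul, L, smul_apply,
      ContinuousLinearEquiv.coe_coe, Complex.conjCLE_apply, map_mul, map_pow, hinv, smul_eq_mul]
    ring
  have hci : CircleIntegrable (fun t : ℂ => (t⁻¹) ^ k * g (t • z)) 0 1 := by
    refine ContinuousOn.circleIntegrable zero_le_one fun t ht => ContinuousAt.continuousWithinAt ?_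
    have ht0 : t ≠ 0 := norm_ne_zero_iff.1 (by rw [mem_sphere_zero_iff_norm.1 ht]; simp)
    have := hg.continuous
    fun_prop (disch := exact ht0)
  calc integrand P (homComp g k) z = L (homComp g k z) := by
        simp only [integrand, L, smul_apply, ContinuousLinearEquiv.coe_coe,
          Complex.conjCLE_apply, smul_eq_mul]
        ring
    _ = Real.circleAverage (L ∘ fun t : ℂ => (t⁻¹) ^ k * g (t • z)) 0 1 := by
        rw [L.circleAverage_comp_comm hci, circleAverage_inv_pow_mul_eq_homComp hg]
    _ = _ := (Real.circleAverage_congr_sphere hcirc).symm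

/-! ### Pairing with homogeneous components of the kernel -/

/-- The reproducing kernel `e^{z·w̄}`. -/
def kernel (w z : Cn n) : ℂ := Complex.exp (inner ℂ w z)

/-- The homogeneous component `(z·w̄)^k / k!` of the reproducing kernel. -/
def kernelComp (k : ℕ) (w z : Cn n) : ℂ := inner ℂ w z ^ k / k.factorial

lemma contDiff_kernel (w : Cn n) : ContDiff ℂ ∞ (kernel w) := (innerSL ℂ w).contDiff.cexp

lemma contDiff_kernelComp (k : ℕ) (w : Cn n) : ContDiff ℂ ∞ (kernelComp k w) :=
  ((innerSL ℂ w).contDiff.pow k).div_const _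

lemma kernelComp_smul (k : ℕ) (w : Cn n) (t : ℂ) (z : Cn n) :
    kernelComp k w (t • z) = t ^ k * kernelComp k w z := by
  simp only [kernelComp, inner_smul_right, mul_pow, mul_div_assoc]

lemma hasSum_kernelComp (w z : Cn n) : HasSum (fun k => kernelComp k w z) (kernel w z) := by
  rw [kernel, Complex.exp_eq_exp_ℂ]
  exact NormedSpace.expSeries_div_hasSum_exp _

lemma homComp_kernel (w : Cn n) (k : ℕ) : homComp (kernel w) k = kernelComp k w :=
  funext fun z => homComp_eq_of_hasSum (contDiff_kernel w) (c := fun k => kernelComp k w z)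
    (fun t => by simpa only [kernelComp_smul] using hasSum_kernelComp w (t • z)) k

lemma norm_kernelComp_le (k : ℕ) (w z : Cn n) :
    ‖kernelComp k w z‖ ≤ (1 / 2) ^ k * Real.exp (2 * ‖w‖ * ‖z‖) := by
  calc ‖kernelComp k w z‖ ≤ (‖w‖ * ‖z‖) ^ k / k.factorial := by
        rw [kernelComp, norm_div, norm_pow, Complex.norm_natCast]
        gcongr
        exact norm_inner_le_norm w z
    _ = (1 / 2) ^ k * ((2 * ‖w‖ * ‖z‖) ^ k / k.factorial) := by
        rw [← mul_div_assoc, ← mul_pow]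
        congr 2
        ring
    _ ≤ _ := by
        gcongr
        exact Real.pow_div_factorial_le_exp _ (by positivity) k

lemma wnorm_ne_top_of_norm_le_exp (hp : 0 < p) (a : ℝ) {A M : ℝ} {F : Cn n → ℂ}
    (h : ∀ z, ‖F z‖ ≤ M * Real.exp (A * ‖z‖)) : wnorm p a F ≠ ⊤ := by
  obtain ⟨C, hC⟩ := exists_wnorm_le_of_norm_le_exp n hp a A
  exact ((hC M F h).trans_lt (by finiteness)).ne

lemma exists_norm_le_of_norm_le_exp (n : ℕ) (p a A : ℝ) [hp : Fact (1 < p)] :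
    ∃ C : ℝ≥0, ∀ (M : ℝ) (f : FockSpace n p (a * p)),
      (∀ z, ‖f z‖ ≤ M * Real.exp (A * ‖z‖)) → ‖f‖ ≤ C * M := by
  obtain ⟨C, hC⟩ := exists_wnorm_le_of_norm_le_exp n (one_pos.trans hp.out) a A
  refine ⟨C, fun M f h => norm_le_of_wnorm_le f ?_ (hC M f h)⟩
  simpa using (norm_nonneg _).trans (h 0)

lemma ExpIntegrable.of_norm_le_exp {A M : ℝ} {F : Cn n → ℂ} (hF : Continuous F)
    (h : ∀ z, ‖F z‖ ≤ M * Real.exp (A * ‖z‖)) : ExpIntegrable F :=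
  .of_wnorm one_lt_two hF.aemeasurable (wnorm_ne_top_of_norm_le_exp two_pos 0 h)

lemma expIntegrable_homComp [Fact (1 < p)] (g : FockSpace n p (a * p)) (k : ℕ) :
    ExpIntegrable (homComp g k) := by
  obtain ⟨C, hC⟩ := exists_norm_homComp_le n p a one_pos
  refine .of_norm_le_exp (A := k) (M := C * ‖g‖) (contDiff_homComp g k).continuous fun z =>
    (hC g k z).trans ?_
  rw [div_one, Real.exp_nat_mul]
  gcongr
  linarith [Real.add_one_le_exp ‖z‖]

/-- The kernel `e^{z·w̄}` as an element of `F^p_{ap}`. -/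
def kernelF (p a : ℝ) [hp : Fact (1 < p)] (w : Cn n) : FockSpace n p (a * p) :=
  mkFock (kernel w) ((contDiff_kernel w).differentiable (by simp))
    (wnorm_ne_top_of_norm_le_exp (one_pos.trans hp.out) a (A := ‖w‖) (M := 1) fun z => by
      rw [one_mul, mul_comm]
      exact norm_exp_inner_le w z)

/-- The function `(z·w̄)^k / k!` as an element of `F^p_{ap}`. -/
def kernelCompF (p a : ℝ) [hp : Fact (1 < p)] (k : ℕ) (w : Cn n) : FockSpace n p (a * p) :=
  mkFock (kernelComp k w) ((contDiff_kernelComp k w).differentiable (by simp))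
    (wnorm_ne_top_of_norm_le_exp (one_pos.trans hp.out) a (norm_kernelComp_le k w))

lemma coe_kernelF (p a : ℝ) [Fact (1 < p)] (w : Cn n) : ⇑(kernelF p a w) = kernel w := rfl

lemma coe_kernelCompF (p a : ℝ) [Fact (1 < p)] (k : ℕ) (w : Cn n) :
    ⇑(kernelCompF p a k w) = kernelComp k w := rfl

theorem hasSum_kernelCompF (p a : ℝ) [Fact (1 < p)] (w : Cn n) :
    HasSum (fun k => kernelCompF p a k w) (kernelF p a w) := by
  obtain ⟨C, hC⟩ := exists_norm_le_of_norm_le_exp n p a (2 * ‖w‖)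
  have hsummable : Summable fun k => kernelCompF p a k w :=
    .of_norm_bounded (summable_geometric_two.mul_left (C : ℝ)) fun k =>
      hC _ _ (norm_kernelComp_le k w)
  have hsum : ∑' k, kernelCompF p a k w = kernelF p a w := FockSpace.ext fun z =>
    (hsummable.hasSum.mapL (evalL p a z)).unique (hasSum_kernelComp w z)
  exact hsum ▸ hsummable.hasSum

theorem integral_integrand_kernelComp {P : Cn n → ℂ} {k : ℕ} (hP : Differentiable ℂ P)
    (hPe : ExpIntegrable P) (h : ∀ (t : ℂ) z, P (t • z) = t ^ k * P z) (w : Cn n) :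
    ∫ z, integrand (kernelComp k w) P z ∂(V n) = starRingEnd ℂ (P w) := by
  have hkernel : ∀ z, integrand P (kernel w) z =
      P z * Complex.exp (inner ℂ z w) * (Real.exp (-‖z‖ ^ 2) : ℂ) := fun z => by
    rw [integrand, kernel, ← Complex.exp_conj, inner_conj_symm]
  have hconj : ∀ z, integrand (kernelComp k w) P z =
      starRingEnd ℂ (integrand P (kernelComp k w) z) := fun z => by
    simp only [integrand, map_mul, Complex.conj_conj, Complex.conj_ofReal]
    ring
  have hhom := integral_integrand_homComp (fun _ => measurePreserving_smul_V n) hP.continuous h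
    (contDiff_kernel w) (by simpa only [funext hkernel] using hPe.integrable_kernel w)
  rw [homComp_kernel] at hhom
  calc ∫ z, integrand (kernelComp k w) P z ∂(V n)
      = starRingEnd ℂ (∫ z, integrand P (kernel w) z ∂(V n)) := by
        simp only [hconj, integral_conj, hhom]
    _ = starRingEnd ℂ (proj P w) := by simp only [hkernel, proj]
    _ = _ := by rw [proj_eq_self hP hPe]

/-- The ratio of `⟨f, g⟩_σ` and `(f, g)_0` for homogeneous polynomials `f`, `g` of degree `k`. -/
def coef (n : ℕ) (σ : ℝ) (k : ℕ) : ℝ :=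
  if k < cut n σ then 1 else Real.Gamma (n + k - σ / 2) / Real.Gamma (n + k)

lemma pos_of_cut_le {σ : ℝ} {k : ℕ} (h : cut n σ ≤ k) : 0 < n + k - σ / 2 := by
  have hcut := neg_two_mul_lt_two_mul_cut_sub n σ
  have hk : (cut n σ : ℝ) ≤ k := by exact_mod_cast h
  linarith

lemma coef_pos (hn : 1 ≤ n) (σ : ℝ) (k : ℕ) : 0 < coef n σ k := by
  unfold coef
  split_ifs with h
  · exact one_pos
  · exact div_pos (Real.Gamma_pos_of_pos (pos_of_cut_le (not_lt.1 h)))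
      (Real.Gamma_pos_of_pos (by positivity))

lemma lowSum_of_homogeneous {P : Cn n → ℂ} (hP : ContDiff ℂ ∞ P) {j : ℕ}
    (h : ∀ (t : ℂ) z, P (t • z) = t ^ j * P z) (N : ℕ) :
    lowSum N P = if j < N then P else 0 := by
  funext z
  simp only [lowSum, homComp_of_homogeneous hP h, Finset.sum_ite_eq', Finset.mem_range]
  split_ifs <;> rfl

lemma highSum_of_homogeneous {P : Cn n → ℂ} (hP : ContDiff ℂ ∞ P) {j : ℕ}
    (h : ∀ (t : ℂ) z, P (t • z) = t ^ j * P z) (N : ℕ) :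
    highSum N P = if j < N then 0 else P := by
  funext z
  rw [highSum, lowSum_of_homogeneous hP h]
  split_ifs <;> simp

lemma intPairing_zero_left (σ : ℝ) (φ : Cn n → ℂ) : intPairing σ 0 φ = 0 := by
  simp [intPairing, integrand]

theorem pairing_kernelCompF (hn : 1 ≤ n) [Fact (1 < p)] [Fact (1 < q)]
    (hpq : p.HolderConjugate q) (k : ℕ) (w : Cn n) (g : FockSpace n q (b * q)) :
    pairing (a + b) (kernelCompF p a k w) g =
      coef n (a + b) k * starRingEnd ℂ (homComp g k w) := by
  have hcont := (contDiff_kernelComp k w).continuous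
  have hrepr := integral_integrand_kernelComp ((contDiff_homComp g k).differentiable (by simp))
    (expIntegrable_homComp g k) (homComp_smul g k) w
  have hlow := integrable_lowSum hpq (cut n (a + b)) (kernelCompF p a k w) g
  have hhigh := integrable_highSum hn hpq (neg_two_mul_lt_two_mul_cut_sub n (a + b))
    (kernelCompF p a k w) g
  rw [coe_kernelCompF] at hlow hhigh ⊢
  rw [lowSum_of_homogeneous (contDiff_kernelComp k w) (kernelComp_smul k w)] at hlow
  rw [highSum_of_homogeneous (contDiff_kernelComp k w) (kernelComp_smul k w)] at hhigh
  rw [pairing_eq, coef, lowSum_of_homogeneous (contDiff_kernelComp k w) (kernelComp_smul k w),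
    highSum_of_homogeneous (contDiff_kernelComp k w) (kernelComp_smul k w)]
  split_ifs with h
  · rw [if_pos h] at hlow
    have hcomp : homComp (lowSum (cut n (a + b)) g) k = homComp g k := by
      funext z
      rw [homComp_lowSum, if_pos h]
    rw [intPairing_zero_left, add_zero, intPairing, ← integral_integrand_homComp
      (fun _ => measurePreserving_smul_W n 0) hcont (kernelComp_smul k w) (contDiff_lowSum _ g)
      hlow, hcomp, W_zero, hrepr, Complex.ofReal_one, one_mul]
  · rw [if_neg h] at hhigh
    have hcomp : homComp (highSum (cut n (a + b)) g) k = homComp g k := by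
      funext z
      rw [homComp_highSum _ g.contDiff, if_neg h]
    rw [intPairing_zero_left, zero_add, intPairing, ← integral_integrand_homComp
      (fun _ => measurePreserving_smul_W n (a + b)) hcont (kernelComp_smul k w)
      (contDiff_highSum _ g.contDiff) hhigh, hcomp, ← hrepr]
    refine integral_W_of_homogeneous hn (pos_of_cut_le (not_lt.1 h))
      (H := fun z => kernelComp k w z * starRingEnd ℂ (homComp g k z)) fun r z _ => ?_
    rw [← Complex.coe_smul, kernelComp_smul, homComp_smul, map_mul, map_pow, Complex.conj_ofReal]
    ring

/-! ### Functionals and their values on the kernels -/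

lemma norm_inner_mul_kernel_le (w h z : Cn n) :
    ‖inner ℂ h z * kernel w z‖ ≤ ‖h‖ * Real.exp ((‖w‖ + 1) * ‖z‖) := by
  calc ‖inner ℂ h z * kernel w z‖ ≤ (‖h‖ * ‖z‖) * Real.exp (‖z‖ * ‖w‖) := by
        rw [norm_mul]
        exact mul_le_mul (norm_inner_le_norm h z) (norm_exp_inner_le w z) (norm_nonneg _)
          (by positivity)
    _ ≤ (‖h‖ * Real.exp ‖z‖) * Real.exp (‖z‖ * ‖w‖) := by
        gcongr
        linarith [Real.add_one_le_exp ‖z‖]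
    _ = _ := by
        rw [mul_assoc, ← Real.exp_add]
        ring_nf

lemma norm_kernel_add_sub_sum_le (N : ℕ) (w : Cn n) {h : Cn n} (hh : ‖h‖ ≤ 1) (z : Cn n) :
    ‖kernel (w + h) z - kernel w z * ∑ k ∈ Finset.range N, kernelComp k h z‖ ≤
      ‖h‖ ^ N * Real.exp ((‖w‖ + N + 1) * ‖z‖) := by
  have hinner : ‖(inner ℂ h z : ℂ)‖ ≤ ‖h‖ * ‖z‖ := norm_inner_le_norm h z
  have hexp : ‖z‖ ≤ Real.exp ‖z‖ := by linarith [Real.add_one_le_exp ‖z‖]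
  have hremainder : ‖Complex.exp (inner ℂ h z) - ∑ k ∈ Finset.range N, kernelComp k h z‖ ≤
      (‖h‖ * Real.exp ‖z‖) ^ N * Real.exp ‖z‖ := by
    refine (Complex.norm_exp_sub_sum_le_norm_mul_exp _ N).trans ?_
    gcongr
    · exact hinner.trans (by gcongr)
    · exact hinner.trans (mul_le_of_le_one_left (norm_nonneg z) hh)
  calc ‖kernel (w + h) z - kernel w z * ∑ k ∈ Finset.range N, kernelComp k h z‖
      = ‖kernel w z‖ * ‖Complex.exp (inner ℂ h z) - ∑ k ∈ Finset.range N, kernelComp k h z‖ := by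
        rw [← norm_mul, kernel, kernel, inner_add_left, Complex.exp_add, mul_sub]
    _ ≤ Real.exp (‖z‖ * ‖w‖) * ((‖h‖ * Real.exp ‖z‖) ^ N * Real.exp ‖z‖) := by
        gcongr
        exact norm_exp_inner_le w z
    _ = _ := by
        rw [mul_pow, ← Real.exp_nat_mul, mul_assoc, mul_left_comm, ← Real.exp_add, ← Real.exp_add]
        ring_nf

/-- The derivative at `w` of the conjugate-holomorphic map `w ↦ e^{z·w̄}`, with values in
`F^p_{ap}`. -/
def kernelDeriv (p a : ℝ) [hp : Fact (1 < p)] (w : Cn n) : Cn n →ₗ⋆[ℂ] FockSpace n p (a * p) where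
  toFun h := mkFock (fun z => inner ℂ h z * kernel w z)
    (((innerSL ℂ h).contDiff.mul (contDiff_kernel w)).differentiable (by simp))
    (wnorm_ne_top_of_norm_le_exp (one_pos.trans hp.out) a (norm_inner_mul_kernel_le w h))
  map_add' h₁ h₂ := FockSpace.ext fun z =>
    (congrArg (· * kernel w z) (inner_add_left h₁ h₂ z)).trans (add_mul _ _ _)
  map_smul' c h := FockSpace.ext fun z =>
    (congrArg (· * kernel w z) (inner_smul_left h z c)).trans (mul_assoc _ _ _)

lemma kernelDeriv_apply (p a : ℝ) [Fact (1 < p)] (w h z : Cn n) :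
    kernelDeriv p a w h z = inner ℂ h z * kernel w z := rfl

lemma continuous_kernelF (p a : ℝ) [Fact (1 < p)] :
    Continuous (kernelF p a : Cn n → FockSpace n p (a * p)) := by
  refine continuous_iff_continuousAt.2 fun w => ?_
  obtain ⟨C, hC⟩ := exists_norm_le_of_norm_le_exp n p a (‖w‖ + (1 : ℕ) + 1)
  refine continuousAt_of_locally_lipschitz one_pos C fun v hv => ?_
  rw [dist_eq_norm] at hv
  rw [dist_eq_norm, dist_eq_norm]
  refine hC _ _ fun z => ?_
  simpa [FockSpace.sub_apply, coe_kernelF, kernelComp] using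
    norm_kernel_add_sub_sum_le 1 w hv.le z

lemma exists_norm_kernelF_add_sub_le (p a : ℝ) [Fact (1 < p)] (w : Cn n) :
    ∃ C : ℝ≥0, ∀ h : Cn n, ‖h‖ ≤ 1 →
      ‖kernelF p a (w + h) - kernelF p a w - kernelDeriv p a w h‖ ≤ C * ‖h‖ ^ 2 := by
  obtain ⟨C, hC⟩ := exists_norm_le_of_norm_le_exp n p a (‖w‖ + (2 : ℕ) + 1)
  refine ⟨C, fun h hh => hC _ _ fun z => ?_⟩
  have hz := norm_kernel_add_sub_sum_le 2 w hh z
  simp only [Finset.sum_range_succ, Finset.sum_range_zero, kernelComp] at hz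
  convert hz using 2
  rw [FockSpace.sub_apply, FockSpace.sub_apply, coe_kernelF, coe_kernelF, kernelDeriv_apply]
  simp
  ring

/-- The function `w ↦ conj (L (e^{z·w̄}))`, which represents the functional `L` under the
unweighted pairing `(·, ·)_0`. -/
def transform [Fact (1 < p)] (L : StrongDual ℂ (FockSpace n p (a * p))) (w : Cn n) : ℂ :=
  starRingEnd ℂ (L (kernelF p a w))

theorem differentiable_transform [Fact (1 < p)] (L : StrongDual ℂ (FockSpace n p (a * p))) :
    Differentiable ℂ (transform L) := by
  intro w
  obtain ⟨C, hC⟩ := exists_norm_kernelF_add_sub_le p a w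
  let D : Cn n →ₗ[ℂ] ℂ :=
    (starLinearEquiv ℂ : ℂ ≃ₗ⋆[ℂ] ℂ).toLinearMap.comp (L.toLinearMap.comp (kernelDeriv p a w))
  suffices HasFDerivAt (transform L) (LinearMap.toContinuousLinearMap D) w from
    this.differentiableAt
  rw [hasFDerivAt_iff_isLittleO_nhds_zero]
  refine Asymptotics.IsBigO.trans_isLittleO (g := fun h : Cn n => ‖h‖ ^ 2)
    (.of_bound (‖L‖ * C) ?_) (Asymptotics.isLittleO_norm_pow_id one_lt_two)
  filter_upwards [Metric.closedBall_mem_nhds (0 : Cn n) one_pos] with h hh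
  have hremainder : transform L (w + h) - transform L w - LinearMap.toContinuousLinearMap D h =
      starRingEnd ℂ (L (kernelF p a (w + h) - kernelF p a w - kernelDeriv p a w h)) := by
    simp only [transform, map_sub]
    rfl
  rw [hremainder, Complex.norm_conj, norm_pow, norm_norm, mul_assoc]
  exact L.le_opNorm_of_le (hC h (mem_closedBall_zero_iff.1 hh))

lemma IsTestFunction.wnorm_ne_top {φ : Cn n → ℂ} (hφ : IsTestFunction φ) (hp : 0 < p) (a : ℝ) :
    wnorm p a φ ≠ ⊤ := by
  obtain ⟨M, hM⟩ := hφ.bounded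
  exact wnorm_ne_top_of_norm_le_exp hp a (A := 0) (M := M) (by simpa using hM)

lemma apply_projFock [hp : Fact (1 < p)] (L : StrongDual ℂ (FockSpace n p (a * p))) {φ : Cn n → ℂ}
    (hφ : IsTestFunction φ) :
    L (projFock φ hφ.measurable (hφ.wnorm_ne_top (one_pos.trans hp.out) a)) =
      ∫ w, φ w * (Real.exp (-‖w‖ ^ 2) : ℂ) * L (kernelF p a w) ∂(V n) := by
  have hcont : Continuous fun w : Cn n => (Real.exp (-‖w‖ ^ 2) : ℂ) • kernelF p a w := by
    have := continuous_kernelF (n := n) p a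
    fun_prop
  have hint := hφ.integrable_smul (μ := V n) hcont
  have hL (L : StrongDual ℂ (FockSpace n p (a * p))) :
      L (∫ w, φ w • (Real.exp (-‖w‖ ^ 2) : ℂ) • kernelF p a w ∂(V n)) =
        ∫ w, φ w * (Real.exp (-‖w‖ ^ 2) : ℂ) * L (kernelF p a w) ∂(V n) := by
    simp only [← L.integral_comp_comm hint, map_smul, smul_eq_mul, mul_assoc]
  rw [← hL]
  congr 1
  refine FockSpace.ext fun z => ?_
  rw [projFock_apply, ← evalL_apply, hL, proj]
  simp only [evalL_apply, coe_kernelF, kernel, mul_right_comm]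

lemma wnorm_inv_weight_smul (p a : ℝ) (F : Cn n → ℂ) :
    wnorm p a (fun z => (weight a z)⁻¹ • F z) = eLpNorm F (ENNReal.ofReal p) (V n) := by
  simp only [wnorm, smul_inv_smul₀ (weight_pos a _).ne']

lemma continuous_inv_weight (a : ℝ) : Continuous fun z : Cn n => (weight a z)⁻¹ :=
  (continuous_weight a).inv₀ fun z => (weight_pos a z).ne'

theorem exists_isTestFunction_wnorm_sub_le [hp : Fact (1 < p)] (f : FockSpace n p (a * p))
    {ε : ℝ≥0∞} (hε : ε ≠ 0) :
    ∃ φ : Cn n → ℂ, IsTestFunction φ ∧ wnorm p a (fun z => f z - φ z) ≤ ε := by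
  have hmem : MemLp (fun z => weight a z • f z) (ENNReal.ofReal p) (V n) :=
    ⟨((continuous_weight a).smul f.continuous).aestronglyMeasurable, f.wnorm_ne_top.lt_top⟩
  obtain ⟨φ, hsupp, hφ, hcont, -⟩ :=
    hmem.exists_hasCompactSupport_eLpNorm_sub_le ENNReal.ofReal_ne_top hε
  have htest : IsTestFunction φ :=
    ⟨hcont.measurable, hsupp, hcont.bounded_above_of_compact_support hsupp⟩
  refine ⟨_, htest.smul (continuous_inv_weight a), hφ.trans' (le_of_eq ?_)⟩
  simp only [wnorm, smul_sub, smul_inv_smul₀ (weight_pos a _).ne']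
  rfl

theorem eq_zero_of_kernelF [hp : Fact (1 < p)] (L : StrongDual ℂ (FockSpace n p (a * p)))
    (h : ∀ w, L (kernelF p a w) = 0) : L = 0 := by
  ext f
  obtain ⟨C, hC⟩ := exists_enorm_sub_projFock_le n p a
  have hlim : Tendsto (fun ε : ℝ≥0∞ => ‖L‖ₑ * (C * ε)) (𝓝[>] 0) (𝓝 0) := by
    have hcont : Continuous fun ε : ℝ≥0∞ => ‖L‖ₑ * (C * ε) :=
      (ENNReal.continuous_const_mul enorm_ne_top).comp
        (ENNReal.continuous_const_mul ENNReal.coe_ne_top)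
    simpa using (hcont.tendsto 0).mono_left nhdsWithin_le_nhds
  suffices ∀ ε : ℝ≥0∞, 0 < ε → ‖L f‖ₑ ≤ ‖L‖ₑ * (C * ε) from
    enorm_eq_zero.1 (le_antisymm (ge_of_tendsto hlim (eventually_mem_nhdsWithin.mono this)) zero_le)
  intro ε hε
  obtain ⟨φ, hφ, hfφ⟩ := exists_isTestFunction_wnorm_sub_le f hε.ne'
  have hfin := hφ.wnorm_ne_top (one_pos.trans hp.out) a
  have hzero : L (projFock φ hφ.measurable hfin) = 0 := by simp [apply_projFock L hφ, h]
  rw [← sub_zero (L f), ← hzero, ← map_sub]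
  exact (L.le_opENorm _).trans (by gcongr; exact (hC f φ hφ.measurable hfin).trans (by gcongr))

theorem exists_wnorm_transform_le (n : ℕ) [hp : Fact (1 < p)] (hpq : p.HolderConjugate q) (a : ℝ) :
    ∃ C : ℝ≥0, ∀ L : StrongDual ℂ (FockSpace n p (a * p)),
      wnorm q (-a) (transform L) ≤ C * ‖L‖ₑ := by
  obtain ⟨C, hC⟩ := exists_wnorm_proj_le n hp.out.le a
  refine ⟨C, fun L => ?_⟩
  let T : Cn n → ℂ := fun w => weight (-a) w • L (kernelF p a w)
  have hT : Continuous T :=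
    (continuous_weight (-a)).smul (L.continuous.comp (continuous_kernelF p a))
  have hnorm : wnorm q (-a) (transform L) = eLpNorm T (ENNReal.ofReal q) (V n) :=
    eLpNorm_congr_norm_ae (Eventually.of_forall fun w => by
      simp only [T, norm_smul, transform, Complex.norm_conj])
  rw [hnorm]
  refine eLpNorm_le_of_forall_enorm_integral_mul_le hpq hT fun φ hφ => ?_
  have hψ := hφ.smul (continuous_inv_weight a)
  have hLψ : ∫ w, φ w * T w ∂(V n) = L (projFock _ hψ.measurable (hψ.wnorm_ne_top hpq.pos a)) := by
    rw [apply_projFock L hψ]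
    refine integral_congr_ae (Eventually.of_forall fun w => ?_)
    simp only [T, ← weight_mul_weight_neg a, Complex.real_smul]
    push_cast
    have : (weight a w : ℂ) ≠ 0 := by exact_mod_cast (weight_pos a w).ne'
    field_simp
  rw [hLψ]
  refine (L.le_opENorm _).trans ?_
  rw [mul_comm (C : ℝ≥0∞), mul_assoc, ← wnorm_inv_weight_smul p a, ← wnorm_coe]
  gcongr
  exact hC _ hψ.measurable

lemma kernelCompF_smul (p a : ℝ) [Fact (1 < p)] (k : ℕ) (t : ℂ) (w : Cn n) :
    kernelCompF p a k (t • w) = starRingEnd ℂ t ^ k • kernelCompF p a k w :=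
  FockSpace.ext fun z => by
    simp only [coe_kernelCompF, kernelComp, inner_smul_left, mul_pow, mul_div_assoc,
      FockSpace.smul_apply]

/-- The function `transform L` as an element of `F^q_{-aq}`. -/
def transformF [Fact (1 < p)] [Fact (1 < q)] (hpq : p.HolderConjugate q)
    (L : StrongDual ℂ (FockSpace n p (a * p))) : FockSpace n q (-a * q) :=
  mkFock (transform L) (differentiable_transform L)
    (let ⟨_, hC⟩ := exists_wnorm_transform_le n hpq a
    ((hC L).trans_lt (by finiteness)).ne)

lemma exists_norm_transformF_le (n : ℕ) [Fact (1 < p)] [Fact (1 < q)] (hpq : p.HolderConjugate q)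
    (a : ℝ) : ∃ C : ℝ≥0, ∀ L : StrongDual ℂ (FockSpace n p (a * p)),
      ‖transformF hpq L‖ ≤ C * ‖L‖ := by
  obtain ⟨C, hC⟩ := exists_wnorm_transform_le n hpq a
  refine ⟨C, fun L => norm_le_of_wnorm_le _ (norm_nonneg L) ?_⟩
  rw [ofReal_norm]
  exact hC L

theorem homComp_transformF [Fact (1 < p)] [Fact (1 < q)] (hpq : p.HolderConjugate q)
    (L : StrongDual ℂ (FockSpace n p (a * p))) (k : ℕ) (w : Cn n) :
    homComp (transformF hpq L) k w = starRingEnd ℂ (L (kernelCompF p a k w)) := by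
  refine homComp_eq_of_hasSum (transformF hpq L).contDiff
    (c := fun k => starRingEnd ℂ (L (kernelCompF p a k w))) (fun t => ?_) k
  have hsum := Complex.hasSum_conj'.2 ((hasSum_kernelCompF p a (t • w)).mapL L)
  simp only [kernelCompF_smul, map_smul, smul_eq_mul, map_mul, map_pow, Complex.conj_conj] at hsum
  exact hsum

/-! ### Multipliers of the homogeneous expansion -/

/-- Multiplication of the homogeneous components of degree `k` by `ν k` maps the Fock space with
weight exponent `a` boundedly to the one with weight exponent `b`. -/
def IsBoundedMultiplier (n : ℕ) (p : ℝ) [Fact (1 < p)] (a b : ℝ) (ν : ℕ → ℝ) : Prop :=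
  ∃ C : ℝ≥0, ∀ f : FockSpace n p (a * p), ∃ u : FockSpace n p (b * p),
    (∀ k z, homComp u k z = ν k * homComp f k z) ∧ ‖u‖ ≤ C * ‖f‖

namespace IsBoundedMultiplier

variable [hp : Fact (1 < p)] {c : ℝ} {ν ν' : ℕ → ℝ}

lemma of_hasSum {C : ℝ≥0} (T : FockSpace n p (a * p) → Cn n → ℂ)
    (hdiff : ∀ f, Differentiable ℂ (T f)) (hC : ∀ f, wnorm p b (T f) ≤ C * ‖f‖ₑ)
    (hsum : ∀ (f : FockSpace n p (a * p)) z (t : ℂ),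
      HasSum (fun k => t ^ k * (ν k * homComp f k z)) (T f (t • z))) :
    IsBoundedMultiplier n p a b ν := by
  refine ⟨C, fun f => ?_⟩
  let u : FockSpace n p (b * p) := mkFock (T f) (hdiff f) ((hC f).trans_lt (by finiteness)).ne
  refine ⟨u, fun k z => homComp_eq_of_hasSum u.contDiff (c := fun k => ν k * homComp f k z)
    (hsum f z) k, norm_le_of_wnorm_le u (norm_nonneg f) ?_⟩
  rw [ofReal_norm]
  exact hC f

lemma const (n : ℕ) (p a c : ℝ) [Fact (1 < p)] : IsBoundedMultiplier n p a a fun _ => c :=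
  ⟨‖c‖₊, fun f => ⟨(c : ℂ) • f, homComp_const_smul f.contDiff c, by simp [norm_smul]⟩⟩

lemma comp (h : IsBoundedMultiplier n p a b ν) (h' : IsBoundedMultiplier n p b c ν') :
    IsBoundedMultiplier n p a c fun k => ν' k * ν k := by
  obtain ⟨C, h⟩ := h
  obtain ⟨C', h'⟩ := h'
  refine ⟨C' * C, fun f => ?_⟩
  obtain ⟨u, hu, hun⟩ := h f
  obtain ⟨v, hv, hvn⟩ := h' u
  refine ⟨v, fun k z => by rw [hv, hu, Complex.ofReal_mul, mul_assoc], hvn.trans ?_⟩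
  rw [NNReal.coe_mul, mul_assoc]
  gcongr

lemma add (h : IsBoundedMultiplier n p a b ν) (h' : IsBoundedMultiplier n p a b ν') :
    IsBoundedMultiplier n p a b fun k => ν k + ν' k := by
  obtain ⟨C, h⟩ := h
  obtain ⟨C', h'⟩ := h'
  refine ⟨C + C', fun f => ?_⟩
  obtain ⟨u, hu, hun⟩ := h f
  obtain ⟨v, hv, hvn⟩ := h' f
  refine ⟨u + v, fun k z => ?_, (norm_add_le_of_le hun hvn).trans (by simp [add_mul])⟩
  rw [Complex.ofReal_add, add_mul, ← hu, ← hv]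
  exact homComp_add u.contDiff v.contDiff k z

lemma single (n : ℕ) (p : ℝ) [hp : Fact (1 < p)] (a b : ℝ) (j : ℕ) :
    IsBoundedMultiplier n p a b fun k => if k = j then 1 else 0 := by
  obtain ⟨C, hC⟩ := exists_norm_homComp_le n p a one_pos
  obtain ⟨D, hD⟩ := exists_wnorm_le_of_norm_le_exp n (one_pos.trans hp.out) b j
  refine of_hasSum (C := D * C) (fun f => homComp f j)
    (fun f => (contDiff_homComp f j).differentiable (by simp)) (fun f => ?_) fun f z t => ?_
  · refine (hD (C * ‖f‖) _ fun z => (hC f j z).trans ?_).trans_eq ?_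
    · rw [div_one, Real.exp_nat_mul]
      gcongr
      exact (le_add_of_nonneg_right zero_le_one).trans (Real.add_one_le_exp ‖z‖)
    · rw [ENNReal.ofReal_mul C.coe_nonneg, ENNReal.ofReal_coe_nnreal, ofReal_norm, ← mul_assoc,
        ENNReal.coe_mul]
  · rw [homComp_smul]
    convert hasSum_ite_eq j (t ^ j * homComp f j z) using 2 with k
    split_ifs with hk <;> simp [hk]

lemma congr_of_le (N : ℕ) (h : IsBoundedMultiplier n p a b ν) (hν : ∀ k, N ≤ k → ν' k = ν k) :
    IsBoundedMultiplier n p a b ν' := by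
  induction N generalizing ν with
  | zero => rwa [funext fun k => hν k k.zero_le]
  | succ N ih =>
    refine ih (h.add ((single n p a b N).comp (const n p b (ν' N - ν N)))) fun k hk => ?_
    rcases hk.eq_or_lt with rfl | hk
    · simp
    · rw [if_neg hk.ne', mul_zero, add_zero, hν k hk]

end IsBoundedMultiplier

/-- The operator `c + ∑ z_j ∂_j`. -/
def euler (c : ℝ) (f : Cn n → ℂ) (z : Cn n) : ℂ := c * f z + fderiv ℂ f z z

lemma hasSum_fderiv_smul_self {f : Cn n → ℂ} (hf : ContDiff ℂ ∞ f) (z : Cn n) (t : ℂ) :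
    HasSum (fun k : ℕ => t ^ k * (k * homComp f k z)) (fderiv ℂ f (t • z) (t • z)) := by
  set s : ℂ → ℂ := fun t => f (t • z)
  have hderiv : deriv s t = fderiv ℂ f (t • z) z := by
    have hline : HasDerivAt (fun t : ℂ => t • z) z t := by
      simpa using (hasDerivAt_id t).smul_const z
    exact ((hf.differentiable (by simp) _).hasFDerivAt.comp_hasDerivAt t hline).deriv
  have htaylor := (Complex.hasSum_taylorSeries_of_entire (differentiable_slice hf z).deriv 0
    t).mul_left t
  rw [map_smul, smul_eq_mul, ← hderiv, ← hasSum_nat_add_iff' 1]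
  simp only [Finset.range_one, Finset.sum_singleton, Nat.cast_zero, zero_mul, mul_zero, sub_zero]
  convert! htaylor using 2 with k
  have hk : ((k + 1 : ℕ) : ℂ) ≠ 0 := by exact_mod_cast k.succ_ne_zero
  rw [homComp_eq_iteratedDeriv hf, iteratedDeriv_succ', Nat.factorial_succ, Nat.cast_mul,
    sub_zero, smul_eq_mul, smul_eq_mul, mul_inv, pow_succ]
  field_simp

lemma hasSum_euler (c : ℝ) {f : Cn n → ℂ} (hf : ContDiff ℂ ∞ f) (z : Cn n) (t : ℂ) :
    HasSum (fun k : ℕ => t ^ k * ((k + c : ℝ) * homComp f k z)) (euler c f (t • z)) := by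
  refine (((hasSum_homComp_smul hf z t).mul_left (c : ℂ)).add
    (hasSum_fderiv_smul_self hf z t)).congr_fun fun k => ?_
  push_cast
  ring

lemma euler_eq_proj (c : ℝ) {f : Cn n → ℂ} (hf : Differentiable ℂ f) (hi : ExpIntegrable f)
    (z : Cn n) : euler c f z = proj (fun w => f w * (c + inner ℂ w z)) z := by
  have hfderiv : fderiv ℂ f z z = proj (fun w => f w * inner ℂ w z) z := by
    rw [← hi.fderiv_proj_apply, proj_eq_self hf hi]
  have hself : f z = proj f z := (congrFun (proj_eq_self hf hi) z).symm
  rw [euler, hfderiv, hself, proj, proj, ← integral_const_mul,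
    ← integral_add ((hi.integrable_kernel z).const_mul _) ((hi.mul_inner z).integrable_kernel z)]
  refine integral_congr_ae (Eventually.of_forall fun w => ?_)
  ring

lemma norm_add_inner_le (c : ℝ) (z w : Cn n) :
    ‖(c : ℂ) + inner ℂ w z‖ ≤ (1 + |c|) * (1 + ‖z‖) ^ 2 * (1 + ‖z - w‖) := by
  have hw : 1 + ‖w‖ ≤ (1 + ‖z‖) * (1 + ‖z - w‖) := by
    simpa only [norm_sub_rev] using one_add_norm_le_mul w z
  calc ‖(c : ℂ) + inner ℂ w z‖ ≤ |c| + ‖w‖ * ‖z‖ :=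
        norm_add_le_of_le (by simp) (norm_inner_le_norm w z)
    _ ≤ (1 + |c|) * ((1 + ‖z‖) * (1 + ‖w‖)) := by
        nlinarith [norm_nonneg z, norm_nonneg w, abs_nonneg c,
          mul_nonneg (norm_nonneg z) (norm_nonneg w),
          mul_nonneg (abs_nonneg c) (norm_nonneg z), mul_nonneg (abs_nonneg c) (norm_nonneg w),
          mul_nonneg (abs_nonneg c) (mul_nonneg (norm_nonneg z) (norm_nonneg w))]
    _ ≤ (1 + |c|) * ((1 + ‖z‖) * ((1 + ‖z‖) * (1 + ‖z - w‖))) := by gcongr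
    _ = _ := by ring

lemma exists_norm_add_inner_mul_exp_le (n : ℕ) (c : ℝ) : ∃ C : ℝ≥0, ∀ z w : Cn n,
    ‖(c : ℂ) + inner ℂ w z‖ * Real.exp (-(1 / 2) * ‖z - w‖ ^ 2) ≤
      C * (1 + ‖z‖) ^ 2 * Real.exp (-(1 / 4) * ‖z - w‖ ^ 2) := by
  obtain ⟨C, hC0, hC⟩ := exists_exp_mul_rpow_le 0 1 (c := 1 / 4) (by norm_num)
  refine ⟨.mk ((1 + |c|) * C) (by positivity), fun z w => ?_⟩
  have hlin : 1 + ‖z - w‖ ≤ C * Real.exp (1 / 4 * ‖z - w‖ ^ 2) := by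
    simpa using hC _ (norm_nonneg (z - w))
  have hexp : Real.exp (-(1 / 4) * ‖z - w‖ ^ 2) =
      Real.exp (1 / 4 * ‖z - w‖ ^ 2) * Real.exp (-(1 / 2) * ‖z - w‖ ^ 2) := by
    rw [← Real.exp_add]
    ring_nf
  calc _ ≤ (1 + |c|) * (1 + ‖z‖) ^ 2 * (C * Real.exp (1 / 4 * ‖z - w‖ ^ 2)) *
        Real.exp (-(1 / 2) * ‖z - w‖ ^ 2) := by
        gcongr
        exact (norm_add_inner_le c z w).trans (by gcongr)
    _ = _ := by
        rw [hexp, NNReal.coe_mk]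
        ring

lemma exists_wnorm_euler_le (n : ℕ) (p a c : ℝ) [hp : Fact (1 < p)] :
    ∃ C : ℝ≥0, ∀ f : FockSpace n p (a * p), wnorm p (a + 2) (euler c f) ≤ C * ‖f‖ₑ := by
  obtain ⟨K, hK⟩ := exists_norm_add_inner_mul_exp_le n c
  obtain ⟨C, hC⟩ := exists_wnorm_le_of_gaussian_kernel n hp.out.le a 2 (c := 1 / 4) (by norm_num) K
  refine ⟨C, fun f => (hC f _ f.continuous.measurable fun z => ?_).trans_eq (by rw [wnorm_coe])⟩
  rw [euler_eq_proj c f.differentiable f.expIntegrable,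
    ← lintegral_const_mul' _ _ (by finiteness)]
  refine (enorm_proj_mul_exp_le _ z).trans (lintegral_mono fun w => ?_)
  have hbound := ENNReal.ofReal_le_ofReal (mul_le_mul_of_nonneg_left (hK z w)
    (Real.exp_pos (-‖w‖ ^ 2 / 2)).le)
  rw [mul_left_comm, ENNReal.ofReal_mul (norm_nonneg _), ofReal_norm] at hbound
  rw [enorm_mul, mul_assoc, mul_left_comm _ ‖f w‖ₑ]
  refine mul_le_mul_right (hbound.trans_eq ?_) _
  rw [Real.rpow_two, ← ENNReal.ofReal_coe_nnreal, ← ENNReal.ofReal_mul K.coe_nonneg,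
    ← ENNReal.ofReal_mul (by positivity)]
  ring_nf

theorem isBoundedMultiplier_add_const (n : ℕ) (p a c : ℝ) [Fact (1 < p)] :
    IsBoundedMultiplier n p a (a + 2) fun k => k + c := by
  obtain ⟨C, hC⟩ := exists_wnorm_euler_le n p a c
  refine .of_hasSum (fun f => euler c f) (fun f => ?_) hC fun f => hasSum_euler c f.contDiff
  have hfderiv : ContDiff ℂ ∞ (fderiv ℂ f) := f.contDiff.fderiv_right (by simp)
  exact ((contDiff_const.mul f.contDiff).add
    (hfderiv.clm_apply contDiff_id)).differentiable (by simp)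

lemma isBoundedMultiplier_prod_add_const (n : ℕ) (p a c : ℝ) [Fact (1 < p)] (m : ℕ) :
    IsBoundedMultiplier n p a (a + 2 * m) fun k => ∏ j ∈ Finset.range m, (k + (c + j)) := by
  induction m with
  | zero => simpa using IsBoundedMultiplier.const n p a 1
  | succ m ih =>
    have hexponent : a + 2 * (m + 1 : ℕ) = a + 2 * m + 2 := by push_cast; ring
    simp only [hexponent, Finset.prod_range_succ, mul_comm _ ((_ : ℝ) + (c + m))]
    exact ih.comp (isBoundedMultiplier_add_const n p (a + 2 * m) (c + m))

/-! ### Fractional integration along rays -/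

/-- The integral of `f` along the segment from `0` to `z`, with density `ρ` in the parameter. -/
def radialInt (ρ : ℝ → ℝ) (f : Cn n → ℂ) (z : Cn n) : ℂ :=
  ∫ t in Set.Ioc (0 : ℝ) 1, (ρ t : ℂ) * f ((t : ℂ) • z)

lemma integrableOn_Ioc_of_continuous {E : Type*} [NormedAddCommGroup E] {g : ℝ → E}
    (hg : Continuous g) : IntegrableOn g (Set.Ioc 0 1) :=
  hg.integrableOn_Icc.mono_set Set.Ioc_subset_Icc_self

lemma norm_ofReal_smul_le {E : Type*} [SeminormedAddCommGroup E] [NormedSpace ℂ E] {t : ℝ}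
    (ht : t ∈ Set.Ioc (0 : ℝ) 1) (x : E) : ‖(t : ℂ) • x‖ ≤ ‖x‖ := by
  rw [norm_smul, Complex.norm_real, Real.norm_of_nonneg ht.1.le]
  exact mul_le_of_le_one_left (norm_nonneg x) ht.2

lemma hasFDerivAt_comp_const_smul {f : Cn n → ℂ} (hf : Differentiable ℂ f) (c : ℂ) (y : Cn n) :
    HasFDerivAt (fun y => f (c • y)) (c • fderiv ℂ f (c • y)) y := by
  have hsmul : HasFDerivAt (fun y : Cn n => c • y) (c • ContinuousLinearMap.id ℂ (Cn n)) y :=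
    (hasFDerivAt_id y).const_smul c
  refine ((hf _).hasFDerivAt.comp y hsmul).congr_fderiv ?_
  ext v
  simp

section radialInt

variable {ρ : ℝ → ℝ} (hρ : Continuous ρ)

include hρ

lemma differentiable_radialInt {f : Cn n → ℂ} (hf : ContDiff ℂ 1 f) :
    Differentiable ℂ (radialInt ρ f) := by
  intro z
  have hcont := hf.continuous
  have hfderiv : Continuous (fderiv ℂ f) := hf.continuous_fderiv one_ne_zero
  obtain ⟨M, hM⟩ := (isCompact_closedBall (0 : Cn n) (‖z‖ + 1)).exists_bound_of_continuousOn
    hfderiv.continuousOn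
  refine (hasFDerivAt_integral_of_dominated_of_fderiv_le (μ := volume.restrict (Set.Ioc (0 : ℝ) 1))
    (F := fun (z : Cn n) (t : ℝ) => (ρ t : ℂ) * f ((t : ℂ) • z))
    (F' := fun z t => (ρ t : ℂ) • (t : ℂ) • fderiv ℂ f ((t : ℂ) • z))
    (bound := fun t => |ρ t| * M) (Metric.ball_mem_nhds z one_pos)
    (Eventually.of_forall fun y => Continuous.aestronglyMeasurable (by fun_prop))
    (integrableOn_Ioc_of_continuous (by fun_prop)) (Continuous.aestronglyMeasurable (by fun_prop))
    ((ae_restrict_iff' measurableSet_Ioc).2 (Eventually.of_forall fun t ht y hy => ?_))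
    (integrableOn_Ioc_of_continuous (by fun_prop)) (Eventually.of_forall fun t y _ =>
      (hasFDerivAt_comp_const_smul (hf.differentiable one_ne_zero) t y).const_mul
        (ρ t : ℂ))).differentiableAt
  have hy : ‖y‖ ≤ ‖z‖ + 1 := by
    have := norm_le_norm_add_norm_sub' y z
    rw [mem_ball_iff_norm] at hy
    linarith
  rw [norm_smul, Complex.norm_real, Real.norm_eq_abs]
  gcongr
  exact (norm_ofReal_smul_le ht _).trans
    (hM _ (mem_closedBall_zero_iff.2 ((norm_ofReal_smul_le ht y).trans hy)))

lemma hasSum_radialInt {f : Cn n → ℂ} (hf : ContDiff ℂ ∞ f) (z : Cn n) (s : ℂ) :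
    HasSum (fun k => s ^ k * ((∫ t in Set.Ioc (0 : ℝ) 1, ρ t * t ^ k : ℝ) * homComp f k z))
      (radialInt ρ f (s • z)) := by
  have hsummable := (hasSum_homComp_smul hf z s).summable.norm
  have hterm : ∀ k : ℕ, s ^ k * ((∫ t in Set.Ioc (0 : ℝ) 1, ρ t * t ^ k : ℝ) * homComp f k z) =
      ∫ t in Set.Ioc (0 : ℝ) 1, (ρ t : ℂ) * ((t : ℂ) ^ k * (s ^ k * homComp f k z)) := fun k => by
    simp only [← integral_complex_ofReal, ← mul_assoc, integral_mul_const, Complex.ofReal_mul,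
      Complex.ofReal_pow]
    ring
  simp only [hterm]
  refine hasSum_integral_of_dominated_convergence
    (fun k t => |ρ t| * ‖s ^ k * homComp f k z‖)
    (fun k => Continuous.aestronglyMeasurable (by fun_prop))
    (fun k => (ae_restrict_iff' measurableSet_Ioc).2 (Eventually.of_forall fun t ht => ?_))
    (Eventually.of_forall fun t => hsummable.mul_left _) ?_ (Eventually.of_forall fun t => ?_)
  · rw [norm_mul, Complex.norm_real, Real.norm_eq_abs, norm_mul, norm_pow, Complex.norm_real,
      Real.norm_of_nonneg ht.1.le]
    gcongr
    exact mul_le_of_le_one_left (norm_nonneg _) (pow_le_one₀ ht.1.le ht.2)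
  · simp only [tsum_mul_left]
    exact integrableOn_Ioc_of_continuous (by fun_prop)
  · simpa only [mul_smul, mul_pow, mul_assoc] using
      (hasSum_homComp_smul hf z ((t : ℂ) * s)).mul_left (ρ t : ℂ)

end radialInt

lemma norm_sub_sq_le_of_mem_Ioc {t : ℝ} (ht : t ∈ Set.Ioc (0 : ℝ) 1) (z w : Cn n) :
    (1 - t) * ‖z‖ ^ 2 / 4 + 1 / 8 * ‖z - w‖ ^ 2 ≤
      (1 - t ^ 2) * ‖z‖ ^ 2 / 2 + 1 / 2 * ‖(t : ℂ) • z - w‖ ^ 2 := by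
  have htriangle : ‖z - w‖ ≤ (1 - t) * ‖z‖ + ‖(t : ℂ) • z - w‖ := by
    have hsplit : z - w = ((1 - t : ℝ) : ℂ) • z + ((t : ℂ) • z - w) := by
      push_cast
      module
    calc ‖z - w‖ ≤ ‖((1 - t : ℝ) : ℂ) • z‖ + ‖(t : ℂ) • z - w‖ := hsplit ▸ norm_add_le _ _
      _ = _ := by rw [norm_smul, Complex.norm_real, Real.norm_of_nonneg (sub_nonneg.2 ht.2)]
  have hsq : ‖z - w‖ ^ 2 ≤ 2 * ((1 - t) * ‖z‖) ^ 2 + 2 * ‖(t : ℂ) • z - w‖ ^ 2 := by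
    nlinarith [norm_nonneg (z - w), sq_nonneg ((1 - t) * ‖z‖ - ‖(t : ℂ) • z - w‖)]
  nlinarith [mul_nonneg (mul_nonneg ht.1.le (sub_nonneg.2 ht.2)) (sq_nonneg ‖z‖),
    sq_nonneg ‖(t : ℂ) • z - w‖]

lemma enorm_proj_smul_mul_exp_le {t : ℝ} (ht : t ∈ Set.Ioc (0 : ℝ) 1) (F : Cn n → ℂ) (z : Cn n) :
    ‖proj F ((t : ℂ) • z)‖ₑ * ENNReal.ofReal (Real.exp (-‖z‖ ^ 2 / 2)) ≤
      ENNReal.ofReal (Real.exp (-((1 - t) * ‖z‖ ^ 2 / 4))) *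
        ∫⁻ w, ‖F w‖ₑ * ENNReal.ofReal
          (Real.exp (-‖w‖ ^ 2 / 2) * Real.exp (-(1 / 8) * ‖z - w‖ ^ 2)) ∂(V n) := by
  have hnorm : ‖(t : ℂ) • z‖ ^ 2 = t ^ 2 * ‖z‖ ^ 2 := by
    rw [norm_smul, Complex.norm_real, Real.norm_of_nonneg ht.1.le, mul_pow]
  have hexp : Real.exp (-‖z‖ ^ 2 / 2) =
      Real.exp (-‖(t : ℂ) • z‖ ^ 2 / 2) * Real.exp (-((1 - t ^ 2) * ‖z‖ ^ 2 / 2)) := by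
    rw [← Real.exp_add, hnorm]
    ring_nf
  rw [hexp, ENNReal.ofReal_mul (Real.exp_pos _).le, ← mul_assoc]
  refine (mul_le_mul_left (enorm_proj_mul_exp_le F _) _).trans ?_
  rw [← lintegral_mul_const' _ _ ENNReal.ofReal_ne_top,
    ← lintegral_const_mul' _ _ ENNReal.ofReal_ne_top]
  refine lintegral_mono fun w => ?_
  rw [mul_assoc, mul_left_comm (ENNReal.ofReal _), ← ENNReal.ofReal_mul (by positivity),
    ← ENNReal.ofReal_mul (by positivity), ← Real.exp_add, ← Real.exp_add, ← Real.exp_add,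
    ← Real.exp_add]
  refine mul_le_mul_right (ENNReal.ofReal_le_ofReal (Real.exp_le_exp.2 ?_)) _
  linarith [norm_sub_sq_le_of_mem_Ioc ht z w]

lemma enorm_radialInt_mul_exp_le {ρ : ℝ → ℝ} (hρ : Continuous ρ)
    (hρ0 : ∀ t ∈ Set.Ioc (0 : ℝ) 1, 0 ≤ ρ t) [Fact (1 < p)] (f : FockSpace n p (a * p))
    (z : Cn n) : ‖radialInt ρ f z‖ₑ * ENNReal.ofReal (Real.exp (-‖z‖ ^ 2 / 2)) ≤
      ENNReal.ofReal (∫ t in Set.Ioc (0 : ℝ) 1, ρ t * Real.exp (-((1 - t) * ‖z‖ ^ 2 / 4))) *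
        ∫⁻ w, ‖f w‖ₑ * ENNReal.ofReal
          (Real.exp (-‖w‖ ^ 2 / 2) * Real.exp (-(1 / 8) * ‖z - w‖ ^ 2)) ∂(V n) := by
  set J := ∫⁻ w, ‖f w‖ₑ * ENNReal.ofReal
    (Real.exp (-‖w‖ ^ 2 / 2) * Real.exp (-(1 / 8) * ‖z - w‖ ^ 2)) ∂(V n)
  have hcont : Continuous fun t : ℝ => ρ t * Real.exp (-((1 - t) * ‖z‖ ^ 2 / 4)) := by fun_prop
  have hpointwise : ∀ t ∈ Set.Ioc (0 : ℝ) 1,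
      ‖(ρ t : ℂ) * f ((t : ℂ) • z)‖ₑ * ENNReal.ofReal (Real.exp (-‖z‖ ^ 2 / 2)) ≤
        ENNReal.ofReal (ρ t * Real.exp (-((1 - t) * ‖z‖ ^ 2 / 4))) * J := fun t ht => by
    rw [enorm_mul, ← ofReal_norm (ρ t : ℂ), Complex.norm_real, Real.norm_of_nonneg (hρ0 t ht),
      ENNReal.ofReal_mul (hρ0 t ht), mul_assoc, mul_assoc]
    refine mul_le_mul_right ?_ _
    exact (f.proj_eq ▸ enorm_proj_smul_mul_exp_le ht f z :)
  calc _ ≤ (∫⁻ t in Set.Ioc (0 : ℝ) 1, ‖(ρ t : ℂ) * f ((t : ℂ) • z)‖ₑ) *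
        ENNReal.ofReal (Real.exp (-‖z‖ ^ 2 / 2)) :=
        mul_le_mul_left (enorm_integral_le_lintegral_enorm _) _
    _ ≤ ∫⁻ t in Set.Ioc (0 : ℝ) 1,
        ENNReal.ofReal (ρ t * Real.exp (-((1 - t) * ‖z‖ ^ 2 / 4))) * J := by
        rw [← lintegral_mul_const' _ _ ENNReal.ofReal_ne_top]
        exact setLIntegral_mono' measurableSet_Ioc hpointwise
    _ = _ := by
        rw [lintegral_mul_const _ hcont.measurable.ennreal_ofReal,
          ofReal_integral_eq_lintegral_ofReal (integrableOn_Ioc_of_continuous hcont)]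
        exact (ae_restrict_iff' measurableSet_Ioc).2 (Eventually.of_forall fun t ht =>
          mul_nonneg (hρ0 t ht) (Real.exp_pos _).le)

theorem isBoundedMultiplier_integral_mul_pow (n : ℕ) (p a : ℝ) [hp : Fact (1 < p)] {ρ : ℝ → ℝ}
    (hρ : Continuous ρ) (hρ0 : ∀ t ∈ Set.Ioc (0 : ℝ) 1, 0 ≤ ρ t) {K : ℝ≥0}
    (hK : ∀ r : ℝ, 0 ≤ r → ∫ t in Set.Ioc (0 : ℝ) 1, ρ t * Real.exp (-((1 - t) * r ^ 2 / 4)) ≤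
      K * (1 + r) ^ b) :
    IsBoundedMultiplier n p a (a + b) fun k => ∫ t in Set.Ioc (0 : ℝ) 1, ρ t * t ^ k := by
  obtain ⟨C, hC⟩ := exists_wnorm_le_of_gaussian_kernel n hp.out.le a b (c := 1 / 8) (by norm_num) K
  refine .of_hasSum (C := C) (fun f => radialInt ρ f)
    (fun f => differentiable_radialInt hρ (f.contDiff.of_le (by simp))) (fun f => ?_)
    fun f => hasSum_radialInt hρ f.contDiff
  rw [← wnorm_coe]
  refine hC f _ f.continuous.measurable fun z =>
    (enorm_radialInt_mul_exp_le hρ hρ0 f z).trans (mul_le_mul_left ?_ _)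
  rw [← ENNReal.ofReal_coe_nnreal, ← ENNReal.ofReal_mul K.coe_nonneg]
  exact ENNReal.ofReal_le_ofReal (hK ‖z‖ (norm_nonneg z))

/-- The density of fractional integration of order `δ` along the rays, up to the factor `Γ(δ)`. -/
def fracWeight (n : ℕ) (δ t : ℝ) : ℝ := t ^ (n - 1) * (1 - t) ^ (δ - 1)

lemma continuous_one_sub_rpow {δ : ℝ} (hδ : 1 ≤ δ) : Continuous fun t : ℝ => (1 - t) ^ (δ - 1) :=
  Continuous.rpow_const (by fun_prop) fun _ => Or.inr (sub_nonneg.2 hδ)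

lemma integral_fracWeight_mul_pow (hn : 1 ≤ n) {δ : ℝ} (hδ : 0 < δ) (k : ℕ) :
    ∫ t in Set.Ioc (0 : ℝ) 1, fracWeight n δ t * t ^ k =
      Real.Gamma (n + k) * Real.Gamma δ / Real.Gamma (n + k + δ) := by
  have hnk : (0 : ℝ) < n + k := by positivity
  suffices (∫ t in Set.Ioc (0 : ℝ) 1, fracWeight n δ t * t ^ k : ℝ) =
      Complex.betaIntegral ((n + k : ℝ) : ℂ) (δ : ℂ) by
    rw [← Complex.ofReal_re (∫ t in _, _), this, ← ProbabilityTheory.beta_eq_betaIntegralReal _ _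
      hnk hδ, ProbabilityTheory.beta]
  rw [Complex.betaIntegral, intervalIntegral.integral_of_le zero_le_one, ← integral_complex_ofReal]
  refine setIntegral_congr_fun measurableSet_Ioc fun t ht => ?_
  have hexponent : (n + k - 1 : ℝ) = ((n - 1 + k : ℕ) : ℝ) := by push_cast [Nat.cast_sub hn]; ring
  have hfst : (t : ℂ) ^ (((n + k : ℝ) : ℂ) - 1) = ((t ^ (n - 1) * t ^ k : ℝ) : ℂ) := by
    rw [← pow_add, ← Real.rpow_natCast, ← hexponent, Complex.ofReal_cpow ht.1.le]
    push_cast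
    rfl
  have hsnd : (1 - (t : ℂ)) ^ ((δ : ℂ) - 1) = (((1 - t) ^ (δ - 1) : ℝ) : ℂ) := by
    rw [Complex.ofReal_cpow (sub_nonneg.2 ht.2)]
    push_cast
    rfl
  simp only [hfst, hsnd, fracWeight]
  push_cast
  ring

lemma integral_one_sub_rpow_mul_exp_le {δ c : ℝ} (hδ : 0 < δ) (hc : 0 < c) :
    ∫ t in Set.Ioc (0 : ℝ) 1, (1 - t) ^ (δ - 1) * Real.exp (-(c * (1 - t))) ≤
      (1 / c) ^ δ * Real.Gamma δ := by
  have hint : IntegrableOn (fun t : ℝ => t ^ (δ - 1) * Real.exp (-(c * t))) (Set.Ioi 0) := by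
    simpa only [Real.rpow_one, neg_mul] using
      integrableOn_rpow_mul_exp_neg_mul_rpow (s := δ - 1) (by linarith) one_pos hc
  rw [← Real.integral_rpow_mul_exp_neg_mul_Ioi hδ hc, ← intervalIntegral.integral_of_le zero_le_one,
    intervalIntegral.integral_comp_sub_left (fun x => x ^ (δ - 1) * Real.exp (-(c * x))) 1,
    sub_self, sub_zero, intervalIntegral.integral_of_le zero_le_one]
  refine setIntegral_mono_set hint ?_ (Eventually.of_forall Set.Ioc_subset_Ioi_self)
  exact (ae_restrict_iff' measurableSet_Ioi).2 (Eventually.of_forall fun t ht =>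
    mul_nonneg (Real.rpow_nonneg (Set.mem_Ioi.1 ht).le _) (Real.exp_pos _).le)

lemma fracWeight_mul_exp_le {t : ℝ} (ht : t ∈ Set.Ioc (0 : ℝ) 1) (n : ℕ) (δ r : ℝ) :
    fracWeight n δ t * Real.exp (-((1 - t) * r ^ 2 / 4)) ≤
      Real.exp (1 / 4) * ((1 - t) ^ (δ - 1) * Real.exp (-((1 + r ^ 2) / 4 * (1 - t)))) := by
  have hrpow : 0 ≤ (1 - t) ^ (δ - 1) := Real.rpow_nonneg (sub_nonneg.2 ht.2) _
  rw [mul_left_comm, ← Real.exp_add]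
  refine mul_le_mul (mul_le_of_le_one_left hrpow (pow_le_one₀ ht.1.le ht.2))
    (Real.exp_le_exp.2 ?_) (Real.exp_pos _).le hrpow
  linarith [ht.1]

lemma one_div_one_add_sq_rpow_le {δ r : ℝ} (hδ : 0 ≤ δ) (hr : 0 ≤ r) :
    (1 / ((1 + r ^ 2) / 4)) ^ δ ≤ 8 ^ δ * (1 + r) ^ (-(2 * δ)) := by
  have hpow : (1 + r) ^ (-(2 * δ)) = (((1 + r) ^ 2)⁻¹) ^ δ := by
    rw [Real.inv_rpow (by positivity), ← Real.rpow_natCast, ← Real.rpow_mul (by positivity),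
      Real.rpow_neg (by positivity), Nat.cast_ofNat]
  rw [hpow, ← Real.mul_rpow (by norm_num) (by positivity)]
  refine Real.rpow_le_rpow (by positivity) ?_ hδ
  rw [← div_eq_mul_inv, div_le_div_iff₀ (by positivity) (by positivity)]
  linarith [sq_nonneg (1 - r)]

lemma integral_fracWeight_mul_exp_le (n : ℕ) {δ : ℝ} (hδ : 1 ≤ δ) {r : ℝ} (hr : 0 ≤ r) :
    ∫ t in Set.Ioc (0 : ℝ) 1, fracWeight n δ t * Real.exp (-((1 - t) * r ^ 2 / 4)) ≤
      Real.exp (1 / 4) * 8 ^ δ * Real.Gamma δ * (1 + r) ^ (-(2 * δ)) := by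
  have hδ0 : 0 < δ := one_pos.trans_le hδ
  have hcont := continuous_one_sub_rpow hδ
  have := Real.Gamma_pos_of_pos hδ0
  calc _ ≤ ∫ t in Set.Ioc (0 : ℝ) 1, Real.exp (1 / 4) *
        ((1 - t) ^ (δ - 1) * Real.exp (-((1 + r ^ 2) / 4 * (1 - t)))) :=
        setIntegral_mono_on (integrableOn_Ioc_of_continuous (by unfold fracWeight; fun_prop))
          (integrableOn_Ioc_of_continuous (by fun_prop)) measurableSet_Ioc
          fun t ht => fracWeight_mul_exp_le ht n δ r
    _ ≤ Real.exp (1 / 4) * ((1 / ((1 + r ^ 2) / 4)) ^ δ * Real.Gamma δ) := by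
        rw [integral_const_mul]
        gcongr
        exact integral_one_sub_rpow_mul_exp_le hδ0 (by positivity)
    _ ≤ Real.exp (1 / 4) * (8 ^ δ * (1 + r) ^ (-(2 * δ)) * Real.Gamma δ) := by
        gcongr
        exact one_div_one_add_sq_rpow_le hδ0.le hr
    _ = _ := by ring

theorem isBoundedMultiplier_Gamma_div_Gamma (hn : 1 ≤ n) (p a : ℝ) [Fact (1 < p)] {δ : ℝ}
    (hδ : 1 ≤ δ) : IsBoundedMultiplier n p a (a + -(2 * δ)) fun k =>
      Real.Gamma (n + k) * Real.Gamma δ / Real.Gamma (n + k + δ) := by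
  have hδ0 : 0 < δ := one_pos.trans_le hδ
  have := Real.Gamma_pos_of_pos hδ0
  have hcont : Continuous (fracWeight n δ) :=
    (continuous_pow (n - 1)).mul (continuous_one_sub_rpow hδ)
  simp only [← integral_fracWeight_mul_pow hn hδ0]
  refine isBoundedMultiplier_integral_mul_pow n p a hcont (fun t ht =>
    mul_nonneg (pow_nonneg ht.1.le _) (Real.rpow_nonneg (sub_nonneg.2 ht.2) _))
    (K := .mk (Real.exp (1 / 4) * 8 ^ δ * Real.Gamma δ) (by positivity))
    fun r hr => integral_fracWeight_mul_exp_le n hδ hr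

lemma Gamma_add_natCast {x : ℝ} (hx : ∀ j : ℕ, x ≠ -j) (m : ℕ) :
    Real.Gamma (x + m) = (∏ j ∈ Finset.range m, (x + j)) * Real.Gamma x := by
  induction m with
  | zero => simp
  | succ m ih =>
    rw [Nat.cast_succ, ← add_assoc, Real.Gamma_add_one fun h => hx m (eq_neg_of_add_eq_zero_left h),
      ih, Finset.prod_range_succ]
    ring

/-- With `m - σ/2 ≥ 1`, the factor `Γ(n+k) / Γ(n+k-σ/2)` is the product of
`Γ(n+k) / Γ(n+k-σ/2+m)` and `Γ(n+k-σ/2+m) / Γ(n+k-σ/2)`. -/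
theorem isBoundedMultiplier_inv_coef (hn : 1 ≤ n) (p a σ : ℝ) [Fact (1 < p)] :
    IsBoundedMultiplier n p a (a + σ) fun k => (coef n σ k)⁻¹ := by
  obtain ⟨m, hm⟩ := exists_nat_ge (σ / 2 + 1)
  set δ : ℝ := m - σ / 2 with hδ
  have hδ1 : 1 ≤ δ := by linarith
  have hmult := ((isBoundedMultiplier_Gamma_div_Gamma hn p a hδ1).comp
    (isBoundedMultiplier_prod_add_const n p (a + -(2 * δ)) (n - σ / 2) m)).comp
    (.const n p _ (Real.Gamma δ)⁻¹)
  have hexponent : a + -(2 * δ) + 2 * m = a + σ := by linarith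
  rw [hexponent] at hmult
  refine hmult.congr_of_le (cut n σ) fun k hk => ?_
  have hpos : 0 < n + k - σ / 2 := pos_of_cut_le hk
  have hprod : ∏ j ∈ Finset.range m, (k + (n - σ / 2 + j)) =
      ∏ j ∈ Finset.range m, (n + k - σ / 2 + j) :=
    Finset.prod_congr rfl fun j _ => by ring
  have hΓ : Real.Gamma (n + k + δ) = (∏ j ∈ Finset.range m, (n + k - σ / 2 + j)) *
      Real.Gamma (n + k - σ / 2) := by
    rw [← Gamma_add_natCast fun j h => by linarith [j.cast_nonneg (α := ℝ)], hδ]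
    ring_nf
  have hprod0 : ∏ j ∈ Finset.range m, (n + k - σ / 2 + j : ℝ) ≠ 0 :=
    (Finset.prod_pos fun j _ => by positivity).ne'
  have hδ0 := (Real.Gamma_pos_of_pos (one_pos.trans_le hδ1)).ne'
  have hΓ0 := (Real.Gamma_pos_of_pos hpos).ne'
  rw [coef, if_neg (not_lt.2 hk), inv_div, hprod, hΓ]
  generalize ∏ j ∈ Finset.range m, (n + k - σ / 2 + j : ℝ) = P at hprod0 ⊢
  generalize Real.Gamma (n + k - σ / 2) = G at hΓ0 ⊢
  field_simp

/-! ### The duality -/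

lemma pairing_conj_symm (σ : ℝ) (f g : Cn n → ℂ) :
    starRingEnd ℂ (pairing σ f g) = pairing σ g f := by
  have hint : ∀ (τ : ℝ) (ψ φ : Cn n → ℂ),
      starRingEnd ℂ (intPairing τ ψ φ) = intPairing τ φ ψ := fun τ ψ φ => by
    rw [intPairing, ← integral_conj]
    refine integral_congr_ae (Eventually.of_forall fun z => ?_)
    simp only [integrand, map_mul, Complex.conj_conj, Complex.conj_ofReal, mul_comm (ψ z)]
  rw [pairing_eq, pairing_eq, map_add, hint, hint]

lemma pairing_smul_left (σ : ℝ) {f : Cn n → ℂ} (hf : ContDiff ℂ ∞ f) (c : ℂ) (g : Cn n → ℂ) :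
    pairing σ (c • f) g = c * pairing σ f g := by
  simp only [pairing_eq, mul_add, intPairing, ← integral_const_mul, integrand, highSum,
    lowSum_const_smul _ hf, Pi.smul_apply, smul_eq_mul, ← mul_sub, mul_assoc]

lemma pairing_smul_right (σ : ℝ) (f : Cn n → ℂ) {g : Cn n → ℂ} (hg : ContDiff ℂ ∞ g) (c : ℂ) :
    pairing σ f (c • g) = starRingEnd ℂ c * pairing σ f g := by
  rw [← pairing_conj_symm, pairing_smul_left σ hg, map_mul, pairing_conj_symm]

section Fact

variable [Fact (1 < p)] [Fact (1 < q)]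

lemma pairing_add_left (hn : 1 ≤ n) (hpq : p.HolderConjugate q) (f₁ f₂ : FockSpace n p (a * p))
    (g : FockSpace n q (b * q)) :
    pairing (a + b) (f₁ + f₂ : Cn n → ℂ) g =
      pairing (a + b) f₁ g + pairing (a + b) f₂ g := by
  have hcut := neg_two_mul_lt_two_mul_cut_sub n (a + b)
  simp only [pairing_eq, intPairing]
  rw [add_add_add_comm,
    ← integral_add (integrable_lowSum hpq _ f₁ g) (integrable_lowSum hpq _ f₂ g),
    ← integral_add (integrable_highSum hn hpq hcut f₁ g) (integrable_highSum hn hpq hcut f₂ g)]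
  simp only [integrand, highSum, Pi.add_apply, ← add_mul,
    lowSum_add _ f₁.contDiff f₂.contDiff, add_sub_add_comm]

lemma pairing_add_right (hn : 1 ≤ n) (hpq : p.HolderConjugate q) (f : FockSpace n p (a * p))
    (g₁ g₂ : FockSpace n q (b * q)) :
    pairing (a + b) f (g₁ + g₂ : Cn n → ℂ) =
      pairing (a + b) f g₁ + pairing (a + b) f g₂ := by
  rw [← pairing_conj_symm, add_comm a b, pairing_add_left hn hpq.symm, map_add, pairing_conj_symm,
    pairing_conj_symm]

/-- The pairing as a continuous sesquilinear map, conjugate-linear in its first argument `g`. -/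
def pairingMap (hn : 1 ≤ n) (hpq : p.HolderConjugate q) (a b : ℝ) :
    FockSpace n q (b * q) →SL[starRingEnd ℂ] StrongDual ℂ (FockSpace n p (a * p)) :=
  LinearMap.mkContinuous₂
    (LinearMap.mk₂'ₛₗ (starRingEnd ℂ) (RingHom.id ℂ) (fun g f => pairing (a + b) f g)
      (fun g₁ g₂ f => pairing_add_right hn hpq f g₁ g₂)
      (fun c g f => pairing_smul_right _ f g.contDiff c)
      (fun g f₁ f₂ => pairing_add_left hn hpq f₁ f₂ g)
      (fun c g f => pairing_smul_left _ f.contDiff c g))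
    (exists_norm_pairing_le hn hpq a b).choose fun g f => by
      rw [mul_right_comm]
      exact (exists_norm_pairing_le hn hpq a b).choose_spec f g

@[simp] lemma pairingMap_apply (hn : 1 ≤ n) (hpq : p.HolderConjugate q)
    (g : FockSpace n q (b * q)) (f : FockSpace n p (a * p)) :
    pairingMap hn hpq a b g f = pairing (a + b) f g := rfl

theorem pairingMap_injective (hn : 1 ≤ n) (hpq : p.HolderConjugate q) (a b : ℝ) :
    Function.Injective (pairingMap hn hpq a b) := by
  rw [injective_iff_map_eq_zero]
  intro g hg
  have hcomp : ∀ k w, homComp g k w = 0 := fun k w => by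
    have h := pairing_kernelCompF hn hpq (a := a) k w g
    rw [← pairingMap_apply hn hpq, hg, zero_apply, eq_comm, mul_eq_zero,
      map_eq_zero] at h
    exact h.resolve_left (Complex.ofReal_ne_zero.2 (coef_pos hn (a + b) k).ne')
  refine FockSpace.ext fun w => (hasSum_homComp g.contDiff w).unique ?_
  simp only [hcomp]
  exact hasSum_zero

lemma pairingMap_eq_of_homComp_eq (hn : 1 ≤ n) (hpq : p.HolderConjugate q)
    {L : StrongDual ℂ (FockSpace n p (a * p))} {g : FockSpace n q (b * q)}
    (hg : ∀ k w, homComp g k w =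
      ((coef n (a + b) k)⁻¹ : ℝ) * starRingEnd ℂ (L (kernelCompF p a k w))) :
    pairingMap hn hpq a b g = L := by
  rw [← sub_eq_zero]
  refine eq_zero_of_kernelF _ fun w =>
    ((hasSum_kernelCompF p a w).mapL (pairingMap hn hpq a b g - L)).unique ?_
  have hcomp : ∀ k, (pairingMap hn hpq a b g - L) (kernelCompF p a k w) = 0 := fun k => by
    have hcoef : (coef n (a + b) k : ℂ) ≠ 0 := Complex.ofReal_ne_zero.2 (coef_pos hn (a + b) k).ne'
    rw [sub_apply, pairingMap_apply, pairing_kernelCompF hn hpq, hg, map_mul,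
      Complex.conj_conj, Complex.conj_ofReal, Complex.ofReal_inv,
      mul_inv_cancel_left₀ hcoef, sub_self]
  simp only [hcomp]
  exact hasSum_zero

theorem exists_pairingMap_eq (hn : 1 ≤ n) (hpq : p.HolderConjugate q) (a b : ℝ) :
    ∃ C : ℝ≥0, ∀ L : StrongDual ℂ (FockSpace n p (a * p)),
      ∃ g : FockSpace n q (b * q), pairingMap hn hpq a b g = L ∧ ‖g‖ ≤ C * ‖L‖ := by
  obtain ⟨C, hC⟩ := exists_norm_transformF_le n hpq a
  have hmult := isBoundedMultiplier_inv_coef hn q (-a) (a + b)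
  rw [neg_add_cancel_left] at hmult
  obtain ⟨D, hD⟩ := hmult
  refine ⟨D * C, fun L => ?_⟩
  obtain ⟨g, hg, hle⟩ := hD (transformF hpq L)
  refine ⟨g, pairingMap_eq_of_homComp_eq hn hpq fun k w => ?_, hle.trans ?_⟩
  · rw [hg, homComp_transformF]
  · rw [NNReal.coe_mul, mul_assoc]
    exact mul_le_mul_of_nonneg_left (hC L) D.coe_nonneg

end Fact

end Fock

end

theorem theorem5p5 (n : ℕ) (hn : 1 ≤ n) (p q : ℝ) [Fact (1 < p)] [Fact (1 < q)]
    (hpq : 1 / p + 1 / q = 1) (α β : ℝ) :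
    (∀ (f : Fock.FockSpace n p (α * p)) (g : Fock.FockSpace n q (β * q)),
      Fock.PairingConverges (α + β) f g) ∧
    ∃ Φ : Fock.FockSpace n q (β * q) ≃ₛₗ[starRingEnd ℂ]
        StrongDual ℂ (Fock.FockSpace n p (α * p)),
      (∀ (g : Fock.FockSpace n q (β * q)) (f : Fock.FockSpace n p (α * p)),
        Φ g f = Fock.pairing (α + β) f g) ∧
      ∃ C : ℝ, 0 < C ∧ ∀ g : Fock.FockSpace n q (β * q),
        C⁻¹ * ‖g‖ ≤ ‖Φ g‖ ∧ ‖Φ g‖ ≤ C * ‖g‖ := by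
  have hconj : p.HolderConjugate q :=
    Real.holderConjugate_iff.2 ⟨Fact.out, by simpa only [one_div] using hpq⟩
  let M := Fock.pairingMap hn hconj α β
  have hinj : Function.Injective M := Fock.pairingMap_injective hn hconj α β
  obtain ⟨D, hD⟩ := Fock.exists_pairingMap_eq hn hconj α β
  have hsurj : Function.Surjective M := fun L => (hD L).imp fun _ hg => hg.1
  have hlower : ∀ g, ‖g‖ ≤ D * ‖M g‖ := fun g => by
    obtain ⟨g', hg', hle⟩ := hD (M g)
    exact hinj hg' ▸ hle
  have hC : 0 < max (max ‖M‖ D) 1 := lt_max_of_lt_right one_pos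
  refine ⟨Fock.pairingConverges hn hconj, .ofBijective M.toLinearMap ⟨hinj, hsurj⟩,
    fun _ _ => rfl, max (max ‖M‖ D) 1, hC, fun g => ⟨?_, ?_⟩⟩
  · exact (inv_mul_le_iff₀ hC).2 ((hlower g).trans
      (mul_le_mul_of_nonneg_right (le_max_of_le_left (le_max_right _ _)) (norm_nonneg _)))
  · exact (M.le_opNorm g).trans
      (mul_le_mul_of_nonneg_right (le_max_of_le_left (le_max_left _ _)) (norm_nonneg _))
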